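/- For $\xi\in\mathbb R^2$ let $$G(\xi)=\frac1{4\pi}e^{-|\xi|^2/4},\qquad v^G(\xi)=\frac1{2\pi}\frac{\xi^\perp}{|\xi|^2}\bigl(1-e^{-|\xi|^2/4}\bigr),\qquad \xi^\perp=(-\xi_2,\xi_1).$$ For $m>1$ let $L^2(m)$ be the space of complex-valued $w\in L^2(\mathbb R^2)$ with $\int_{\mathbb R^2}(1+|\xi|^2)^m|w(\xi)|^2\,d\xi<\infty$, let $L^2_0(m)=\{w\in L^2(m):\int_{\mathbb R^2} w\,d\xi=0\}$ and, for $m>2$, let $L^2_1(m)=\{w\in L^2_0(m):\int_{\mathbb R^2}\xi_j w\,d\xi=0,\ j=1,2\}$. Define, with derivatives in the sense of distributions, $$\mathcal Lw=\Delta w+\tfrac12\,\xi\cdot\nabla w+w,\qquad \Lambda w=v^G\cdot\nabla w+v\cdot\nabla G,\qquad v(\xi)=\frac1{2\pi}\int_{\mathbb R^2}\frac{(\xi-\eta)^\perp}{|\xi-\eta|^2}\,w(\eta)\,d\eta ,$$ and consider $\mathcal L-\alpha\Lambda$ in $L^2(m)$ on the maximal domain $\mathcal D_m(\mathcal L)=\{w\in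 L^2(m):\Delta w+\tfrac12\xi\cdot\nabla w\in L^2(m)\}$. For a subspace $V\subset L^2(m)$, a number $\lambda\in\mathbb C$ is called an eigenvalue of $\mathcal L-\alpha\Lambda$ in $V$ if there is a nonzero $w\in V\cap\mathcal D_m(\mathcal L)$ with $(\mathcal L-\alpha\Lambda)w=\lambda w$. Fix $m>1$ and $\alpha\in\mathbb R$. Then every eigenvalue $\lambda$ of $\mathcal L-\alpha\Lambda$ in $L^2_0(m)$ satisfies $$\operatorname{Re}\lambda\le\max\Bigl(-\frac12,\ \frac{1-m}2\Bigr).$$ If moreover $m>2$, then every eigenvalue $\lambda$ of $\mathcal L-\alpha\Lambda$ in $L^2_1(m)$ satisfies $$\operatorname{Re}\lambda\le\max\Bigl(-1,\ \frac{1-m}2\Bigr).$$ -/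

import Mathlib

open MeasureTheory
open scoped ContDiff

noncomputable section

namespace OseenVortex

/-- The Euclidean plane. -/
abbrev Plane := EuclideanSpace ℝ (Fin 2)

/-- `(x₁, x₂)^⊥ = (-x₂, x₁)`. -/
def perp (x : Plane) : Plane := !₂[-(x 1), x 0]

/-- The Gaussian profile `G(ξ) = e^{-|ξ|²/4} / (4π)` of the Oseen vortex. -/
def G (ξ : Plane) : ℝ := 1 / (4 * Real.pi) * Real.exp (-‖ξ‖ ^ 2 / 4)

/-- The velocity field of the Oseen vortex,
`v^G(ξ) = (2π)⁻¹ |ξ|⁻² (1 - e^{-|ξ|²/4}) ξ^⊥` (with value `0` at the origin, which makes it smooth). -/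
def vG (ξ : Plane) : Plane :=
  (1 / (2 * Real.pi) * ((1 - Real.exp (-‖ξ‖ ^ 2 / 4)) / ‖ξ‖ ^ 2)) • perp ξ

/-- The `j`-th component of the velocity field given by the Biot-Savart law,
`v(ξ) = (2π)⁻¹ ∫ (ξ - η)^⊥ / |ξ - η|² w(η) dη`. -/
def biotSavart (w : Plane → ℂ) (j : Fin 2) (ξ : Plane) : ℂ :=
  (1 / (2 * Real.pi) : ℂ) * ∫ η : Plane, ((perp (ξ - η) j / ‖ξ - η‖ ^ 2 : ℝ) : ℂ) * w η

/-! ### Weighted spaces (elements are functions, to be read up to almost everywhere equality) -/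

/-- The weight `b(ξ) = (1 + |ξ|²)^{1/2}`. -/
def b (ξ : Plane) : ℝ := Real.sqrt (1 + ‖ξ‖ ^ 2)

/-- `L²(m)`: complex functions `f ∈ L²(ℝ²)` such that `b^m f ∈ L²(ℝ²)`. -/
def L2 (m : ℝ) : Set (Plane → ℂ) :=
  {f | MemLp f 2 volume ∧ MemLp (fun ξ => ((b ξ ^ m : ℝ) : ℂ) * f ξ) 2 volume}

/-- `L²₀(m)`: the functions of `L²(m)` with zero mass. -/
def L20 (m : ℝ) : Set (Plane → ℂ) :=
  {w | w ∈ L2 m ∧ ∫ ξ : Plane, w ξ = 0}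

/-- `L²₁(m)`: the functions of `L²₀(m)` with zero first moments. -/
def L21 (m : ℝ) : Set (Plane → ℂ) :=
  {w | w ∈ L20 m ∧ ∀ j : Fin 2, ∫ ξ : Plane, ((ξ j : ℝ) : ℂ) * w ξ = 0}

/-! ### Differential operators in the sense of distributions

A distribution is given by its values on test functions; functionals are compared
only on test functions, see `DistEq`. -/

/-- Test functions: complex `C^∞` functions with compact support. -/
def IsTest (φ : Plane → ℂ) : Prop := ContDiff ℝ ∞ φ ∧ HasCompactSupport φ

/-- The classical partial derivative `∂_j f`. -/
def pd {F : Type*} [NormedAddCommGroup F] [NormedSpace ℝ F] (j : Fin 2) (f : Plane → F)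
    (ξ : Plane) : F :=
  fderiv ℝ f ξ (EuclideanSpace.single j (1 : ℝ))

/-- Functionals `φ ↦ ⟨T, φ⟩`. -/
abbrev Functional := (Plane → ℂ) → ℂ

/-- The distribution defined by a function, `φ ↦ ∫ w φ`. -/
def ofFun (w : Plane → ℂ) : Functional := fun φ => ∫ ξ : Plane, w ξ * φ ξ

/-- The distributional derivative, `⟨∂_j T, φ⟩ = -⟨T, ∂_j φ⟩`. -/
def dd (j : Fin 2) (T : Functional) : Functional := fun φ => -T (pd j φ)

/-- The product of a distribution with a smooth real function, `⟨a T, φ⟩ = ⟨T, a φ⟩`. -/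
def mulFun (a : Plane → ℝ) (T : Functional) : Functional :=
  fun φ => T (fun ξ => ((a ξ : ℝ) : ℂ) * φ ξ)

/-- Equality of distributions. -/
def DistEq (S T : Functional) : Prop := ∀ φ : Plane → ℂ, IsTest φ → S φ = T φ

/-- `Δ w + ½ ξ·∇ w` as a distribution. -/
def principalPart (w : Plane → ℂ) : Functional :=
  (∑ j : Fin 2, dd j (dd j (ofFun w))) +
    (1 / 2 : ℂ) • ∑ j : Fin 2, mulFun (fun ξ => ξ j) (dd j (ofFun w))

/-- `ℒ w = Δ w + ½ ξ·∇ w + w` as a distribution. -/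
def opL (w : Plane → ℂ) : Functional := principalPart w + ofFun w

/-- `Λ w = v^G·∇ w + v·∇ G` as a distribution, where `v` is obtained from `w`
by the Biot-Savart law. -/
def opLam (w : Plane → ℂ) : Functional :=
  (∑ j : Fin 2, mulFun (fun ξ => vG ξ j) (dd j (ofFun w))) +
    ofFun (fun ξ => ∑ j : Fin 2, biotSavart w j ξ * ((pd j G ξ : ℝ) : ℂ))

/-- The maximal domain `𝒟_m(ℒ) = {w ∈ L²(m) | Δ w + ½ ξ·∇ w ∈ L²(m)}`. -/
def domL (m : ℝ) : Set (Plane → ℂ) :=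
  {w | w ∈ L2 m ∧ ∃ h ∈ L2 m, DistEq (principalPart w) (ofFun h)}

/-- The graph of `ℒ - αΛ` in `L²(m)`, with domain `𝒟_m(ℒ)`: `w ∈ 𝒟_m(ℒ)`, `f ∈ L²(m)` and
`(ℒ - αΛ) w = f`. -/
def LinGraph (m α : ℝ) (w f : Plane → ℂ) : Prop :=
  w ∈ domL m ∧ f ∈ L2 m ∧ DistEq (opL w - (α : ℂ) • opLam w) (ofFun f)

/-- `z` is an eigenvalue of `ℒ - αΛ` in the subspace `V` of `L²(m)`: there is an eigenfunction
in `V` that does not vanish almost everywhere. -/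
def IsEigenvalueIn (m α : ℝ) (V : Set (Plane → ℂ)) (z : ℂ) : Prop :=
  ∃ w ∈ V, ¬ (w =ᵐ[volume] 0) ∧ LinGraph m α w (z • w)

end OseenVortex

end

open MeasureTheory
open scoped ContDiff
noncomputable section
namespace OseenVortex
open Filter Topology Set
open scoped ENNReal Convolution

/-! ### Partial derivatives and integration by parts -/

/-! With `B = ξ/2 - α v^G`, which has divergence one, the eigenvalue equation reads `Δw + div(B w) =
z w + α v·∇G`. The bound follows from an energy argument in the Gaussian-weighted space. There `ℒ`
is conjugate to minus a harmonic oscillator with eigenvalues `0, -1/2, -1, ...`, and `Λ` is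
antisymmetric, so `α` does not affect the real part. An eigenfunction in `L²(m)` need not belong to
that space; this accounts for the `(1-m)/2` in the maximum.

Decay (`integrable_exp_mul_norm_sq_of_lt`): if `Re z > (1-m)/2`, then `e^{|ξ|²/4}|w|²` is
integrable. Test the equation with the radial weight `(1+t)^m / (ε + e^{-t/4})`, where `t = |ξ|²`.
It is controlled by the `L²(m)` weight for fixed `ε` and tends to `(1+t)^m e^{t/4}` as `ε → 0`. For
large `t` the zeroth-order coefficient in the energy inequality is negative uniformly in `ε`,
because `1/2 - m/2 - Re z < 0` (`wtLog_quadratic_le`). Bounded `t` contributes a constant, and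
`v·∇G` has Gaussian decay.

Gap (`re_le_of_forall_lowIdx`): with the weight `e^{t/4}`, the function `u = e^{t/8} w` turns the
energy into that of the oscillator. The transport by `v^G` drops out because `v^G` is divergence
free and tangential to circles, while the weight is radial. In `v·∇G` the weight cancels the
Gaussian in `∇G = -ξ G/2`. What remains is a double integral with kernel `ξ·(ξ-η)^⊥/|ξ-η|²`,
antisymmetric in `ξ, η`, hence of zero real part (`integral_exp_mul_velGradG_eq_zero`). If `u` is
orthogonal to the Hermite functions of degree below `k`, the oscillator gap gives `Re z ≤ -k/2`.
Since these functions are polynomials times `e^{-t/8}`, orthogonality says that the moments of `w`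
of order below `k` vanish: zero mass for `k = 1`, and zero first moments as well for `k = 2`.

The function `w` is only in `L²`, so the energy inequality is proved for mollifications. The
commutator of mollification with multiplication by `B` tends to zero locally in `L²` and is absorbed
by Young's inequality (`exists_approx_energy`). The oscillator gap comes from the completeness of
the Hermite functions together with ladder operators (`harmonic_oscillator_gap`). -/

theorem pd_mul {𝕂 : Type*} [NormedRing 𝕂] [NormedAlgebra ℝ 𝕂] {f g : Plane → 𝕂} {x : Plane}
    (j : Fin 2) (hf : DifferentiableAt ℝ f x) (hg : DifferentiableAt ℝ g x) :
    pd j (fun y => f y * g y) x = f x * pd j g x + pd j f x * g x := by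
  simp only [pd]
  rw [fderiv_fun_mul' hf hg]
  simp

theorem pd_add {F : Type*} [NormedAddCommGroup F] [NormedSpace ℝ F] {f g : Plane → F} {x : Plane}
    (j : Fin 2) (hf : DifferentiableAt ℝ f x) (hg : DifferentiableAt ℝ g x) :
    pd j (fun y => f y + g y) x = pd j f x + pd j g x := by
  simp only [pd]
  rw [fderiv_fun_add hf hg]
  simp

theorem pd_clm_comp {F H : Type*} [NormedAddCommGroup F] [NormedSpace ℝ F] [NormedAddCommGroup H]
    [NormedSpace ℝ H] (L : F →L[ℝ] H) {f : Plane → F} {x : Plane}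
    (j : Fin 2) (hf : DifferentiableAt ℝ f x) :
    pd j (fun y => L (f y)) x = L (pd j f x) := by
  simp only [pd]
  have := (L.hasFDerivAt.comp x hf.hasFDerivAt).fderiv
  simp only [Function.comp_def] at this
  rw [this]
  simp

theorem pd_ofReal {f : Plane → ℝ} {x : Plane} (j : Fin 2) (hf : DifferentiableAt ℝ f x) :
    pd j (fun y => ((f y : ℝ) : ℂ)) x = ((pd j f x : ℝ) : ℂ) :=
  pd_clm_comp Complex.ofRealCLM j hf

theorem pd_conj {f : Plane → ℂ} {x : Plane} (j : Fin 2) (hf : DifferentiableAt ℝ f x) :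
    pd j (fun y => (starRingEnd ℂ) (f y)) x = (starRingEnd ℂ) (pd j f x) :=
  pd_clm_comp (Complex.conjCLE : ℂ →L[ℝ] ℂ) j hf

theorem pd_coord (i j : Fin 2) (x : Plane) :
    pd j (fun y : Plane => y i) x = if i = j then 1 else 0 := by
  simp only [pd]
  have : HasFDerivAt (fun y : Plane => y i) (EuclideanSpace.proj i : Plane →L[ℝ] ℝ) x :=
    (EuclideanSpace.proj i : Plane →L[ℝ] ℝ).hasFDerivAt
  rw [this.fderiv]
  simp

theorem norm_sq_eq (x : Plane) : ‖x‖ ^ 2 = x 0 ^ 2 + x 1 ^ 2 := by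
  simp [EuclideanSpace.norm_sq_eq, Fin.sum_univ_two]

theorem hasFDerivAt_radial {S : ℝ → ℝ} {S' : ℝ} {x : Plane} (h : HasDerivAt S S' (‖x‖ ^ 2)) :
    HasFDerivAt (fun y : Plane => S (‖y‖ ^ 2)) (S' • (2 • innerSL ℝ x)) x := by
  exact h.comp_hasFDerivAt x (hasStrictFDerivAt_norm_sq x).hasFDerivAt

theorem pd_radial {S : ℝ → ℝ} {S' : ℝ} {x : Plane} (h : HasDerivAt S S' (‖x‖ ^ 2)) (j : Fin 2) :
    pd j (fun y : Plane => S (‖y‖ ^ 2)) x = 2 * x j * S' := by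
  simp only [pd]
  rw [(hasFDerivAt_radial h).fderiv]
  simp [EuclideanSpace.inner_single_right]
  ring

theorem contDiff_pd {F : Type*} [NormedAddCommGroup F] [NormedSpace ℝ F] {f : Plane → F}
    {n k : WithTop ℕ∞} (hf : ContDiff ℝ n f) (hk : k + 1 ≤ n) (j : Fin 2) : ContDiff ℝ k (pd j f) :=
  (hf.fderiv_right hk).clm_apply contDiff_const

theorem continuous_pd {F : Type*} [NormedAddCommGroup F] [NormedSpace ℝ F] {f : Plane → F}
    (hf : ContDiff ℝ 1 f) (j : Fin 2) : Continuous (pd j f) :=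
  (contDiff_pd (k := 0) hf (by simp) j).continuous

theorem _root_.HasCompactSupport.pd {F : Type*} [NormedAddCommGroup F] [NormedSpace ℝ F]
    {f : Plane → F} (hf : HasCompactSupport f) (j : Fin 2) : HasCompactSupport (pd j f) :=
  hf.fderiv_apply ℝ _

theorem integral_pd_eq_zero {𝕂 : Type*} [RCLike 𝕂] {f : Plane → 𝕂} (hf : Differentiable ℝ f)
    (j : Fin 2) (hi : Integrable f) (hi' : Integrable (pd j f)) : ∫ x, pd j f x = 0 := by
  have := integral_mul_fderiv_eq_neg_fderiv_mul_of_integrable (μ := (volume : Measure Plane))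
    (f := fun _ => (1 : 𝕂)) (g := f) (v := EuclideanSpace.single j (1 : ℝ)) (by simp)
    (by simpa using! hi') (by simpa using hi) (fun _ _ => by fun_prop) (fun x _ => hf x)
  simpa [pd] using this

theorem integral_pd_eq_zero_of_hasCompactSupport {𝕂 : Type*} [RCLike 𝕂] {f : Plane → 𝕂}
    (hf : ContDiff ℝ 1 f) (hc : HasCompactSupport f) (j : Fin 2) : ∫ x, pd j f x = 0 :=
  integral_pd_eq_zero (hf.differentiable (by simp)) j
    (hf.continuous.integrable_of_hasCompactSupport hc)
    ((continuous_pd hf j).integrable_of_hasCompactSupport (hc.pd j))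

/-! ### Mollification -/

/-- The convolution `ρ * f` of a complex function with a real kernel. -/
def moll (ρ : Plane → ℝ) (f : Plane → ℂ) (x : Plane) : ℂ := ∫ y, f y * ((ρ (x - y) : ℝ) : ℂ)

theorem moll_eq_convolution (ρ : Plane → ℝ) (f : Plane → ℂ) :
    moll ρ f = f ⋆[(ContinuousLinearMap.lsmul ℝ ℝ : ℝ →L[ℝ] ℂ →L[ℝ] ℂ).flip, volume] ρ := by
  ext x
  simp [moll, convolution, mul_comm]

theorem contDiff_moll {ρ : Plane → ℝ} {f : Plane → ℂ} (hρ : ContDiff ℝ ∞ ρ)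
    (hc : HasCompactSupport ρ) (hf : LocallyIntegrable f) : ContDiff ℝ ∞ (moll ρ f) := by
  rw [moll_eq_convolution]
  exact hc.contDiff_convolution_right _ hf hρ

theorem pd_moll {ρ : Plane → ℝ} {f : Plane → ℂ} (hρ : ContDiff ℝ ∞ ρ)
    (hc : HasCompactSupport ρ) (hf : LocallyIntegrable f) (j : Fin 2) :
    pd j (moll ρ f) = moll (pd j ρ) f := by
  ext x
  rw [moll_eq_convolution, moll_eq_convolution]
  have h1 : ContDiff ℝ 1 ρ := hρ.of_le (by exact_mod_cast le_top)
  have := hc.hasFDerivAt_convolution_right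
    (ContinuousLinearMap.lsmul ℝ ℝ : ℝ →L[ℝ] ℂ →L[ℝ] ℂ).flip hf h1 x
  simp only [pd]
  rw [this.fderiv, convolution_precompR_apply _ hf (hc.fderiv ℝ) (h1.continuous_fderiv (by simp))]
  rfl

/-- Continuity of translations in `L²`, obtained from the continuity of composition with a
continuous family of measure-preserving maps. -/
theorem tendsto_eLpNorm_translate {f : Plane → ℂ} (hf : MemLp f 2) :
    Tendsto (fun y : Plane => eLpNorm (fun x => f (x - y) - f x) 2 volume) (𝓝 0) (𝓝 0) := by
  have hm : ∀ y : Plane, MeasurePreserving (fun x : Plane => x - y) volume volume :=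
    fun y => measurePreserving_sub_right _ y
  let g : Plane → C(Plane, Plane) := fun y => ⟨fun x => x - y, by fun_prop⟩
  have hg : Continuous g := by
    have : Continuous (fun p : Plane × Plane => p.2 - p.1) := by fun_prop
    exact (ContinuousMap.curry ⟨_, this⟩).continuous
  have hc : Continuous (fun y => Lp.compMeasurePreserving (g y) (hm y) (hf.toLp f)) :=
    Continuous.compMeasurePreservingLp continuous_const hg hm (by norm_num)
  have h0 := (hc.tendsto 0)
  have h1 := tendsto_iff_edist_tendsto_0.1 h0
  refine h1.congr fun y => ?_
  rw [Lp.edist_def]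
  refine eLpNorm_congr_ae ?_
  have a1 := Lp.coeFn_compMeasurePreserving (hf.toLp f) (hm y)
  have a2 := Lp.coeFn_compMeasurePreserving (hf.toLp f) (hm 0)
  have b1 := (hm y).quasiMeasurePreserving.ae_eq_comp hf.coeFn_toLp
  have b2 := (hm 0).quasiMeasurePreserving.ae_eq_comp hf.coeFn_toLp
  filter_upwards [a1, a2, b1, b2] with x h1 h2 h3 h4
  simp only [Function.comp_apply] at h1 h2 h3 h4
  simp only [Pi.sub_apply]
  have e1 : (Lp.compMeasurePreserving (g y) (hm y) (hf.toLp f)) x = f (x - y) := by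
    rw [← h3]; exact h1
  have e2 : (Lp.compMeasurePreserving (g 0) (hm 0) (hf.toLp f)) x = f x := by
    rw [sub_zero] at h4
    rw [← h4]
    exact h2.trans (by rw [sub_zero])
  rw [e1, e2]

theorem moll_congr_ae {ρ : Plane → ℝ} {f g : Plane → ℂ} (h : f =ᵐ[volume] g) :
    moll ρ f = moll ρ g := by
  ext x
  refine integral_congr_ae ?_
  filter_upwards [h] with y hy
  rw [hy]

theorem integrable_moll {ρ : Plane → ℝ} {f : Plane → ℂ} (hρ : Continuous ρ)
    (hc : HasCompactSupport ρ) (hf : LocallyIntegrable f) (x : Plane) :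
    Integrable (fun y => f y * ((ρ (x - y) : ℝ) : ℂ)) := by
  have := hc.convolutionExists_right
    (ContinuousLinearMap.lsmul ℝ ℝ : ℝ →L[ℝ] ℂ →L[ℝ] ℂ).flip hf hρ x
  refine this.congr (ae_of_all _ fun y => ?_)
  simp [mul_comm]

/-- The measure `ρ(y) dy` is a probability measure, so Jensen's inequality bounds `|ρ * f - f|²` at
`x` by the average of `|f(x - y) - f(x)|²` over `y`. Tonelli then exchanges the two integrations. -/
theorem eLpNorm_moll_sub_le {ρ : Plane → ℝ} {f : Plane → ℂ} (hρ : Continuous ρ)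
    (hc : HasCompactSupport ρ) (hnn : ∀ x, 0 ≤ ρ x) (h1 : ∫ x, ρ x = 1) (hf : MemLp f 2) {η : ℝ≥0∞}
    (hη : ∀ y ∈ Function.support ρ, eLpNorm (fun x => f (x - y) - f x) 2 volume ≤ η) :
    eLpNorm (fun x => moll ρ f x - f x) 2 volume ≤ η := by
  -- Tonelli needs joint measurability of `f(x - y) - f(x)`, hence a measurable representative. Both
  -- sides depend only on the class of `f`.
  wlog hsm : StronglyMeasurable f generalizing f
  · have hff := hf.1.ae_eq_mk
    have hmk : MemLp (hf.1.mk f) 2 := (memLp_congr_ae hff).1 hf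
    have := this hmk (fun y hy => ?_) hf.1.stronglyMeasurable_mk
    · refine le_trans (le_of_eq (eLpNorm_congr_ae ?_)) this
      rw [moll_congr_ae hff]
      filter_upwards [hff] with x hx
      rw [hx]
    · refine le_trans (le_of_eq (eLpNorm_congr_ae ?_)) (hη y hy)
      have hb := (measurePreserving_sub_right volume y).quasiMeasurePreserving.ae_eq_comp hff
      filter_upwards [hff, hb] with x hx hx'
      simp only [Function.comp_apply] at hx'
      rw [hx, hx']
  have hl : LocallyIntegrable f := hf.locallyIntegrable (by norm_num)
  have hρi : Integrable ρ := hρ.integrable_of_hasCompactSupport hc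
  set ν : Measure Plane := volume.withDensity (fun y => ENNReal.ofReal (ρ y)) with hν
  have hmeas : Measurable (fun y => ENNReal.ofReal (ρ y)) := hρ.measurable.ennreal_ofReal
  have hprob : IsProbabilityMeasure ν := by
    constructor
    rw [hν, withDensity_apply _ MeasurableSet.univ, Measure.restrict_univ,
      ← ofReal_integral_eq_lintegral_ofReal hρi (ae_of_all _ hnn), h1, ENNReal.ofReal_one]
  have hdm : Measurable (fun p : Plane × Plane => ‖f (p.1 - p.2) - f p.1‖ₑ ^ 2) := by
    have hfm := hsm.measurable
    fun_prop
  have key : ∀ x, ‖moll ρ f x - f x‖ₑ ^ 2 ≤ ∫⁻ y, ‖f (x - y) - f x‖ₑ ^ 2 ∂ν := by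
    intro x
    have hi1 : Integrable (fun y => f (x - y) * ((ρ y : ℝ) : ℂ)) := by
      have := (integrable_moll hρ hc hl x).comp_sub_left x
      simpa using this
    have e1 : moll ρ f x - f x = ∫ y, (f (x - y) - f x) * ((ρ y : ℝ) : ℂ) := by
      have a1 : moll ρ f x = ∫ y, f (x - y) * ((ρ y : ℝ) : ℂ) := by
        rw [moll, ← integral_sub_left_eq_self _ volume x]
        simp
      have a2 : f x = ∫ y, f x * ((ρ y : ℝ) : ℂ) := by
        rw [integral_const_mul, integral_complex_ofReal, h1]; simp
      conv_lhs => rw [a1, a2]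
      have hi2 : Integrable (fun y => f x * ((ρ y : ℝ) : ℂ)) := hρi.ofReal.const_mul _
      rw [← integral_sub hi1 hi2]
      simp only [sub_mul]
    have e2 : ‖moll ρ f x - f x‖ₑ ≤ ∫⁻ y, ‖f (x - y) - f x‖ₑ ∂ν := by
      rw [e1, hν, lintegral_withDensity_eq_lintegral_mul _ hmeas
        (by have := hsm.measurable; fun_prop)]
      refine (enorm_integral_le_lintegral_enorm _).trans (lintegral_mono fun y => ?_)
      rw [enorm_mul, Pi.mul_apply, mul_comm]
      gcongr
      rw [← ofReal_norm, Complex.norm_real, Real.norm_of_nonneg (hnn y)]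
    have hae : AEStronglyMeasurable (fun y => f (x - y) - f x) ν := by
      have := hsm.measurable
      exact Measurable.aestronglyMeasurable (by fun_prop)
    have e3 := eLpNorm_le_eLpNorm_of_exponent_le (p := 1) (q := 2) (by norm_num) hae
    rw [eLpNorm_one_eq_lintegral_enorm] at e3
    have e4 := pow_le_pow_left' (e2.trans e3) 2
    refine e4.trans (le_of_eq ?_)
    rw [eLpNorm_eq_lintegral_rpow_enorm_toReal (by norm_num) (by norm_num)]
    rw [← ENNReal.rpow_natCast, ← ENNReal.rpow_mul]
    norm_num
  have e5 : ∫⁻ x, ‖moll ρ f x - f x‖ₑ ^ 2 ≤ η ^ 2 := by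
    calc ∫⁻ x, ‖moll ρ f x - f x‖ₑ ^ 2 ≤ ∫⁻ x, ∫⁻ y, ‖f (x - y) - f x‖ₑ ^ 2 ∂ν :=
          lintegral_mono key
      _ = ∫⁻ y, (∫⁻ x, ‖f (x - y) - f x‖ₑ ^ 2) ∂ν := by
          rw [lintegral_lintegral_swap]
          exact hdm.aemeasurable
      _ ≤ ∫⁻ y, η ^ 2 ∂ν := by
          refine lintegral_mono_ae ?_
          rw [hν, ae_withDensity_iff hmeas]
          refine ae_of_all _ fun y hy => ?_
          have hy' : y ∈ Function.support ρ := fun h => hy (by simp [h])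
          have := pow_le_pow_left' (hη y hy') 2
          refine le_trans (le_of_eq ?_) this
          rw [eLpNorm_eq_lintegral_rpow_enorm_toReal (by norm_num) (by norm_num)]
          rw [← ENNReal.rpow_natCast, ← ENNReal.rpow_mul]
          norm_num
      _ = η ^ 2 := by simp
  rw [eLpNorm_eq_lintegral_rpow_enorm_toReal (by norm_num) (by norm_num)]
  have e6 : (∫⁻ x, ‖moll ρ f x - f x‖ₑ ^ (2 : ℝ≥0∞).toReal) ≤ η ^ (2 : ℝ) := by
    simpa using e5
  refine (ENNReal.rpow_le_rpow e6 (by norm_num)).trans (le_of_eq ?_)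
  rw [← ENNReal.rpow_mul]
  norm_num

/-- A sequence of smooth mollifiers. -/
def mollifier (n : ℕ) : Plane → ℝ :=
  (⟨1 / (2 * ((n : ℝ) + 1)), 1 / ((n : ℝ) + 1), by positivity,
    one_div_lt_one_div_of_lt (by positivity) (by linarith [(n.cast_nonneg : (0:ℝ) ≤ n)])⟩ :
      ContDiffBump (0 : Plane)).normed volume

theorem contDiff_mollifier (n : ℕ) : ContDiff ℝ ∞ (mollifier n) := ContDiffBump.contDiff_normed _

theorem hasCompactSupport_mollifier (n : ℕ) : HasCompactSupport (mollifier n) :=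
  ContDiffBump.hasCompactSupport_normed _

theorem support_mollifier (n : ℕ) :
    Function.support (mollifier n) = Metric.ball 0 (1 / ((n : ℝ) + 1)) :=
  ContDiffBump.support_normed_eq _

theorem tendsto_moll {f : Plane → ℂ} (hf : MemLp f 2) :
    Tendsto (fun n => eLpNorm (fun x => moll (mollifier n) f x - f x) 2 volume) atTop (𝓝 0) := by
  rw [ENNReal.tendsto_nhds_zero]
  intro η hη
  have h := (ENNReal.tendsto_nhds_zero.1 (tendsto_eLpNorm_translate hf)) η hη
  obtain ⟨δ, hδ, hb⟩ := Metric.eventually_nhds_iff_ball.1 h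
  have hn := (tendsto_one_div_add_atTop_nhds_zero_nat (𝕜 := ℝ)).eventually (gt_mem_nhds hδ)
  filter_upwards [hn] with n hn
  refine eLpNorm_moll_sub_le (contDiff_mollifier n).continuous (hasCompactSupport_mollifier n)
    (fun x => ContDiffBump.nonneg_normed _ x) (ContDiffBump.integral_normed _) hf fun y hy => hb y ?_
  rw [support_mollifier] at hy
  exact Metric.ball_subset_ball hn.le hy

end OseenVortex
end

open MeasureTheory
open scoped ContDiff
noncomputable section
namespace OseenVortex
open Filter Topology Set
open scoped ENNReal Convolution ComplexConjugate

/-! ### Convergence of weighted products -/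

theorem memLp_bdd_mul {c : Plane → ℝ} {f : Plane → ℂ} {C : ℝ} (hc : AEStronglyMeasurable c volume)
    (hC : ∀ x, |c x| ≤ C) (hf : MemLp f 2) : MemLp (fun x => ((c x : ℝ) : ℂ) * f x) 2 := by
  refine MemLp.of_le_mul (c := C) hf ?_ (ae_of_all _ fun x => ?_)
  · exact (Complex.continuous_ofReal.comp_aestronglyMeasurable hc).mul hf.1
  · rw [norm_mul, Complex.norm_real, Real.norm_eq_abs]
    gcongr
    exact hC x

theorem integrable_weighted {c : Plane → ℝ} {f g : Plane → ℂ} {C : ℝ}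
    (hc : AEStronglyMeasurable c volume)
    (hC : ∀ x, |c x| ≤ C) (hf : MemLp f 2) (hg : MemLp g 2) :
    Integrable (fun x => c x * (conj (f x) * g x).re) := by
  have h1 := (memLp_bdd_mul hc hC hg)
  have h2 : MemLp (fun x => conj (f x)) 2 := hf.star
  have h3 : Integrable (fun x => conj (f x) * (((c x : ℝ) : ℂ) * g x)) := h2.integrable_mul h1
  refine h3.re.congr (ae_of_all _ fun x => ?_)
  simp
  ring

theorem tendsto_integral_conj_mul {f g : ℕ → Plane → ℂ} {f₀ g₀ : Plane → ℂ}
    (hf : ∀ n, MemLp (f n) 2) (hg : ∀ n, MemLp (g n) 2) (hf₀ : MemLp f₀ 2) (hg₀ : MemLp g₀ 2)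
    (hft : Tendsto (fun n => eLpNorm (fun x => f n x - f₀ x) 2 volume) atTop (𝓝 0))
    (hgt : Tendsto (fun n => eLpNorm (fun x => g n x - g₀ x) 2 volume) atTop (𝓝 0)) :
    Tendsto (fun n => ∫ x, conj (f n x) * g n x) atTop (𝓝 (∫ x, conj (f₀ x) * g₀ x)) := by
  have a1 := (Lp.tendsto_Lp_iff_tendsto_eLpNorm'' f hf f₀ hf₀).2 hft
  have a2 := (Lp.tendsto_Lp_iff_tendsto_eLpNorm'' g hg g₀ hg₀).2 hgt
  have key : ∀ (u v : Plane → ℂ) (hu : MemLp u 2) (hv : MemLp v 2),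
      inner ℂ (hu.toLp u) (hv.toLp v) = ∫ x, conj (u x) * v x := by
    intro u v hu hv
    rw [L2.inner_def]
    refine integral_congr_ae ?_
    filter_upwards [hu.coeFn_toLp, hv.coeFn_toLp] with x h1 h2
    rw [h1, h2]
    simp [mul_comm]
  simpa only [key] using a1.inner (𝕜 := ℂ) a2

theorem tendsto_bdd_mul {c : Plane → ℝ} {C : ℝ} (hC : ∀ x, |c x| ≤ C)
    {f : ℕ → Plane → ℂ} {f₀ : Plane → ℂ}
    (hft : Tendsto (fun n => eLpNorm (fun x => f n x - f₀ x) 2 volume) atTop (𝓝 0)) :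
    Tendsto (fun n => eLpNorm (fun x => ((c x : ℝ) : ℂ) * f n x - ((c x : ℝ) : ℂ) * f₀ x) 2 volume)
      atTop (𝓝 0) := by
  have h0 : Tendsto (fun n => ENNReal.ofReal C * eLpNorm (fun x => f n x - f₀ x) 2 volume) atTop
      (𝓝 (ENNReal.ofReal C * 0)) := ENNReal.Tendsto.const_mul hft (by simp)
  rw [mul_zero] at h0
  refine tendsto_of_tendsto_of_tendsto_of_le_of_le tendsto_const_nhds h0 (fun _ => zero_le) fun n => ?_
  refine eLpNorm_le_mul_eLpNorm_of_ae_le_mul (ae_of_all _ fun x => ?_) 2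
  rw [← mul_sub, norm_mul, Complex.norm_real, Real.norm_eq_abs]
  gcongr
  exact hC x

theorem tendsto_integral_weighted {c : Plane → ℝ} {C : ℝ} (hc : AEStronglyMeasurable c volume)
    (hC : ∀ x, |c x| ≤ C) {f g : ℕ → Plane → ℂ} {f₀ g₀ : Plane → ℂ}
    (hf : ∀ n, MemLp (f n) 2) (hg : ∀ n, MemLp (g n) 2) (hf₀ : MemLp f₀ 2) (hg₀ : MemLp g₀ 2)
    (hft : Tendsto (fun n => eLpNorm (fun x => f n x - f₀ x) 2 volume) atTop (𝓝 0))
    (hgt : Tendsto (fun n => eLpNorm (fun x => g n x - g₀ x) 2 volume) atTop (𝓝 0)) :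
    Tendsto (fun n => ∫ x, c x * (conj (f n x) * g n x).re) atTop
      (𝓝 (∫ x, c x * (conj (f₀ x) * g₀ x).re)) := by
  have key : ∀ (u v : Plane → ℂ) (_ : MemLp u 2) (_ : MemLp v 2),
      ∫ x, c x * (conj (u x) * v x).re = (∫ x, conj (u x) * (((c x : ℝ) : ℂ) * v x)).re := by
    intro u v hu hv
    have h3 : Integrable (fun x => conj (u x) * (((c x : ℝ) : ℂ) * v x)) :=
      hu.star.integrable_mul (memLp_bdd_mul hc hC hv)
    have := integral_re h3
    simp only [RCLike.re_to_complex] at this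
    rw [← this]
    refine integral_congr_ae (ae_of_all _ fun x => ?_)
    simp
    ring
  have h := tendsto_integral_conj_mul hf (fun n => memLp_bdd_mul hc hC (hg n)) hf₀
    (memLp_bdd_mul hc hC hg₀) hft (tendsto_bdd_mul hC hgt)
  have h' := (Complex.continuous_re.tendsto _).comp h
  rw [key _ _ hf₀ hg₀]
  refine h'.congr fun n => ?_
  rw [key _ _ (hf n) (hg n)]
  rfl

/-! ### The localized energy identity -/

/-- The real part of the divergence of `s² f̄ (∇f + Φ - B f / 2)` has zero integral. Here `Φ` stands
for the mollified flux and is close to `B f`. Writing `Φ = B f + (Φ - B f)` isolates the commutator,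
and `s ∇f` is expressed through `∇(s f)`. -/
theorem energy_identity {f : Plane → ℂ} {Φ : Fin 2 → Plane → ℂ} {η : Plane → ℂ} {s : Plane → ℝ}
    {B : Fin 2 → Plane → ℝ} (hf : ContDiff ℝ ∞ f) (hΦ : ∀ j, ContDiff ℝ ∞ (Φ j))
    (heq : ∀ x, ∑ j, pd j (pd j f) x + ∑ j, pd j (Φ j) x = η x)
    (hs : ContDiff ℝ 1 s) (hc : HasCompactSupport s) (hB : ∀ j, ContDiff ℝ 1 (B j))
    (hdiv : ∀ x, ∑ j, pd j (B j) x = 1) :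
    ∫ x, ((∑ j, ‖pd j (fun y => ((s y : ℝ) : ℂ) * f y) x‖ ^ 2) - (∑ j, pd j s x ^ 2) * ‖f x‖ ^ 2
      + s x ^ 2 * (conj (f x) * η x).re
      + (s x * (∑ j, B j x * pd j s x) - s x ^ 2 / 2) * ‖f x‖ ^ 2
      + ∑ j, (s x * (conj (pd j (fun y => ((s y : ℝ) : ℂ) * f y) x)
          + conj (f x) * (pd j s x : ℝ)) * (Φ j x - B j x * f x)).re) = 0 := by
  have hf1 : ContDiff ℝ 1 f := hf.of_le (by exact_mod_cast le_top)
  have hpf : ∀ j, ContDiff ℝ 1 (pd j f) := fun j =>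
    (contDiff_pd (k := ∞) hf (by simp) j).of_le (by exact_mod_cast le_top)
  have hΦ1 : ∀ j, ContDiff ℝ 1 (Φ j) := fun j => (hΦ j).of_le (by exact_mod_cast le_top)
  have hsC : ContDiff ℝ 1 (fun y => ((s y : ℝ) : ℂ)) := Complex.ofRealCLM.contDiff.comp hs
  have hBC : ∀ j, ContDiff ℝ 1 (fun y => ((B j y : ℝ) : ℂ)) :=
    fun j => Complex.ofRealCLM.contDiff.comp (hB j)
  have hcf : ContDiff ℝ 1 (fun y => conj (f y)) :=
    (Complex.conjCLE : ℂ →L[ℝ] ℂ).contDiff.comp hf1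
  -- The correction `-B f / 2` cancels the first-order drift terms, since `Re(f̄ B·∇f) = B·∇|f|² /
  -- 2`. Only `div B` and `B·∇s` remain.
  let W : Fin 2 → Plane → ℂ := fun j y =>
    conj (f y) * (pd j f y + Φ j y + -(1 / 2 : ℂ) * (((B j y : ℝ) : ℂ) * f y))
  let V : Fin 2 → Plane → ℂ := fun j y => ((s y : ℝ) : ℂ) * (((s y : ℝ) : ℂ) * W j y)
  have hW : ∀ j, ContDiff ℝ 1 (W j) := fun j =>
    hcf.mul (((hpf j).add (hΦ1 j)).add (contDiff_const.mul ((hBC j).mul hf1)))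
  have hV : ∀ j, ContDiff ℝ 1 (V j) := fun j => hsC.mul (hsC.mul (hW j))
  have hcs : HasCompactSupport (fun y => ((s y : ℝ) : ℂ)) := hc.comp_left (g := Complex.ofReal) rfl
  have hVc : ∀ j, HasCompactSupport (V j) := fun j => hcs.mul_right
  have hVi : ∀ j, Integrable (pd j (V j)) := fun j =>
    (continuous_pd (hV j) j).integrable_of_hasCompactSupport ((hVc j).pd j)
  have hz : ∫ x, (∑ j, pd j (V j) x) = 0 := by
    rw [integral_finsetSum _ fun j _ => hVi j]
    simp [integral_pd_eq_zero_of_hasCompactSupport (hV _) (hVc _)]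
  have hz' : ∫ x, (∑ j, pd j (V j) x).re = 0 := by
    have := integral_re (integrable_finsetSum Finset.univ fun j _ => hVi j)
    simp only [RCLike.re_to_complex] at this
    rw [this, hz, Complex.zero_re]
  rw [← hz']
  refine integral_congr_ae (ae_of_all _ fun x => ?_)
  have df : DifferentiableAt ℝ f x := hf1.differentiable (by simp) x
  have ds : DifferentiableAt ℝ s x := hs.differentiable (by simp) x
  have dsC := hsC.differentiable (by simp) x
  have dB : ∀ j, DifferentiableAt ℝ (B j) x := fun j => (hB j).differentiable (by simp) x
  have dBC := fun j => (hBC j).differentiable (by simp) x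
  have dpf := fun j => (hpf j).differentiable (by simp) x
  have dΦ := fun j => (hΦ1 j).differentiable (by simp) x
  have dcf := hcf.differentiable (by simp) x
  have dW := fun j => (hW j).differentiable (by simp) x
  have e1 : ∀ j, pd j (fun y => ((s y : ℝ) : ℂ) * f y) x = s x * pd j f x + (pd j s x : ℝ) * f x := by
    intro j
    rw [pd_mul j dsC df, pd_ofReal j ds]
  have e2 : ∀ j, pd j (W j) x = conj (f x) * (pd j (pd j f) x + pd j (Φ j) x
      + -(1 / 2 : ℂ) * (((B j x : ℝ) : ℂ) * pd j f x + (pd j (B j) x : ℝ) * f x))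
      + conj (pd j f x) * (pd j f x + Φ j x + -(1 / 2 : ℂ) * (((B j x : ℝ) : ℂ) * f x)) := by
    intro j
    have dBf : DifferentiableAt ℝ (fun y => ((B j y : ℝ) : ℂ) * f y) x := (dBC j).mul df
    have d1 : DifferentiableAt ℝ (fun y => -(1 / 2 : ℂ) * (((B j y : ℝ) : ℂ) * f y)) x :=
      dBf.const_mul _
    have d2 : DifferentiableAt ℝ (fun y => pd j f y + Φ j y) x := (dpf j).add (dΦ j)
    have d3 : DifferentiableAt ℝ
      (fun y => pd j f y + Φ j y + -(1 / 2 : ℂ) * (((B j y : ℝ) : ℂ) * f y)) x := d2.add d1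
    rw [pd_mul j dcf d3, pd_conj j df, pd_add j d2 d1, pd_add j (dpf j) (dΦ j),
      pd_mul j (differentiableAt_const _) dBf, pd_mul j (dBC j) df, pd_ofReal j (dB j)]
    simp [pd]
  have e3 : ∀ j, pd j (V j) x = s x * (s x * pd j (W j) x + (pd j s x : ℝ) * W j x)
      + (pd j s x : ℝ) * (s x * W j x) := by
    intro j
    have d1 : DifferentiableAt ℝ (fun y => ((s y : ℝ) : ℂ) * W j y) x := dsC.mul (dW j)
    rw [pd_mul j dsC d1, pd_mul j dsC (dW j), pd_ofReal j ds]
  have hd := hdiv x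
  have he := heq x
  simp only [Fin.sum_univ_two] at hd he ⊢
  rw [e3, e3, e2, e2, e1, e1, ← he]
  have hd1 : pd 1 (B 1) x = 1 - pd 0 (B 0) x := by linarith
  rw [hd1]
  simp only [W, Complex.sq_norm, Complex.normSq_apply, Complex.add_re, Complex.add_im,
    Complex.mul_re, Complex.mul_im, Complex.conj_re, Complex.conj_im, Complex.ofReal_re,
    Complex.ofReal_im, Complex.sub_re, Complex.sub_im, Complex.neg_re, Complex.neg_im, map_add,
    map_mul, Complex.conj_ofReal, Complex.one_re, Complex.one_im, Complex.div_ofNat_re,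
    Complex.div_ofNat_im]
  ring

end OseenVortex
end

open MeasureTheory
open scoped ContDiff
noncomputable section
namespace OseenVortex
open Filter Topology Set
open scoped ENNReal Convolution ComplexConjugate

/-! ### The mollified equation and its limit in the energy identity. -/

theorem memLp_moll {f : Plane → ℂ} (hf : MemLp f 2) (n : ℕ) :
    MemLp (moll (mollifier n) f) 2 := by
  have hl : LocallyIntegrable f := hf.locallyIntegrable (by norm_num)
  have hs := contDiff_moll (contDiff_mollifier n) (hasCompactSupport_mollifier n) hl
  have h1 : eLpNorm (fun x => moll (mollifier n) f x - f x) 2 volume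
      ≤ eLpNorm f 2 volume + eLpNorm f 2 volume := by
    refine eLpNorm_moll_sub_le (contDiff_mollifier n).continuous (hasCompactSupport_mollifier n)
      (fun x => ContDiffBump.nonneg_normed _ x) (ContDiffBump.integral_normed _) hf fun y _ => ?_
    have hmp := measurePreserving_sub_right (volume : Measure Plane) y
    have := eLpNorm_sub_le (p := 2) (hf.comp_measurePreserving hmp).1 hf.1 (by norm_num)
    rw [eLpNorm_comp_measurePreserving hf.1 hmp] at this
    exact this
  have h2 : MemLp (fun x => moll (mollifier n) f x - f x) 2 :=
    ⟨hs.continuous.aestronglyMeasurable.sub hf.1, h1.trans_lt (ENNReal.add_lt_top.2 ⟨hf.2, hf.2⟩)⟩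
  have := h2.add hf
  refine (memLp_congr_ae (ae_of_all _ fun x => ?_)).1 this
  simp

theorem isTest_translate {ρ : Plane → ℝ} (hρ : ContDiff ℝ ∞ ρ) (hc : HasCompactSupport ρ)
    (x : Plane) : IsTest (fun y => ((ρ (x - y) : ℝ) : ℂ)) := by
  refine ⟨Complex.ofRealCLM.contDiff.comp (hρ.comp (contDiff_const.sub contDiff_id)), ?_⟩
  have h1 : HasCompactSupport (fun y => ρ (x - y)) :=
    hc.comp_homeomorph (Homeomorph.subLeft x)
  exact h1.comp_left (g := Complex.ofReal) rfl

theorem pd_translate {ρ : Plane → ℝ} (hρ : Differentiable ℝ ρ) (x : Plane) (j : Fin 2) :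
    pd j (fun y => ((ρ (x - y) : ℝ) : ℂ)) = fun y => ((-pd j ρ (x - y) : ℝ) : ℂ) := by
  ext y
  have h1 : HasFDerivAt (fun y => ρ (x - y)) (-(fderiv ℝ ρ (x - y))) y := by
    have := (hρ (x - y)).hasFDerivAt.comp y ((hasFDerivAt_id y).const_sub x)
    simpa [Function.comp_def] using! this
  rw [pd_ofReal j h1.differentiableAt]
  simp only [pd]
  rw [h1.fderiv]
  simp

/-- The mollified form of `Δ w + div F = h`. -/
theorem mollified_equation {w h : Plane → ℂ} {F : Fin 2 → Plane → ℂ} {ρ : Plane → ℝ}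
    (hw : LocallyIntegrable w) (hF : ∀ j, LocallyIntegrable (F j))
    (hW : ∀ φ, IsTest φ → (∫ x, w x * ∑ j, pd j (pd j φ) x) - ∑ j, ∫ x, F j x * pd j φ x
      = ∫ x, h x * φ x)
    (hρ : ContDiff ℝ ∞ ρ) (hc : HasCompactSupport ρ) (x : Plane) :
    ∑ j, pd j (pd j (moll ρ w)) x + ∑ j, pd j (moll ρ (F j)) x = moll ρ h x := by
  have hρ' : ∀ j, ContDiff ℝ ∞ (pd j ρ) := fun j => contDiff_pd hρ (by simp) j
  have := hW _ (isTest_translate hρ hc x)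
  simp only [Fin.sum_univ_two] at this ⊢
  simp only [pd_translate (hρ.differentiable (by simp))] at this
  have e : ∀ j, pd j (fun y => ((-pd j ρ (x - y) : ℝ) : ℂ))
      = fun y => ((pd j (pd j ρ) (x - y) : ℝ) : ℂ) := by
    intro j
    have h1 := pd_translate (ρ := fun y => -pd j ρ y) ((hρ' j).differentiable (by simp)).neg x j
    rw [h1]
    ext y
    rw [show (fun y => -pd j ρ y) = -(pd j ρ) from rfl]
    simp only [pd, fderiv_neg]
    simp
  simp only [e] at this
  have h2 : ∀ j, Integrable (fun y => w y * ((pd j (pd j ρ) (x - y) : ℝ) : ℂ)) := fun j =>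
    integrable_moll (contDiff_pd (k := ∞) (hρ' j) (by simp) j).continuous ((hc.pd j).pd j) hw x
  simp only [mul_add] at this
  rw [integral_add (h2 0) (h2 1)] at this
  simp only [pd_moll hρ hc hw, pd_moll (hρ' _) (hc.pd _) hw, pd_moll hρ hc (hF _)]
  simp only [moll]
  rw [← this]
  simp only [Complex.ofReal_neg, mul_neg, integral_neg]
  ring

/-- A localized energy inequality: if `Δ w + div (B w) = h` with `div B = 1`, and `s` is a `C¹`
cutoff, then `s w` is an `L²` limit of `C¹` functions `s f_n` whose Dirichlet integrals are
asymptotically bounded by the value predicted by the formal energy identity. -/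
theorem exists_approx_energy {w h : Plane → ℂ} {B : Fin 2 → Plane → ℝ} {s : Plane → ℝ}
    (hw : MemLp w 2) (hF : ∀ j, MemLp (fun x => ((B j x : ℝ) : ℂ) * w x) 2) (hh : MemLp h 2)
    (hW : ∀ φ, IsTest φ → (∫ x, w x * ∑ j, pd j (pd j φ) x)
      - ∑ j, ∫ x, ((B j x : ℝ) : ℂ) * w x * pd j φ x = ∫ x, h x * φ x)
    (hs : ContDiff ℝ 1 s) (hc : HasCompactSupport s) (hB : ∀ j, ContDiff ℝ 1 (B j))
    (hdiv : ∀ x, ∑ j, pd j (B j) x = 1) :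
    ∃ f : ℕ → Plane → ℂ, (∀ n, ContDiff ℝ ∞ (f n)) ∧ (∀ n, MemLp (f n) 2) ∧
      Tendsto (fun n => eLpNorm (fun x => f n x - w x) 2 volume) atTop (𝓝 0) ∧
      ∀ ε > 0, ∀ᶠ n in atTop, ∫ x, ∑ j, ‖pd j (fun y => ((s y : ℝ) : ℂ) * f n y) x‖ ^ 2 ≤
        (∫ x, (((∑ j, pd j s x ^ 2) - (s x * (∑ j, B j x * pd j s x) - s x ^ 2 / 2)) * ‖w x‖ ^ 2
          - s x ^ 2 * (conj (w x) * h x).re)) + ε := by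
  set ρ := mollifier
  have hρ := contDiff_mollifier
  have hρc := hasCompactSupport_mollifier
  set F : Fin 2 → Plane → ℂ := fun j x => ((B j x : ℝ) : ℂ) * w x with hFdef
  have lw := hw.locallyIntegrable (by norm_num)
  have lF := fun j => (hF j).locallyIntegrable (by norm_num)
  have lh := hh.locallyIntegrable (by norm_num)
  set f : ℕ → Plane → ℂ := fun n => moll (ρ n) w
  set Φ : ℕ → Fin 2 → Plane → ℂ := fun n j => moll (ρ n) (F j)
  set g : ℕ → Plane → ℂ := fun n => moll (ρ n) h
  have mf : ∀ n, MemLp (f n) 2 := fun n => memLp_moll hw n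
  have mΦ : ∀ j n, MemLp (Φ n j) 2 := fun j n => memLp_moll (hF j) n
  have mg : ∀ n, MemLp (g n) 2 := fun n => memLp_moll hh n
  have tf := tendsto_moll hw
  have tΦ := fun j => tendsto_moll (hF j)
  have tg := tendsto_moll hh
  have cf : ∀ n, ContDiff ℝ ∞ (f n) := fun n => contDiff_moll (hρ n) (hρc n) lw
  have cΦ : ∀ n j, ContDiff ℝ ∞ (Φ n j) := fun n j => contDiff_moll (hρ n) (hρc n) (lF j)
  have cg : ∀ n, ContDiff ℝ ∞ (g n) := fun n => contDiff_moll (hρ n) (hρc n) lh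
  refine ⟨f, cf, mf, tf, fun ε hε => ?_⟩
  -- the coefficients
  have cps : ∀ j, Continuous (pd j s) := fun j => continuous_pd hs j
  have csc := hs.continuous
  have cB := fun j => (hB j).continuous
  set c1 : Plane → ℝ := fun x => ∑ j, pd j s x ^ 2 with hc1
  set c2 : Plane → ℝ := fun x => s x * (∑ j, B j x * pd j s x) - s x ^ 2 / 2 with hc2
  have k1 : Continuous c1 := by fun_prop
  have k2 : Continuous c2 := by fun_prop
  have bdd : ∀ c : Plane → ℝ, Continuous c → HasCompactSupport c → ∃ C, ∀ x, |c x| ≤ C :=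
    fun c h1 h2 => h1.bounded_above_of_compact_support h2
  have zs : ∀ x, x ∉ tsupport s → s x = 0 := fun x hx => image_eq_zero_of_notMem_tsupport hx
  have zps : ∀ j x, x ∉ tsupport s → pd j s x = 0 := fun j x hx =>
    image_eq_zero_of_notMem_tsupport fun h => hx (tsupport_fderiv_apply_subset ℝ _ h)
  have s1 : HasCompactSupport c1 := HasCompactSupport.intro hc fun x hx => by
    simp [hc1, zps _ x hx]
  have s2 : HasCompactSupport c2 := HasCompactSupport.intro hc fun x hx => by
    simp [hc2, zs x hx]
  have sS : HasCompactSupport (fun x => s x ^ 2) := HasCompactSupport.intro hc fun x hx => by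
    simp [zs x hx]
  have sSB : ∀ j, HasCompactSupport (fun x => s x ^ 2 * B j x) := fun j =>
    HasCompactSupport.intro hc fun x hx => by simp [zs x hx]
  have sSBB : ∀ j, HasCompactSupport (fun x => s x ^ 2 * B j x ^ 2) := fun j =>
    HasCompactSupport.intro hc fun x hx => by simp [zs x hx]
  have kS : Continuous (fun x => s x ^ 2) := by fun_prop
  have kSB : ∀ j, Continuous (fun x => s x ^ 2 * B j x) := fun j => by fun_prop
  have kSBB : ∀ j, Continuous (fun x => s x ^ 2 * B j x ^ 2) := fun j => by fun_prop
  obtain ⟨C1, b1⟩ := bdd c1 k1 s1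
  obtain ⟨C2, b2⟩ := bdd c2 k2 s2
  obtain ⟨CS, bS⟩ := bdd _ kS sS
  choose CSB bSB using fun j => bdd _ (kSB j) (sSB j)
  choose CSBB bSBB using fun j => bdd _ (kSBB j) (sSBB j)
  -- limits
  have L1 := tendsto_integral_weighted k1.aestronglyMeasurable b1 mf mf hw hw tf tf
  have L2 := tendsto_integral_weighted k2.aestronglyMeasurable b2 mf mf hw hw tf tf
  have Lh := tendsto_integral_weighted kS.aestronglyMeasurable bS mf mg hw hh tf tg
  have LA := fun j => tendsto_integral_weighted kS.aestronglyMeasurable bS (mΦ j) (mΦ j) (hF j)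
    (hF j) (tΦ j) (tΦ j)
  have LB := fun j => tendsto_integral_weighted (kSB j).aestronglyMeasurable (bSB j) mf (mΦ j) hw
    (hF j) tf (tΦ j)
  have LC := fun j => tendsto_integral_weighted (kSBB j).aestronglyMeasurable (bSBB j) mf mf hw hw
    tf tf
  -- integrability along the sequence
  have I1 := fun n => integrable_weighted k1.aestronglyMeasurable b1 (mf n) (mf n)
  have I2 := fun n => integrable_weighted k2.aestronglyMeasurable b2 (mf n) (mf n)
  have Ih := fun n => integrable_weighted kS.aestronglyMeasurable bS (mf n) (mg n)
  have IA := fun j n => integrable_weighted kS.aestronglyMeasurable bS (mΦ j n) (mΦ j n)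
  have IB := fun j n => integrable_weighted (kSB j).aestronglyMeasurable (bSB j) (mf n) (mΦ j n)
  have IC := fun j n => integrable_weighted (kSBB j).aestronglyMeasurable (bSBB j) (mf n) (mf n)
  have J1 := integrable_weighted k1.aestronglyMeasurable b1 hw hw
  have J2 := integrable_weighted k2.aestronglyMeasurable b2 hw hw
  have Jh := integrable_weighted kS.aestronglyMeasurable bS hw hh
  set X1 := ∫ x, c1 x * (conj (w x) * w x).re
  set X2 := ∫ x, c2 x * (conj (w x) * w x).re
  set Xh := ∫ x, s x ^ 2 * (conj (w x) * h x).re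
  have hsq : ∀ z : ℂ, ‖z‖ ^ 2 = (conj z * z).re := fun z => by
    rw [Complex.sq_norm, Complex.normSq_apply]; simp
  have hJ : ∫ x, ((c1 x - c2 x) * ‖w x‖ ^ 2 - s x ^ 2 * (conj (w x) * h x).re) = X1 - X2 - Xh := by
    have J12 : Integrable (fun x => c1 x * (conj (w x) * w x).re - c2 x * (conj (w x) * w x).re) :=
      J1.sub J2
    rw [← integral_sub J1 J2, ← integral_sub J12 Jh]
    refine integral_congr_ae (ae_of_all _ fun x => ?_)
    simp only [hsq]
    ring
  change ∀ᶠ n in atTop, _ ≤ (∫ x, ((c1 x - c2 x) * ‖w x‖ ^ 2 - s x ^ 2 * (conj (w x) * h x).re)) + ε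
  rw [hJ]
  -- the remainder
  set R : ℕ → ℝ := fun n => ∑ j, ((∫ x, s x ^ 2 * (conj (Φ n j x) * Φ n j x).re)
    - 2 * (∫ x, s x ^ 2 * B j x * (conj (f n x) * Φ n j x).re)
    + ∫ x, s x ^ 2 * B j x ^ 2 * (conj (f n x) * f n x).re) with hR
  -- `R n` is the sum over `j` of the integrals of `s² |Φ_j - B_j f|²`, expanded so that each term
  -- is a convergent pairing. Since `Φ_j → B_j w` and `f → w`, the limit is zero.
  have LR : Tendsto R atTop (𝓝 0) := by
    have h0 : Tendsto R atTop (𝓝 (∑ j, ((∫ x, s x ^ 2 * (conj (F j x) * F j x).re)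
        - 2 * (∫ x, s x ^ 2 * B j x * (conj (w x) * F j x).re)
        + ∫ x, s x ^ 2 * B j x ^ 2 * (conj (w x) * w x).re))) :=
      tendsto_finsetSum _ fun j _ => ((LA j).sub ((LB j).const_mul 2)).add (LC j)
    have e : (∑ j, ((∫ x, s x ^ 2 * (conj (F j x) * F j x).re)
        - 2 * (∫ x, s x ^ 2 * B j x * (conj (w x) * F j x).re)
        + ∫ x, s x ^ 2 * B j x ^ 2 * (conj (w x) * w x).re)) = 0 := by
      refine Finset.sum_eq_zero fun j _ => ?_
      have e1 : (∫ x, s x ^ 2 * (conj (F j x) * F j x).re)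
          = ∫ x, s x ^ 2 * B j x ^ 2 * (conj (w x) * w x).re := by
        congr 1; ext x; simp [hFdef]; ring
      have e2 : (∫ x, s x ^ 2 * B j x * (conj (w x) * F j x).re)
          = ∫ x, s x ^ 2 * B j x ^ 2 * (conj (w x) * w x).re := by
        congr 1; ext x; simp [hFdef]; ring
      rw [e1, e2]; ring
    rwa [e] at h0
  -- choice of the absorption parameter
  obtain ⟨τ, hτ0, hτ1, hτ⟩ : ∃ τ : ℝ, 0 < τ ∧ τ < 1 ∧
      (X1 - X2 - Xh + τ * X1) / (1 - τ) < X1 - X2 - Xh + ε := by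
    have ht : Tendsto (fun τ : ℝ => (X1 - X2 - Xh + τ * X1) / (1 - τ)) (𝓝[>] 0)
        (𝓝 ((X1 - X2 - Xh + 0 * X1) / (1 - 0))) := by
      refine Tendsto.mono_left ?_ nhdsWithin_le_nhds
      refine ContinuousAt.tendsto (f := fun τ : ℝ => (X1 - X2 - Xh + τ * X1) / (1 - τ)) ?_
      exact ContinuousAt.div (by fun_prop) (by fun_prop) (by norm_num)
    have h1 := ht.eventually (gt_mem_nhds (show (X1 - X2 - Xh + 0 * X1) / (1 - 0) < X1 - X2 - Xh + ε by simpa using hε))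
    have h2 : ∀ᶠ τ : ℝ in 𝓝[>] 0, τ < 1 :=
      nhdsWithin_le_nhds (gt_mem_nhds (by norm_num))
    obtain ⟨τ, ⟨h3, h4⟩, h5⟩ := ((h1.and h2).and self_mem_nhdsWithin).exists
    exact ⟨τ, h5, h4, h3⟩
  have hlim : Tendsto (fun n => ((∫ x, c1 x * (conj (f n x) * f n x).re)
      - (∫ x, c2 x * (conj (f n x) * f n x).re) - (∫ x, s x ^ 2 * (conj (f n x) * g n x).re)
      + τ * (∫ x, c1 x * (conj (f n x) * f n x).re) + (1 / (2 * τ)) * R n) / (1 - τ)) atTop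
      (𝓝 ((X1 - X2 - Xh + τ * X1 + (1 / (2 * τ)) * 0) / (1 - τ))) :=
    Tendsto.div_const ((((L1.sub L2).sub Lh).add (L1.const_mul τ)).add (LR.const_mul _)) _
  rw [mul_zero, add_zero] at hlim
  filter_upwards [hlim.eventually (gt_mem_nhds hτ)] with n hn
  refine le_trans ?_ hn.le
  rw [le_div_iff₀ (by linarith)]
  -- the energy identity for the mollified functions
  have key := energy_identity (cf n) (cΦ n)
    (fun x => mollified_equation lw lF hW (hρ n) (hρc n) x) hs hc hB hdiv
  have cf1 : ContDiff ℝ 1 (f n) := (cf n).of_le (by exact_mod_cast le_top)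
  set u : Plane → ℂ := fun y => ((s y : ℝ) : ℂ) * f n y with hu
  have cu : ContDiff ℝ 1 u := (Complex.ofRealCLM.contDiff.comp hs).mul cf1
  have hcu : HasCompactSupport u := HasCompactSupport.intro hc fun x hx => by simp [hu, zs x hx]
  have cpu := fun j => continuous_pd cu j
  have zpu : ∀ j x, x ∉ tsupport s → pd j u x = 0 := fun j x hx =>
    image_eq_zero_of_notMem_tsupport fun h => hx
      (closure_mono (fun y hy => by
        simp only [Function.mem_support, ne_eq, hu] at hy ⊢
        intro h0; exact hy (by simp [h0])) (tsupport_fderiv_apply_subset ℝ _ h))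
  have IU : Integrable (fun x => ∑ j, ‖pd j u x‖ ^ 2) := by
    refine Continuous.integrable_of_hasCompactSupport (by fun_prop) ?_
    exact HasCompactSupport.intro hc fun x hx => by simp [zpu _ x hx]
  have cfc := (cf n).continuous
  have cΦc := fun j => (cΦ n j).continuous
  have cgc := (cg n).continuous
  have IK : Integrable (fun x => (∑ j, ‖pd j u x‖ ^ 2) - (∑ j, pd j s x ^ 2) * ‖f n x‖ ^ 2
      + s x ^ 2 * (conj (f n x) * g n x).re
      + (s x * (∑ j, B j x * pd j s x) - s x ^ 2 / 2) * ‖f n x‖ ^ 2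
      + ∑ j, (s x * (conj (pd j u x) + conj (f n x) * (pd j s x : ℝ))
        * (Φ n j x - B j x * f n x)).re) := by
    refine Continuous.integrable_of_hasCompactSupport ?_ ?_
    · fun_prop
    · exact HasCompactSupport.intro hc fun x hx => by simp [zpu _ x hx, zs x hx, zps _ x hx]
  set r : Fin 2 → Plane → ℝ := fun j x => s x ^ 2 * (conj (Φ n j x) * Φ n j x).re
    - 2 * (s x ^ 2 * B j x * (conj (f n x) * Φ n j x).re)
    + s x ^ 2 * B j x ^ 2 * (conj (f n x) * f n x).re with hr
  have IAB : ∀ j, Integrable (fun x => s x ^ 2 * (conj (Φ n j x) * Φ n j x).re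
    - 2 * (s x ^ 2 * B j x * (conj (f n x) * Φ n j x).re)) :=
    fun j => (IA j n).sub ((IB j n).const_mul 2)
  have Ir : ∀ j, Integrable (r j) := fun j => (IAB j).add (IC j n)
  have IR : Integrable (fun x => ∑ j, r j x) := integrable_finsetSum Finset.univ fun j _ => Ir j
  have eR : R n = ∫ x, ∑ j, r j x := by
    rw [integral_finsetSum _ fun j _ => Ir j]
    refine Finset.sum_congr rfl fun j _ => ?_
    rw [← integral_const_mul, ← integral_sub (IA j n) ((IB j n).const_mul 2),
      ← integral_add (IAB j) (IC j n)]
  have E1 : Integrable (fun x => c1 x * (conj (f n x) * f n x).re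
    - c2 x * (conj (f n x) * f n x).re) := (I1 n).sub (I2 n)
  have E2 : Integrable (fun x => c1 x * (conj (f n x) * f n x).re
    - c2 x * (conj (f n x) * f n x).re - s x ^ 2 * (conj (f n x) * g n x).re) := E1.sub (Ih n)
  have E3 : Integrable (fun x => c1 x * (conj (f n x) * f n x).re
    - c2 x * (conj (f n x) * f n x).re - s x ^ 2 * (conj (f n x) * g n x).re
    + τ * (c1 x * (conj (f n x) * f n x).re)) := E2.add ((I1 n).const_mul τ)
  have E4 : Integrable (fun x => c1 x * (conj (f n x) * f n x).re
    - c2 x * (conj (f n x) * f n x).re - s x ^ 2 * (conj (f n x) * g n x).re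
    + τ * (c1 x * (conj (f n x) * f n x).re) + 1 / (2 * τ) * ∑ j, r j x) :=
    E3.add (IR.const_mul _)
  have hle : ∫ x, (∑ j, ‖pd j u x‖ ^ 2) * (1 - τ) ≤
      ∫ x, (((∑ j, ‖pd j u x‖ ^ 2) - (∑ j, pd j s x ^ 2) * ‖f n x‖ ^ 2
      + s x ^ 2 * (conj (f n x) * g n x).re
      + (s x * (∑ j, B j x * pd j s x) - s x ^ 2 / 2) * ‖f n x‖ ^ 2
      + ∑ j, (s x * (conj (pd j u x) + conj (f n x) * (pd j s x : ℝ))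
        * (Φ n j x - B j x * f n x)).re)
      + (c1 x * (conj (f n x) * f n x).re - c2 x * (conj (f n x) * f n x).re
        - s x ^ 2 * (conj (f n x) * g n x).re + τ * (c1 x * (conj (f n x) * f n x).re)
        + 1 / (2 * τ) * ∑ j, r j x)) := by
    refine integral_mono (IU.mul_const _) (IK.add E4) fun x => ?_
    have young : ∀ (a z : ℂ), -(τ * ‖a‖ ^ 2 + 1 / (4 * τ) * ‖z‖ ^ 2) ≤ (conj a * z).re := by
      intro a z
      have h1 : |(conj a * z).re| ≤ ‖a‖ * ‖z‖ := by
        refine (Complex.abs_re_le_norm _).trans (le_of_eq ?_)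
        rw [norm_mul, Complex.norm_conj]
      have h2 : ‖a‖ * ‖z‖ ≤ τ * ‖a‖ ^ 2 + 1 / (4 * τ) * ‖z‖ ^ 2 := by
        have : τ * ‖a‖ ^ 2 + 1 / (4 * τ) * ‖z‖ ^ 2 - ‖a‖ * ‖z‖
            = (2 * τ * ‖a‖ - ‖z‖) ^ 2 / (4 * τ) := by field_simp; ring
        have : 0 ≤ (2 * τ * ‖a‖ - ‖z‖) ^ 2 / (4 * τ) := by positivity
        linarith
      linarith [neg_abs_le (conj a * z).re]
    -- Young's inequality is applied twice, pairing `s (Φ_j - B_j f)` with `∂_j(s f)` and with `f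
    -- ∂_j s`. The first use costs the fraction `τ` of the Dirichlet integral, whence the factor `1
    -- - τ`. The two coefficients `1/(4τ)` add up to `1/(2τ)`, which multiplies `R n → 0` with `τ`
    -- fixed.
    have hj : ∀ j, -(τ * ‖pd j u x‖ ^ 2) - τ * (pd j s x ^ 2 * (conj (f n x) * f n x).re)
        - 1 / (2 * τ) * (s x ^ 2 * (conj (Φ n j x) * Φ n j x).re
          - 2 * (s x ^ 2 * B j x * (conj (f n x) * Φ n j x).re)
          + s x ^ 2 * B j x ^ 2 * (conj (f n x) * f n x).re) ≤
        (s x * (conj (pd j u x) + conj (f n x) * (pd j s x : ℝ)) * (Φ n j x - B j x * f n x)).re := by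
      intro j
      have y1 := young (pd j u x) (s x * (Φ n j x - B j x * f n x))
      have y2 := young ((pd j s x : ℝ) * f n x) (s x * (Φ n j x - B j x * f n x))
      have e1 : ‖(s x : ℂ) * (Φ n j x - B j x * f n x)‖ ^ 2
          = s x ^ 2 * (conj (Φ n j x) * Φ n j x).re
          - 2 * (s x ^ 2 * B j x * (conj (f n x) * Φ n j x).re)
          + s x ^ 2 * B j x ^ 2 * (conj (f n x) * f n x).re := by
        rw [Complex.sq_norm, Complex.normSq_apply]
        simp
        ring
      have e2 : ‖((pd j s x : ℝ) : ℂ) * f n x‖ ^ 2 = pd j s x ^ 2 * (conj (f n x) * f n x).re := by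
        rw [Complex.sq_norm, Complex.normSq_apply]
        simp
        ring
      have e3 : (s x * (conj (pd j u x) + conj (f n x) * (pd j s x : ℝ))
          * (Φ n j x - B j x * f n x)).re = (conj (pd j u x) * (s x * (Φ n j x - B j x * f n x))).re
          + (conj ((pd j s x : ℝ) * f n x) * (s x * (Φ n j x - B j x * f n x))).re := by
        rw [← Complex.add_re]
        congr 1
        simp only [map_mul, Complex.conj_ofReal]
        ring
      rw [e1] at y1 y2
      rw [e2] at y2
      rw [e3]
      have e4 : (1 : ℝ) / (2 * τ) = 1 / (4 * τ) + 1 / (4 * τ) := by field_simp; norm_num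
      rw [e4]
      linarith
    have h0 := hj 0
    have h1 := hj 1
    simp only [hc1, hc2, hr, Fin.sum_univ_two, hsq (f n x)]
    linarith
  rw [integral_mul_const, integral_add IK E4, key, zero_add] at hle
  refine hle.trans (le_of_eq ?_)
  rw [eR, integral_add E3 (IR.const_mul _), integral_add E2 ((I1 n).const_mul τ),
    integral_sub E1 (Ih n), integral_sub (I1 n) (I2 n), integral_const_mul, integral_const_mul]

end OseenVortex
end

open MeasureTheory
open scoped ContDiff
noncomputable section
namespace OseenVortex
open Filter Topology Set
open scoped ENNReal Convolution ComplexConjugate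
open Polynomial (X C derivative)

/-! ### Gaussian integrals -/

theorem integrable_exp_neg_mul_norm_sq {c : ℝ} (hc : 0 < c) :
    Integrable (fun x : Plane => Real.exp (-c * ‖x‖ ^ 2)) := by
  have h := (GaussianFourier.integrable_cexp_neg_mul_sq_norm_add (V := Plane) (b := (c : ℂ))
    (by simpa using hc) 0 0).norm
  refine h.congr (ae_of_all _ fun x => ?_)
  simp [Complex.norm_exp, ← Complex.ofReal_pow]

theorem integral_exp_neg_mul_norm_sq {c : ℝ} (hc : 0 < c) :
    ∫ x : Plane, Real.exp (-c * ‖x‖ ^ 2) = Real.pi / c := by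
  rw [GaussianFourier.integral_rexp_neg_mul_sq_norm hc]
  simp

/-- Lets a polynomial factor be absorbed by an arbitrarily small loss in the Gaussian rate.
Monomials suffice: `|x|^n ≤ 1 + x^{2n}`, and `x^{2n}` is controlled by one term of the exponential
series. -/
theorem exists_abs_eval_le (p : Polynomial ℝ) {ε : ℝ} (hε : 0 < ε) :
    ∃ K, 0 ≤ K ∧ ∀ x : ℝ, |p.eval x| ≤ K * Real.exp (ε * x ^ 2) := by
  induction p using Polynomial.induction_on' with
  | add p q hp hq =>
    obtain ⟨K, hK, h⟩ := hp
    obtain ⟨L, hL, h'⟩ := hq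
    refine ⟨K + L, by positivity, fun x => ?_⟩
    rw [Polynomial.eval_add, add_mul]
    exact (abs_add_le _ _).trans (add_le_add (h x) (h' x))
  | monomial n a =>
    refine ⟨|a| * (1 + n.factorial / ε ^ n), by positivity, fun x => ?_⟩
    rw [Polynomial.eval_monomial, abs_mul, abs_pow, mul_assoc]
    gcongr
    have h1 : |x| ^ n ≤ 1 + (x ^ 2) ^ n := by
      rw [← sq_abs, ← pow_mul, mul_comm, pow_mul]
      nlinarith [sq_nonneg (|x| ^ n - 1), sq_nonneg (|x| ^ n)]
    have h2 := Real.pow_div_factorial_le_exp (ε * x ^ 2) (by positivity) n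
    have h3 : (x ^ 2) ^ n ≤ n.factorial / ε ^ n * Real.exp (ε * x ^ 2) := by
      rw [mul_pow, div_le_iff₀ (by positivity)] at h2
      rw [div_mul_eq_mul_div, le_div_iff₀ (by positivity)]
      linarith
    have h4 : 1 ≤ Real.exp (ε * x ^ 2) := Real.one_le_exp (by positivity)
    linarith

/-- A product of polynomials in the two coordinates times a Gaussian. -/
def polyGauss (c : ℝ) (p q : Polynomial ℝ) (x : Plane) : ℝ :=
  p.eval (x 0) * q.eval (x 1) * Real.exp (-c * ‖x‖ ^ 2)

theorem contDiff_polyGauss (c : ℝ) (p q : Polynomial ℝ) : ContDiff ℝ ∞ (polyGauss c p q) := by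
  have hp : ContDiff ℝ ∞ (fun x : ℝ => p.eval x) := by
    simpa using p.contDiff_aeval (𝕜 := ℝ) ∞
  have hq : ContDiff ℝ ∞ (fun x : ℝ => q.eval x) := by
    simpa using q.contDiff_aeval (𝕜 := ℝ) ∞
  have h0 : ∀ i, ContDiff ℝ ∞ (fun x : Plane => x i) := fun i =>
    (EuclideanSpace.proj i : Plane →L[ℝ] ℝ).contDiff
  exact ((hp.comp (h0 0)).mul (hq.comp (h0 1))).mul
    (Real.contDiff_exp.comp (contDiff_const.mul (contDiff_norm_sq ℝ)))

theorem exists_abs_polyGauss_le (c : ℝ) (p q : Polynomial ℝ) {ε : ℝ} (hε : 0 < ε) :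
    ∃ K, 0 ≤ K ∧ ∀ x, |polyGauss c p q x| ≤ K * Real.exp (-(c - ε) * ‖x‖ ^ 2) := by
  obtain ⟨K, hK, h⟩ := exists_abs_eval_le p hε
  obtain ⟨L, hL, h'⟩ := exists_abs_eval_le q hε
  refine ⟨K * L, by positivity, fun x => ?_⟩
  have e : Real.exp (-(c - ε) * ‖x‖ ^ 2)
      = Real.exp (ε * x 0 ^ 2) * Real.exp (ε * x 1 ^ 2) * Real.exp (-c * ‖x‖ ^ 2) := by
    rw [← Real.exp_add, ← Real.exp_add, norm_sq_eq]
    congr 1; ring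
  rw [polyGauss, abs_mul, abs_mul, Real.abs_exp, e]
  calc |p.eval (x 0)| * |q.eval (x 1)| * Real.exp (-c * ‖x‖ ^ 2)
      ≤ (K * Real.exp (ε * x 0 ^ 2)) * (L * Real.exp (ε * x 1 ^ 2)) * Real.exp (-c * ‖x‖ ^ 2) := by
        gcongr
        · exact h _
        · exact h' _
    _ = _ := by ring

theorem integrable_polyGauss {c : ℝ} (hc : 0 < c) (p q : Polynomial ℝ) :
    Integrable (polyGauss c p q) := by
  obtain ⟨K, -, h⟩ := exists_abs_polyGauss_le c p q (half_pos hc)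
  refine Integrable.mono' ((integrable_exp_neg_mul_norm_sq (half_pos hc)).const_mul K)
    (contDiff_polyGauss c p q).continuous.aestronglyMeasurable (ae_of_all _ fun x => ?_)
  have := h x
  rwa [sub_half] at this

theorem polyGauss_mul (c d : ℝ) (p q r s : Polynomial ℝ) (x : Plane) :
    polyGauss c p q x * polyGauss d r s x = polyGauss (c + d) (p * r) (q * s) x := by
  simp only [polyGauss, Polynomial.eval_mul, neg_add, add_mul, Real.exp_add]
  ring

theorem memLp_polyGauss {c : ℝ} (hc : 0 < c) (p q : Polynomial ℝ) :
    MemLp (fun x => ((polyGauss c p q x : ℝ) : ℂ)) 2 := by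
  have h1 := integrable_polyGauss (add_pos hc hc) (p * p) (q * q)
  have hm : AEStronglyMeasurable (fun x => ((polyGauss c p q x : ℝ) : ℂ)) volume :=
    (Complex.continuous_ofReal.comp (contDiff_polyGauss c p q).continuous).aestronglyMeasurable
  rw [memLp_two_iff_integrable_sq_norm hm]
  refine h1.congr (ae_of_all _ fun x => ?_)
  simp only
  rw [← polyGauss_mul, Complex.norm_real, Real.norm_eq_abs, sq_abs, sq]

theorem hasFDerivAt_eval_coord (p : Polynomial ℝ) (i : Fin 2) (x : Plane) :
    HasFDerivAt (fun x : Plane => p.eval (x i))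
      ((derivative p).eval (x i) • (EuclideanSpace.proj i : Plane →L[ℝ] ℝ)) x := by
  have h : HasFDerivAt (fun x : Plane => x i) (EuclideanSpace.proj i : Plane →L[ℝ] ℝ) x :=
    (EuclideanSpace.proj i : Plane →L[ℝ] ℝ).hasFDerivAt
  exact (p.hasDerivAt (x i)).comp_hasFDerivAt x h

theorem pd_eval_coord (p : Polynomial ℝ) (i j : Fin 2) (x : Plane) :
    pd j (fun x : Plane => p.eval (x i)) x = if i = j then (derivative p).eval (x i) else 0 := by
  simp only [pd, (hasFDerivAt_eval_coord p i x).fderiv]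
  simp

theorem hasDerivAt_exp_neg_mul (c t : ℝ) :
    HasDerivAt (fun t => Real.exp (-c * t)) (-c * Real.exp (-c * t)) t := by
  have := ((hasDerivAt_id t).const_mul (-c)).exp
  simpa [mul_comm] using this

theorem pd_polyGauss (c : ℝ) (p q : Polynomial ℝ) (j : Fin 2) (x : Plane) :
    pd j (polyGauss c p q) x = (p.eval (x 0) * (if 1 = j then (derivative q).eval (x 1) else 0)
      + (if 0 = j then (derivative p).eval (x 0) else 0) * q.eval (x 1)
      - 2 * c * x j * (p.eval (x 0) * q.eval (x 1))) * Real.exp (-c * ‖x‖ ^ 2) := by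
  have he := hasFDerivAt_radial (hasDerivAt_exp_neg_mul c (‖x‖ ^ 2))
  have hp := (hasFDerivAt_eval_coord p 0 x).differentiableAt
  have hq := (hasFDerivAt_eval_coord q 1 x).differentiableAt
  have hpq : DifferentiableAt ℝ (fun x : Plane => p.eval (x 0) * q.eval (x 1)) x := hp.mul hq
  change pd j (fun x => p.eval (x 0) * q.eval (x 1) * Real.exp (-c * ‖x‖ ^ 2)) x = _
  rw [pd_mul j hpq he.differentiableAt, pd_radial (hasDerivAt_exp_neg_mul c (‖x‖ ^ 2)),
    pd_mul j hp hq, pd_eval_coord, pd_eval_coord]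
  ring

/-- Differentiation stays within polynomials times a Gaussian, which makes integration by parts an
algebraic relation on polynomials. -/
theorem pd_zero_polyGauss (c : ℝ) (p q : Polynomial ℝ) (x : Plane) :
    pd 0 (polyGauss c p q) x = polyGauss c (derivative p - C (2 * c) * X * p) q x := by
  rw [pd_polyGauss]
  simp [polyGauss]
  ring

theorem pd_one_polyGauss (c : ℝ) (p q : Polynomial ℝ) (x : Plane) :
    pd 1 (polyGauss c p q) x = polyGauss c p (derivative q - C (2 * c) * X * q) x := by
  rw [pd_polyGauss]
  simp [polyGauss]
  ring

/-! ### Hermite polynomials for the weight `e^{-x²/4}` -/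

/-- Hermite polynomials for the weight `e^{-x²/4}`, by the recursion `P_{n+1} = x P_n / 2 - P_n'`. -/
def hermiteQ : ℕ → Polynomial ℝ
  | 0 => 1
  | n + 1 => C (1 / 2) * X * hermiteQ n - derivative (hermiteQ n)

theorem derivative_hermiteQ_succ (n : ℕ) :
    derivative (hermiteQ (n + 1)) = C (((n : ℝ) + 1) / 2) * hermiteQ n := by
  induction n with
  | zero => simp [hermiteQ]
  | succ n ih =>
    have e : C ((((n + 1 : ℕ) : ℝ) + 1) / 2) = C (((n : ℝ) + 1) / 2) + C (1 / 2 : ℝ) := by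
      rw [← Polynomial.C_add]; congr 1; push_cast; ring
    have h1 : hermiteQ (n + 1) = C (1 / 2) * X * hermiteQ n - derivative (hermiteQ n) := rfl
    have h2 : hermiteQ (n + 2) = C (1 / 2) * X * hermiteQ (n + 1) - derivative (hermiteQ (n + 1)) :=
      rfl
    rw [e, h2, Polynomial.derivative_sub, ih, Polynomial.derivative_mul,
      Polynomial.derivative_C_mul, Polynomial.derivative_C_mul, ih, Polynomial.derivative_X,
      add_mul, h1]
    ring

/-- The hypothesis on `J` is integration by parts against `e^{-x²/4}`. It gives `J(P_{a+1} P_c) =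
J(P_a P_c')`, and `P_c'` is a multiple of `P_{c-1}`, so both indices drop together. Keeping `J`
abstract lets the lemma be applied to one coordinate at a time. -/
theorem hermiteQ_orthogonal (J : Polynomial ℝ →ₗ[ℝ] ℝ)
    (hJ : ∀ p, J (derivative p - C (1 / 2) * X * p) = 0) (a c : ℕ) :
    J (hermiteQ a * hermiteQ c) = if a = c then a.factorial / 2 ^ a * J 1 else 0 := by
  induction a generalizing c with
  | zero =>
    cases c with
    | zero => simp [hermiteQ]
    | succ k =>
      have := hJ (hermiteQ k)
      simp only [hermiteQ, one_mul]
      rw [if_neg (by omega), ← neg_eq_zero, ← map_neg, neg_sub, this]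
  | succ a ih =>
    have h := hJ (hermiteQ a * hermiteQ c)
    have e : derivative (hermiteQ a * hermiteQ c) - C (1 / 2) * X * (hermiteQ a * hermiteQ c)
        = hermiteQ a * derivative (hermiteQ c) - hermiteQ (a + 1) * hermiteQ c := by
      rw [Polynomial.derivative_mul, hermiteQ]; ring
    rw [e, map_sub, sub_eq_zero] at h
    rw [← h]
    cases c with
    | zero => simp [hermiteQ]
    | succ k =>
      rw [derivative_hermiteQ_succ, mul_left_comm, ← Polynomial.smul_eq_C_mul, map_smul, ih]
      by_cases hak : a = k
      · subst hak
        simp only [if_true, smul_eq_mul, Nat.factorial_succ, pow_succ]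
        push_cast
        field_simp
      · rw [if_neg hak, if_neg (by omega), smul_zero]

/-- The span contains `1` and is stable under multiplication by `X`, because `X P_n = 2 P_{n+1} + 2
P_n'` and `P_n'` is a multiple of `P_{n-1}`. -/
theorem hermiteQ_span : Submodule.span ℝ (Set.range hermiteQ) = ⊤ := by
  have hX : ∀ p ∈ Submodule.span ℝ (Set.range hermiteQ),
      X * p ∈ Submodule.span ℝ (Set.range hermiteQ) := by
    intro p hp
    induction hp using Submodule.span_induction with
    | zero => simp
    | add x y _ _ hx hy => rw [mul_add]; exact Submodule.add_mem _ hx hy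
    | smul a x _ hx => rw [mul_smul_comm]; exact Submodule.smul_mem _ a hx
    | mem x hx =>
      obtain ⟨n, rfl⟩ := hx
      have h1 : X * hermiteQ n = (2 : ℝ) • hermiteQ (n + 1) + (2 : ℝ) • derivative (hermiteQ n) := by
        rw [hermiteQ, ← smul_add, sub_add_cancel, Polynomial.smul_eq_C_mul, ← mul_assoc, ← mul_assoc,
          ← Polynomial.C_mul]
        norm_num
      rw [h1]
      refine Submodule.add_mem _ (Submodule.smul_mem _ _ (Submodule.subset_span ⟨_, rfl⟩))
        (Submodule.smul_mem _ _ ?_)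
      cases n with
      | zero => simp [hermiteQ]
      | succ k =>
        rw [derivative_hermiteQ_succ, ← Polynomial.smul_eq_C_mul]
        exact Submodule.smul_mem _ _ (Submodule.subset_span ⟨_, rfl⟩)
  rw [eq_top_iff]
  rintro p -
  induction p using Polynomial.induction_on' with
  | add p q hp hq => exact Submodule.add_mem _ hp hq
  | monomial n a =>
    rw [← Polynomial.C_mul_X_pow_eq_monomial, ← Polynomial.smul_eq_C_mul]
    refine Submodule.smul_mem _ _ ?_
    induction n with
    | zero => exact Submodule.subset_span ⟨0, by simp [hermiteQ]⟩
    | succ n ih => rw [pow_succ']; exact hX _ ih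

/-! ### Hermite functions -/

/-- The (unnormalized) Hermite functions adapted to the ground state `e^{-|x|²/8}`. -/
def hermiteF (i : ℕ × ℕ) : Plane → ℝ := polyGauss (1 / 8) (hermiteQ i.1) (hermiteQ i.2)

theorem integral_polyGauss_derivative_left {c : ℝ} (hc : 0 < c) (p q : Polynomial ℝ) :
    ∫ x, polyGauss c (derivative p - C (2 * c) * X * p) q x = 0 := by
  have h := integral_pd_eq_zero (𝕂 := ℝ) (f := polyGauss c p q)
    ((contDiff_polyGauss c p q).differentiable (by simp)) 0 (integrable_polyGauss hc p q)
  simp only [funext (pd_zero_polyGauss c p q)] at h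
  exact h (integrable_polyGauss hc _ _)

theorem integral_polyGauss_derivative_right {c : ℝ} (hc : 0 < c) (p q : Polynomial ℝ) :
    ∫ x, polyGauss c p (derivative q - C (2 * c) * X * q) x = 0 := by
  have h := integral_pd_eq_zero (𝕂 := ℝ) (f := polyGauss c p q)
    ((contDiff_polyGauss c p q).differentiable (by simp)) 1 (integrable_polyGauss hc p q)
  simp only [funext (pd_one_polyGauss c p q)] at h
  exact h (integrable_polyGauss hc _ _)

/-- The squared norm of `hermiteF`. -/
def hermiteN (i : ℕ × ℕ) : ℝ :=
  i.1.factorial / 2 ^ i.1 * (i.2.factorial / 2 ^ i.2 * (4 * Real.pi))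

theorem hermiteN_pos (i : ℕ × ℕ) : 0 < hermiteN i := by
  unfold hermiteN; positivity

/-- No Fubini is needed: the planar integral is a functional of the first polynomial with the second
frozen, and then of the second. The two rates `1/8` add up to `1/4`, the weight for which `hermiteQ`
is orthogonal. -/
theorem integral_hermiteF_mul (i k : ℕ × ℕ) :
    ∫ x, hermiteF i x * hermiteF k x = if i = k then hermiteN i else 0 := by
  have h4 : (0 : ℝ) < 1 / 4 := by norm_num
  let J : Polynomial ℝ →ₗ[ℝ] ℝ :=
    { toFun := fun p => ∫ x, polyGauss (1 / 4) p (hermiteQ i.2 * hermiteQ k.2) x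
      map_add' := fun p r => by
        rw [← integral_add (integrable_polyGauss h4 _ _) (integrable_polyGauss h4 _ _)]
        congr 1; ext x; simp [polyGauss]; ring
      map_smul' := fun a p => by
        rw [← integral_smul]
        congr 1; ext x; simp [polyGauss]; ring }
  let J' : Polynomial ℝ →ₗ[ℝ] ℝ :=
    { toFun := fun p => ∫ x, polyGauss (1 / 4) 1 p x
      map_add' := fun p r => by
        rw [← integral_add (integrable_polyGauss h4 _ _) (integrable_polyGauss h4 _ _)]
        congr 1; ext x; simp [polyGauss]; ring
      map_smul' := fun a p => by
        rw [← integral_smul]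
        congr 1; ext x; simp [polyGauss]; ring }
  have hJ : ∀ p, J (derivative p - C (1 / 2) * X * p) = 0 := fun p => by
    have := integral_polyGauss_derivative_left h4 p (hermiteQ i.2 * hermiteQ k.2)
    rw [show (2 : ℝ) * (1 / 4) = 1 / 2 by norm_num] at this
    exact this
  have hJ' : ∀ p, J' (derivative p - C (1 / 2) * X * p) = 0 := fun p => by
    have := integral_polyGauss_derivative_right h4 1 p
    rw [show (2 : ℝ) * (1 / 4) = 1 / 2 by norm_num] at this
    exact this
  have e1 : ∫ x, hermiteF i x * hermiteF k x = J (hermiteQ i.1 * hermiteQ k.1) := by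
    change _ = ∫ x, polyGauss (1 / 4) (hermiteQ i.1 * hermiteQ k.1) (hermiteQ i.2 * hermiteQ k.2) x
    congr 1; ext x
    rw [hermiteF, hermiteF, polyGauss_mul]
    norm_num
  have e2 : J 1 = J' (hermiteQ i.2 * hermiteQ k.2) := rfl
  have e3 : J' 1 = 4 * Real.pi := by
    change ∫ x, polyGauss (1 / 4) 1 1 x = _
    simp only [polyGauss, Polynomial.eval_one, one_mul]
    rw [integral_exp_neg_mul_norm_sq h4]
    ring
  rw [e1, hermiteQ_orthogonal J hJ, e2, hermiteQ_orthogonal J' hJ', e3]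
  obtain ⟨a, b⟩ := i
  obtain ⟨c, d⟩ := k
  simp only [Prod.mk.injEq, hermiteN]
  split_ifs <;> simp_all

end OseenVortex
end

open MeasureTheory
open scoped ContDiff
noncomputable section
namespace OseenVortex
open Filter Topology Set
open scoped ENNReal Convolution ComplexConjugate
open Polynomial (X C derivative)

/-! ### Completeness of the Hermite functions. -/

theorem integrable_mul_of_memLp {f g : Plane → ℂ} (hf : MemLp f 2) (hg : MemLp g 2) :
    Integrable (fun x => f x * g x) :=
  hf.integrable_mul hg

/-- Linear extension in each variable separately, since the polynomials `hermiteQ n` span. -/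
theorem integral_polyGauss_mul_eq_zero {u : Plane → ℂ} (hu : MemLp u 2)
    (h : ∀ i, ∫ x, ((hermiteF i x : ℝ) : ℂ) * u x = 0) (p q : Polynomial ℝ) :
    ∫ x, ((polyGauss (1 / 8) p q x : ℝ) : ℂ) * u x = 0 := by
  have h8 : (0 : ℝ) < 1 / 8 := by norm_num
  have hi : ∀ p q, Integrable (fun x => ((polyGauss (1 / 8) p q x : ℝ) : ℂ) * u x) :=
    fun p q => integrable_mul_of_memLp (memLp_polyGauss h8 p q) hu
  let J : Polynomial ℝ → Polynomial ℝ →ₗ[ℝ] ℂ := fun q =>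
    { toFun := fun p => ∫ x, ((polyGauss (1 / 8) p q x : ℝ) : ℂ) * u x
      map_add' := fun p r => by
        rw [← integral_add (hi _ _) (hi _ _)]
        congr 1; ext x; simp [polyGauss]; ring
      map_smul' := fun a p => by
        rw [← integral_smul]
        congr 1; ext x; simp [polyGauss]; ring }
  let J' : Polynomial ℝ → Polynomial ℝ →ₗ[ℝ] ℂ := fun p =>
    { toFun := fun q => ∫ x, ((polyGauss (1 / 8) p q x : ℝ) : ℂ) * u x
      map_add' := fun q r => by
        rw [← integral_add (hi _ _) (hi _ _)]
        congr 1; ext x; simp [polyGauss]; ring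
      map_smul' := fun a q => by
        rw [← integral_smul]
        congr 1; ext x; simp [polyGauss]; ring }
  have h1 : ∀ b, J (hermiteQ b) = 0 := fun b =>
    LinearMap.ext_on hermiteQ_span (by rintro _ ⟨a, rfl⟩; exact h (a, b))
  have h2 : J' p = 0 :=
    LinearMap.ext_on hermiteQ_span
      (by rintro _ ⟨b, rfl⟩; exact congrArg (fun L => L p) (h1 b))
  exact congrArg (fun L => L q) h2

theorem integral_inner_pow_mul_eq_zero {u : Plane → ℂ} (hu : MemLp u 2)
    (h : ∀ i, ∫ x, ((hermiteF i x : ℝ) : ℂ) * u x = 0) (k : Plane) (n : ℕ) :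
    ∫ x, (((inner ℝ x k) ^ n * polyGauss (1 / 8) 1 1 x : ℝ) : ℂ) * u x = 0 := by
  have h8 : (0 : ℝ) < 1 / 8 := by norm_num
  have e : ∀ x : Plane, (((inner ℝ x k) ^ n * polyGauss (1 / 8) 1 1 x : ℝ) : ℂ) * u x
      = ∑ m ∈ Finset.range (n + 1), (((polyGauss (1 / 8) ((C (k 0) * X) ^ m)
        ((C (k 1) * X) ^ (n - m) * (n.choose m : Polynomial ℝ)) x : ℝ) : ℂ) * u x) := by
    intro x
    rw [← Finset.sum_mul]
    congr 1
    norm_cast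
    have : inner ℝ x k = k 0 * x 0 + k 1 * x 1 := by
      simp [PiLp.inner_apply, Fin.sum_univ_two]
    rw [this, add_pow, Finset.sum_mul]
    refine Finset.sum_congr rfl fun m _ => ?_
    simp [polyGauss]
    ring
  simp only [e]
  rw [integral_finsetSum _ fun m _ => integrable_mul_of_memLp (memLp_polyGauss h8 _ _) hu]
  exact Finset.sum_eq_zero fun m _ => integral_polyGauss_mul_eq_zero hu h _ _

/-- The plane wave is expanded in its power series. Every term is a polynomial times the Gaussian
tested against `u`, hence zero; the Gaussian dominates the exponential of `|x·k|` and justifies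
termwise integration. -/
theorem fourier_eq_zero_of_hermite {u : Plane → ℂ} (hu : MemLp u 2)
    (h : ∀ i, ∫ x, ((hermiteF i x : ℝ) : ℂ) * u x = 0) (k : Plane) :
    ∫ x : Plane, Complex.exp (((-2 * Real.pi * inner ℝ x k : ℝ) : ℂ) * Complex.I)
      • (((polyGauss (1 / 8) 1 1 x : ℝ) : ℂ) * u x) = 0 := by
  have h16 : (0 : ℝ) < 1 / 16 := by norm_num
  set g : Plane → ℝ := polyGauss (1 / 8) 1 1 with hg
  have cg : Continuous g := (contDiff_polyGauss _ _ _).continuous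
  set a : Plane → ℝ := fun x => -2 * Real.pi * inner ℝ x k with ha
  have ca : Continuous a := by fun_prop
  set F : ℕ → Plane → ℂ := fun n x =>
    ((((a x : ℝ) : ℂ) * Complex.I) ^ n / n.factorial) * (((g x : ℝ) : ℂ) * u x)
  have gnn : ∀ x, 0 ≤ g x := fun x => by simp only [hg, polyGauss]; simp; positivity
  have hs := hasSum_integral_of_dominated_convergence (μ := (volume : Measure Plane)) (F := F)
    (f := fun x => Complex.exp (((a x : ℝ) : ℂ) * Complex.I) • (((g x : ℝ) : ℂ) * u x))
    (fun n x => (|a x| ^ n / n.factorial) * (g x * ‖u x‖)) ?_ ?_ ?_ ?_ ?_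
  · have hz : ∀ n, ∫ x, F n x = 0 := by
      intro n
      have e : ∀ x, F n x = ((((-2 * Real.pi : ℝ) : ℂ) * Complex.I) ^ n / n.factorial)
          * ((((inner ℝ x k) ^ n * g x : ℝ) : ℂ) * u x) := by
        intro x
        simp only [F, ha]
        push_cast
        ring
      simp only [e]
      rw [integral_const_mul, integral_inner_pow_mul_eq_zero hu h, mul_zero]
    simp only [hz] at hs
    exact hs.unique hasSum_zero
  · intro n
    have h1 : Continuous (fun x => (((a x : ℝ) : ℂ) * Complex.I) ^ n / n.factorial) := by fun_prop
    have h2 : Continuous (fun x => ((g x : ℝ) : ℂ)) := by fun_prop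
    exact h1.aestronglyMeasurable.mul (h2.aestronglyMeasurable.mul hu.1)
  · intro n
    refine ae_of_all _ fun x => le_of_eq ?_
    simp only [F, norm_mul, norm_div, norm_pow, Complex.norm_I, Complex.norm_real,
      Real.norm_eq_abs, mul_one, abs_of_nonneg (gnn x)]
    simp
  · exact ae_of_all _ fun x => (Real.summable_pow_div_factorial _).mul_right _
  · have e : ∀ x, ∑' n : ℕ, (|a x| ^ n / n.factorial) * (g x * ‖u x‖)
        = Real.exp |a x| * (g x * ‖u x‖) := by
      intro x
      rw [tsum_mul_right, Real.exp_eq_exp_ℝ, NormedSpace.exp_eq_tsum_div]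
    simp only [e]
    set c : ℝ := 2 * Real.pi * ‖k‖
    have hint := ((memLp_polyGauss h16 1 1).norm.integrable_mul hu.norm).const_mul
      (Real.exp (4 * c ^ 2))
    refine hint.mono' ?_ (ae_of_all _ fun x => ?_)
    · have h1 : Continuous (fun x => Real.exp |a x|) := by fun_prop
      exact h1.aestronglyMeasurable.mul (cg.aestronglyMeasurable.mul hu.1.norm)
    · have h1 : |a x| ≤ c * ‖x‖ := by
        have := abs_real_inner_le_norm x k
        simp only [ha, c]
        rw [abs_mul, abs_mul, abs_neg, abs_of_pos (by norm_num : (0:ℝ) < 2),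
          abs_of_pos Real.pi_pos]
        calc 2 * Real.pi * |inner ℝ x k| ≤ 2 * Real.pi * (‖x‖ * ‖k‖) := by gcongr
          _ = _ := by ring
      -- Half of the Gaussian rate `1/8` is spent on `c|x| ≤ |x|²/16 + 4c²`, that is, `(|x|/4 - 2c)²
      -- ≥ 0`.
      have h2 : Real.exp |a x| * g x ≤ Real.exp (4 * c ^ 2) * Real.exp (-(1 / 16) * ‖x‖ ^ 2) := by
        simp only [hg, polyGauss, Polynomial.eval_one, one_mul]
        rw [← Real.exp_add, ← Real.exp_add]
        apply Real.exp_le_exp.2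
        nlinarith [sq_nonneg (‖x‖ / 4 - 2 * c)]
      rw [Real.norm_of_nonneg (by have := gnn x; positivity)]
      simp only [Pi.mul_apply, Complex.norm_real, Real.norm_eq_abs, polyGauss,
        Polynomial.eval_one, one_mul, Real.abs_exp]
      calc Real.exp |a x| * (g x * ‖u x‖) = (Real.exp |a x| * g x) * ‖u x‖ := by ring
        _ ≤ (Real.exp (4 * c ^ 2) * Real.exp (-(1 / 16) * ‖x‖ ^ 2)) * ‖u x‖ := by gcongr
        _ = _ := by ring
  · refine ae_of_all _ fun x => ?_
    have := NormedSpace.expSeries_div_hasSum_exp (𝔸 := ℂ) (((a x : ℝ) : ℂ) * Complex.I)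
    rw [← Complex.exp_eq_exp_ℂ] at this
    exact this.mul_right _

/-- Injectivity of the Fourier transform on `L¹` by duality: a test function is the Fourier
transform of a Schwartz function `φ`, and its integral against `U` equals that of `φ` against the
transform of `U`. -/
theorem ae_eq_zero_of_fourier_eq_zero {U : Plane → ℂ} (hU : Integrable U)
    (h : ∀ k, FourierTransform.fourier U k = 0) : U =ᵐ[volume] 0 := by
  refine ae_eq_zero_of_integral_contDiff_smul_eq_zero hU.locallyIntegrable fun g hg hc => ?_
  have hgc : ContDiff ℝ ∞ (fun x => ((g x : ℝ) : ℂ)) := Complex.ofRealCLM.contDiff.comp hg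
  have hcc : HasCompactSupport (fun x => ((g x : ℝ) : ℂ)) := hc.comp_left (g := Complex.ofReal) rfl
  set G' : SchwartzMap Plane ℂ := hcc.toSchwartzMap hgc
  set φ := FourierTransformInv.fourierInv G'
  have h1 : FourierTransform.fourier φ = G' := FourierTransform.fourier_fourierInv_eq G'
  have h2 := VectorFourier.integral_fourierIntegral_smul_eq_flip (μ := (volume : Measure Plane))
    (ν := (volume : Measure Plane)) (L := innerₗ Plane) (f := U) (g := (φ : Plane → ℂ))
    Real.continuous_fourierChar continuous_inner hU φ.integrable
  have h3 : ∀ ξ, VectorFourier.fourierIntegral Real.fourierChar volume (innerₗ Plane) U ξ = 0 := h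
  simp only [h3, zero_smul, integral_zero] at h2
  have h4 : ∀ x, VectorFourier.fourierIntegral Real.fourierChar volume (innerₗ Plane).flip
      (φ : Plane → ℂ) x = ((g x : ℝ) : ℂ) := by
    intro x
    rw [flip_innerₗ]
    have : (FourierTransform.fourier φ : SchwartzMap Plane ℂ) x = G' x := by rw [h1]
    exact this
  simp only [h4] at h2
  rw [h2]
  refine integral_congr_ae (ae_of_all _ fun x => ?_)
  simp [mul_comm]

theorem ae_eq_zero_of_hermite {u : Plane → ℂ} (hu : MemLp u 2)
    (h : ∀ i, ∫ x, ((hermiteF i x : ℝ) : ℂ) * u x = 0) : u =ᵐ[volume] 0 := by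
  have h8 : (0 : ℝ) < 1 / 8 := by norm_num
  have := ae_eq_zero_of_fourier_eq_zero (integrable_mul_of_memLp (memLp_polyGauss h8 1 1) hu)
    fun k => by rw [Real.fourier_eq']; exact fourier_eq_zero_of_hermite hu h k
  filter_upwards [this] with x hx
  simpa [polyGauss, Complex.exp_ne_zero] using hx

end OseenVortex
end

open MeasureTheory
open scoped ContDiff
noncomputable section
namespace OseenVortex
open Filter Topology Set
open scoped ENNReal Convolution ComplexConjugate
open Polynomial (X C derivative)

/-! ### The Hermite basis of `L²` and Parseval's identity. -/

theorem inner_toLp {u v : Plane → ℂ} (hu : MemLp u 2) (hv : MemLp v 2) :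
    inner ℂ (hu.toLp u) (hv.toLp v) = ∫ x, conj (u x) * v x := by
  rw [L2.inner_def]
  refine integral_congr_ae ?_
  filter_upwards [hu.coeFn_toLp, hv.coeFn_toLp] with x h1 h2
  rw [h1, h2]
  simp [mul_comm]

theorem memLp_hermiteF (i : ℕ × ℕ) : MemLp (fun x => ((hermiteF i x : ℝ) : ℂ)) 2 :=
  memLp_polyGauss (by norm_num) _ _

/-- The normalized Hermite functions as elements of `L²`. -/
def hermiteE (i : ℕ × ℕ) : Lp ℂ 2 (volume : Measure Plane) :=
  (((Real.sqrt (hermiteN i))⁻¹ : ℝ) : ℂ) • (memLp_hermiteF i).toLp _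

theorem inner_hermiteE {u : Plane → ℂ} (hu : MemLp u 2) (i : ℕ × ℕ) :
    inner ℂ (hermiteE i) (hu.toLp u)
      = (((Real.sqrt (hermiteN i))⁻¹ : ℝ) : ℂ) * ∫ x, ((hermiteF i x : ℝ) : ℂ) * u x := by
  rw [hermiteE, inner_smul_left, inner_toLp]
  simp

theorem orthonormal_hermiteE : Orthonormal ℂ hermiteE := by
  rw [orthonormal_iff_ite]
  intro i k
  rw [hermiteE, hermiteE, inner_smul_left, inner_smul_right, inner_toLp]
  have e : ∫ x, conj ((hermiteF i x : ℝ) : ℂ) * ((hermiteF k x : ℝ) : ℂ)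
      = ((if i = k then hermiteN i else 0 : ℝ) : ℂ) := by
    rw [← integral_hermiteF_mul, ← integral_complex_ofReal]
    congr 1; ext x; simp
  rw [e]
  split_ifs with h
  · subst h
    have h0 := hermiteN_pos i
    have h1 : (Real.sqrt (hermiteN i))⁻¹ * ((Real.sqrt (hermiteN i))⁻¹ * hermiteN i) = 1 := by
      rw [← mul_assoc, ← mul_inv, Real.mul_self_sqrt h0.le, inv_mul_cancel₀ h0.ne']
    rw [Complex.conj_ofReal]
    exact_mod_cast h1
  · simp

theorem hermiteE_complete :
    (Submodule.span ℂ (Set.range hermiteE))ᗮ = ⊥ := by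
  rw [Submodule.eq_bot_iff]
  intro f hf
  rw [Submodule.mem_orthogonal] at hf
  have hu : MemLp (f : Plane → ℂ) 2 := Lp.memLp f
  have hz := ae_eq_zero_of_hermite hu fun i => by
    have h1 := hf (hermiteE i) (Submodule.subset_span ⟨i, rfl⟩)
    have h2 : f = hu.toLp (f : Plane → ℂ) := (Lp.toLp_coeFn f hu).symm
    rw [h2, inner_hermiteE] at h1
    rcases mul_eq_zero.1 h1 with h3 | h3
    · have := Real.sqrt_pos.2 (hermiteN_pos i)
      simp [this.ne'] at h3
    · exact h3
  exact (Lp.eq_zero_iff_ae_eq_zero).2 hz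

/-- The normalized squared Hermite coefficient. -/
def hermiteT (u : Plane → ℂ) (i : ℕ × ℕ) : ℝ :=
  ‖∫ x, ((hermiteF i x : ℝ) : ℂ) * u x‖ ^ 2 / hermiteN i

theorem hermiteT_nonneg (u : Plane → ℂ) (i : ℕ × ℕ) : 0 ≤ hermiteT u i :=
  div_nonneg (sq_nonneg _) (hermiteN_pos i).le

theorem conj_mul_self_re (z : ℂ) : (conj z * z).re = ‖z‖ ^ 2 := by
  rw [Complex.sq_norm, Complex.normSq_apply]; simp

theorem hasSum_hermiteT {u : Plane → ℂ} (hu : MemLp u 2) :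
    HasSum (hermiteT u) (∫ x, ‖u x‖ ^ 2) := by
  let bs := HilbertBasis.mkOfOrthogonalEqBot orthonormal_hermiteE hermiteE_complete
  have h := (bs.hasSum_inner_mul_inner (hu.toLp u) (hu.toLp u)).mapL (Complex.reCLM)
  have hb : ∀ i, bs i = hermiteE i := fun i => by
    simp only [bs, HilbertBasis.coe_mkOfOrthogonalEqBot]
  have e1 : Complex.reCLM (inner ℂ (hu.toLp u) (hu.toLp u)) = ∫ x, ‖u x‖ ^ 2 := by
    rw [inner_toLp]
    have hi : Integrable (fun x => conj (u x) * u x) := hu.star.integrable_mul hu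
    have := integral_re hi
    simp only [RCLike.re_to_complex, conj_mul_self_re] at this
    exact this.symm
  rw [e1] at h
  refine h.congr_fun ?_ |> fun h => h
  intro i
  rw [hb, ← inner_conj_symm (hu.toLp u) (hermiteE i)]
  rw [Complex.reCLM_apply, conj_mul_self_re, inner_hermiteE, norm_mul, mul_pow, Complex.norm_real,
    Real.norm_eq_abs, sq_abs, inv_pow, Real.sq_sqrt (hermiteN_pos i).le, hermiteT]
  ring

/-! ### Ladder operators and the gap of the harmonic oscillator. -/

/-- The annihilation operator `∂_j + x_j / 4`. -/
def annih (j : Fin 2) (u : Plane → ℂ) (x : Plane) : ℂ := pd j u x + ((x j / 4 : ℝ) : ℂ) * u x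

/-- Raise the `j`-th index. -/
def raise (j : Fin 2) (i : ℕ × ℕ) : ℕ × ℕ := if j = 0 then (i.1 + 1, i.2) else (i.1, i.2 + 1)

/-- The `j`-th index. -/
def idx (j : Fin 2) (i : ℕ × ℕ) : ℕ := if j = 0 then i.1 else i.2

theorem hermiteF_raise (j : Fin 2) (i : ℕ × ℕ) (x : Plane) :
    hermiteF (raise j i) x = x j / 4 * hermiteF i x - pd j (hermiteF i) x := by
  fin_cases j
  · simp only [hermiteF, raise, Fin.zero_eta, if_true, pd_zero_polyGauss]
    rw [hermiteQ]
    simp [polyGauss]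
    ring
  · simp only [hermiteF, raise, Fin.mk_one, one_ne_zero, if_false, pd_one_polyGauss]
    rw [hermiteQ]
    simp [polyGauss]
    ring

theorem continuous_annih {u : Plane → ℂ} (hu : ContDiff ℝ 1 u) (j : Fin 2) :
    Continuous (annih j u) := by
  have h1 := continuous_pd hu j
  have h2 := hu.continuous
  unfold annih
  fun_prop

theorem hasCompactSupport_annih {u : Plane → ℂ} (hc : HasCompactSupport u) (j : Fin 2) :
    HasCompactSupport (annih j u) := (hc.pd j).add hc.mul_left

/-- The adjoint of `∂_j + x_j/4` is `x_j/4 - ∂_j`, which raises the `j`-th Hermite index. -/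
theorem integral_hermiteF_mul_annih {u : Plane → ℂ} (hu : ContDiff ℝ 1 u)
    (hc : HasCompactSupport u) (j : Fin 2) (i : ℕ × ℕ) :
    ∫ x, ((hermiteF i x : ℝ) : ℂ) * annih j u x
      = ∫ x, ((hermiteF (raise j i) x : ℝ) : ℂ) * u x := by
  have hF : ∀ i, ContDiff ℝ 1 (hermiteF i) := fun i =>
    (contDiff_polyGauss _ _ _).of_le (by exact_mod_cast le_top)
  have hFC : ∀ i, ContDiff ℝ 1 (fun x => ((hermiteF i x : ℝ) : ℂ)) := fun i =>
    Complex.ofRealCLM.contDiff.comp (hF i)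
  have hV : ContDiff ℝ 1 (fun x => ((hermiteF i x : ℝ) : ℂ) * u x) := (hFC i).mul hu
  have h0 := integral_pd_eq_zero_of_hasCompactSupport hV hc.mul_left j
  rw [← sub_eq_zero, ← integral_sub, ← h0]
  · refine integral_congr_ae (ae_of_all _ fun x => ?_)
    simp only
    rw [pd_mul j ((hFC i).differentiable (by simp) x) (hu.differentiable (by simp) x),
      pd_ofReal j ((hF i).differentiable (by simp) x), hermiteF_raise, annih]
    push_cast
    ring
  · exact ((hFC i).continuous.mul (continuous_annih hu j)).integrable_of_hasCompactSupport
      (hasCompactSupport_annih hc j).mul_left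
  · exact ((hFC _).continuous.mul hu.continuous).integrable_of_hasCompactSupport hc.mul_left

theorem hermiteN_raise (j : Fin 2) (i : ℕ × ℕ) :
    hermiteN (raise j i) = ((idx j (raise j i) : ℝ) / 2) * hermiteN i := by
  fin_cases j
  · simp [hermiteN, raise, idx, Nat.factorial_succ, pow_succ]
    ring
  · simp [hermiteN, raise, idx, Nat.factorial_succ, pow_succ]
    ring

theorem raise_injective (j : Fin 2) : Function.Injective (raise j) := by
  intro a b h
  fin_cases j <;> simp_all [raise, Prod.ext_iff]

theorem idx_eq_zero_of_notMem_range_raise {j : Fin 2} {i : ℕ × ℕ} (h : i ∉ Set.range (raise j)) :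
    idx j i = 0 := by
  by_contra h0
  apply h
  obtain ⟨a, b⟩ := i
  fin_cases j
  · exact ⟨(a - 1, b), by simp [idx] at h0; simp [raise]; omega⟩
  · exact ⟨(a, b - 1), by simp [idx] at h0; simp [raise]; omega⟩

/-- Parseval for `annih j u`, whose coefficients are those of `u` at raised indices. The ratio of
the norms of consecutive Hermite functions supplies the factor `idx / 2`, and indices outside the
range of `raise j` carry weight zero. -/
theorem hasSum_idx_mul_hermiteT {u : Plane → ℂ} (hu : ContDiff ℝ 1 u)
    (hc : HasCompactSupport u) (j : Fin 2) :
    HasSum (fun i => (idx j i : ℝ) / 2 * hermiteT u i) (∫ x, ‖annih j u x‖ ^ 2) := by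
  have h := hasSum_hermiteT ((continuous_annih hu j).memLp_of_hasCompactSupport (p := 2)
    (μ := volume) (hasCompactSupport_annih hc j))
  rw [← (raise_injective j).hasSum_iff]
  · refine h.congr_fun ?_ |> fun h => h
    intro i
    have h1 := hermiteN_pos i
    have h2 := hermiteN_pos (raise j i)
    have h3 := hermiteN_raise j i
    simp only [hermiteT, Function.comp_apply, integral_hermiteF_mul_annih hu hc]
    have h4 : (idx j (raise j i) : ℝ) ≠ 0 := by
      intro h0
      rw [h0] at h3
      simp at h3
      linarith
    rw [h3]
    field_simp
  · intro i hi
    rw [idx_eq_zero_of_notMem_range_raise hi]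
    simp

/-- Expanding the square leaves the cross term `x_j ∂_j|u|² / 4`, whose integral is `-1/4` times
that of `|u|²`. The two coordinates together give the `-1/2`. -/
theorem integral_annih_sq {u : Plane → ℂ} (hu : ContDiff ℝ 1 u) (hc : HasCompactSupport u) :
    (∫ x, ‖annih 0 u x‖ ^ 2) + ∫ x, ‖annih 1 u x‖ ^ 2
      = ∫ x, ((∑ j, ‖pd j u x‖ ^ 2) + (‖x‖ ^ 2 / 16 - 1 / 2) * ‖u x‖ ^ 2) := by
  have cu := hu.continuous
  have cpu := fun j => continuous_pd hu j
  have zu : ∀ x, x ∉ tsupport u → u x = 0 := fun x hx => image_eq_zero_of_notMem_tsupport hx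
  have zpu : ∀ j x, x ∉ tsupport u → pd j u x = 0 := fun j x hx =>
    image_eq_zero_of_notMem_tsupport fun h => hx (tsupport_fderiv_apply_subset ℝ _ h)
  have hcu : ContDiff ℝ 1 (fun y => conj (u y)) :=
    (Complex.conjCLE : ℂ →L[ℝ] ℂ).contDiff.comp hu
  have hx : ∀ j, ContDiff ℝ 1 (fun y : Plane => ((y j : ℝ) : ℂ)) := fun j =>
    Complex.ofRealCLM.contDiff.comp (EuclideanSpace.proj j : Plane →L[ℝ] ℝ).contDiff
  let V : Fin 2 → Plane → ℂ := fun j y => ((y j : ℝ) : ℂ) * (conj (u y) * u y)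
  have hV : ∀ j, ContDiff ℝ 1 (V j) := fun j => (hx j).mul (hcu.mul hu)
  have hVc : ∀ j, HasCompactSupport (V j) := fun j => hc.mul_left.mul_left
  have hVi : ∀ j, Integrable (pd j (V j)) := fun j =>
    (continuous_pd (hV j) j).integrable_of_hasCompactSupport ((hVc j).pd j)
  have hz : ∀ j, ∫ x, (pd j (V j) x).re = 0 := by
    intro j
    have := integral_re (hVi j)
    simp only [RCLike.re_to_complex] at this
    rw [this, integral_pd_eq_zero_of_hasCompactSupport (hV j) (hVc j), Complex.zero_re]
  have hA : ∀ j, Integrable (fun x => ‖annih j u x‖ ^ 2) := fun j =>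
    ((continuous_annih hu j).norm.pow 2).integrable_of_hasCompactSupport
      (HasCompactSupport.intro hc fun x hx => by simp [annih, zu x hx, zpu j x hx])
  have hB : Integrable (fun x => (∑ j, ‖pd j u x‖ ^ 2) + (‖x‖ ^ 2 / 16 - 1 / 2) * ‖u x‖ ^ 2) := by
    refine Continuous.integrable_of_hasCompactSupport (by fun_prop)
      (HasCompactSupport.intro hc fun x hx => by simp [zu x hx, zpu _ x hx])
  have hR : ∀ j, Integrable (fun x => 1 / 4 * (pd j (V j) x).re) := fun j => (hVi j).re.const_mul _
  have hR2 : Integrable (fun x => 1 / 4 * (pd 0 (V 0) x).re + 1 / 4 * (pd 1 (V 1) x).re) :=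
    (hR 0).add (hR 1)
  have e : ∫ x, (1 / 4 * (pd 0 (V 0) x).re + 1 / 4 * (pd 1 (V 1) x).re) = 0 := by
    rw [integral_add (hR 0) (hR 1), integral_const_mul, integral_const_mul, hz, hz]
    simp
  rw [← add_zero (∫ x, ((∑ j, ‖pd j u x‖ ^ 2) + (‖x‖ ^ 2 / 16 - 1 / 2) * ‖u x‖ ^ 2)), ← e,
    ← integral_add hB hR2, ← integral_add (hA 0) (hA 1)]
  refine integral_congr_ae (ae_of_all _ fun x => ?_)
  have du := hu.differentiable (by simp) x
  have dcu := hcu.differentiable (by simp) x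
  have dx := fun j => (hx j).differentiable (by simp) x
  have dcc : DifferentiableAt ℝ (fun y => conj (u y) * u y) x := dcu.mul du
  have e3 : ∀ j, pd j (V j) x = ((x j : ℝ) : ℂ) * (conj (u x) * pd j u x + conj (pd j u x) * u x)
      + conj (u x) * u x := by
    intro j
    rw [pd_mul j (dx j) dcc, pd_mul j dcu du, pd_conj j du,
      pd_ofReal (f := fun y : Plane => y j) j
        (EuclideanSpace.proj j : Plane →L[ℝ] ℝ).differentiableAt, pd_coord]
    simp
  simp only [e3, Fin.sum_univ_two, norm_sq_eq, annih, Complex.sq_norm, Complex.normSq_apply,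
    Complex.add_re, Complex.add_im, Complex.mul_re, Complex.mul_im, Complex.conj_re,
    Complex.conj_im, Complex.ofReal_re, Complex.ofReal_im]
  ring

/-- The indices of the Hermite functions of degree less than `k`. -/
def lowIdx (k : ℕ) : Finset (ℕ × ℕ) :=
  (Finset.range k ×ˢ Finset.range k).filter fun i => i.1 + i.2 < k

/-- The spectral gap of the harmonic oscillator above the Hermite functions of degree `< k`. -/
theorem harmonic_oscillator_gap {u : Plane → ℂ} (hu : ContDiff ℝ 1 u) (hc : HasCompactSupport u)
    (k : ℕ) :
    (k : ℝ) / 2 * (∫ x, ‖u x‖ ^ 2) - (k : ℝ) / 2 * ∑ i ∈ lowIdx k, hermiteT u i ≤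
      ∫ x, ((∑ j, ‖pd j u x‖ ^ 2) + (‖x‖ ^ 2 / 16 - 1 / 2) * ‖u x‖ ^ 2) := by
  rw [← integral_annih_sq hu hc]
  have h0 := hasSum_hermiteT (hu.continuous.memLp_of_hasCompactSupport (p := 2) (μ := volume) hc)
  have h1 := ((hasSum_idx_mul_hermiteT hu hc 0).add (hasSum_idx_mul_hermiteT hu hc 1)).sub
    (h0.mul_left ((k : ℝ) / 2))
  -- The series has terms `((i.1 + i.2)/2 - k/2)` times `hermiteT u i`, nonnegative from degree `k`
  -- on, so its sum is at least its finite part over `lowIdx k`.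
  have h2 := sum_le_hasSum (lowIdx k) (fun i hi => ?_) h1
  · have h3 : -((k : ℝ) / 2 * ∑ i ∈ lowIdx k, hermiteT u i) ≤ ∑ i ∈ lowIdx k,
        ((idx 0 i : ℝ) / 2 * hermiteT u i + (idx 1 i : ℝ) / 2 * hermiteT u i
          - (k : ℝ) / 2 * hermiteT u i) := by
      rw [Finset.mul_sum, ← Finset.sum_neg_distrib]
      refine Finset.sum_le_sum fun i _ => ?_
      have := hermiteT_nonneg u i
      have a0 : 0 ≤ (idx 0 i : ℝ) / 2 * hermiteT u i := by positivity
      have a1 : 0 ≤ (idx 1 i : ℝ) / 2 * hermiteT u i := by positivity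
      linarith
    linarith
  · have h4 : k ≤ i.1 + i.2 := by
      by_contra hlt
      exact hi (by simp [lowIdx]; omega)
    have h5 : (k : ℝ) ≤ i.1 + i.2 := by exact_mod_cast h4
    have h6 := mul_nonneg (sub_nonneg.2 h5) (hermiteT_nonneg u i)
    simp only [idx, if_true, one_ne_zero, if_false]
    linarith

end OseenVortex
end

open MeasureTheory
open scoped ContDiff
noncomputable section
namespace OseenVortex
open Filter Topology Set
open scoped ENNReal Convolution ComplexConjugate

/-! ### Bounds for the Biot-Savart law -/

/-- The kernel `1 / |x|`. -/
def rker (x : Plane) : ℝ≥0∞ := ENNReal.ofReal ‖x‖⁻¹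

theorem measurable_rker : Measurable rker := by unfold rker; fun_prop

theorem rker_neg (x : Plane) : rker (-x) = rker x := by simp [rker]

/-- The integral of `1 / |x|` over the unit disc. -/
def rkerMass : ℝ≥0∞ := ∫⁻ x in Metric.ball (0 : Plane) 1, rker x

theorem rkerMass_lt_top : rkerMass < ⊤ := by
  have h : IntegrableOn (fun x : Plane => ‖x‖⁻¹) (Metric.ball 0 1) volume := by
    rw [integrableOn_fun_norm_addHaar volume (f := fun y : ℝ => y⁻¹)]
    have h1 : IntegrableOn (fun _ : ℝ => (1 : ℝ)) (Ioo 0 1) := by simp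
    refine h1.congr_fun (fun y hy => ?_) measurableSet_Ioo
    have := hy.1.ne'
    simp [this]
  have h2 := h.hasFiniteIntegral
  refine lt_of_le_of_lt (lintegral_mono fun x => ?_) h2
  rw [rker, ← ofReal_norm]
  exact ENNReal.ofReal_le_ofReal (le_abs_self _)

/-- Split at distance one: the singularity is integrable in the plane, and beyond it the kernel is
at most one. -/
theorem lintegral_rker_mul_le {W : Plane → ℝ≥0∞} {K : ℝ≥0∞}
    (hK : ∀ x, W x ≤ K) (ξ : Plane) :
    ∫⁻ η, rker (ξ - η) * W η ≤ rkerMass * K + ∫⁻ η, W η := by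
  set I : Plane → ℝ≥0∞ := (Metric.ball (0 : Plane) 1).indicator rker with hI
  have mI : Measurable I := measurable_rker.indicator measurableSet_ball
  have h1 : ∀ η, rker (ξ - η) * W η ≤ I (ξ - η) * K + W η := by
    intro η
    by_cases hb : ξ - η ∈ Metric.ball (0 : Plane) 1
    · rw [hI, indicator_of_mem hb]
      exact le_add_right (by gcongr; exact hK η)
    · refine le_add_left ?_
      have : rker (ξ - η) ≤ 1 := by
        rw [rker, ENNReal.ofReal_le_one]
        refine inv_le_one_of_one_le₀ ?_
        simpa using hb
      exact mul_le_of_le_one_left' this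
  have mI' : Measurable (fun η => I (ξ - η)) := mI.comp (measurable_const.sub measurable_id)
  refine (lintegral_mono h1).trans (le_of_eq ?_)
  rw [lintegral_add_left (mI'.mul_const K), lintegral_mul_const _ mI']
  congr 2
  rw [lintegral_sub_left_eq_self I ξ, hI, lintegral_indicator measurableSet_ball, rkerMass]

/-- The majorant `∫ |w(η)| / |ξ - η| dη` of the velocity field. -/
def potential (w : Plane → ℂ) (ξ : Plane) : ℝ≥0∞ := ∫⁻ η, rker (ξ - η) * ‖w η‖ₑ

theorem abs_perp_le (x : Plane) (j : Fin 2) : |perp x j| ≤ ‖x‖ := by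
  have h := norm_sq_eq x
  refine abs_le_of_sq_le_sq ?_ (norm_nonneg _)
  fin_cases j
  · simp [perp]; nlinarith [sq_nonneg (x 0)]
  · simp [perp]; nlinarith [sq_nonneg (x 1)]

theorem abs_kernel_le (x : Plane) (j : Fin 2) : |perp x j / ‖x‖ ^ 2| ≤ ‖x‖⁻¹ := by
  rw [abs_div, abs_of_nonneg (sq_nonneg ‖x‖)]
  rcases (norm_nonneg x).eq_or_lt with h | h
  · rw [← h]; simp
  · rw [div_le_iff₀ (by positivity)]
    have := abs_perp_le x j
    calc |perp x j| ≤ ‖x‖ := this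
      _ = _ := by field_simp

theorem enorm_kernel_mul_le (w : Plane → ℂ) (j : Fin 2) (ξ η : Plane) :
    ‖((perp (ξ - η) j / ‖ξ - η‖ ^ 2 : ℝ) : ℂ) * w η‖ₑ ≤ rker (ξ - η) * ‖w η‖ₑ := by
  rw [enorm_mul]
  gcongr
  rw [rker, ← ofReal_norm, Complex.norm_real]
  exact ENNReal.ofReal_le_ofReal (abs_kernel_le _ j)

theorem enorm_biotSavart_le (w : Plane → ℂ) (j : Fin 2) (ξ : Plane) :
    ‖biotSavart w j ξ‖ₑ ≤ potential w ξ := by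
  rw [biotSavart, enorm_mul]
  have h1 : ‖(1 / (2 * Real.pi) : ℂ)‖ₑ ≤ 1 := by
    rw [← ofReal_norm, ENNReal.ofReal_le_one, norm_div, norm_mul, Complex.norm_real,
      Real.norm_of_nonneg Real.pi_pos.le]
    simp only [norm_one, Complex.norm_ofNat]
    rw [div_le_one (by positivity)]
    linarith [Real.pi_gt_three]
  refine (mul_le_of_le_one_left' h1).trans ((enorm_integral_le_lintegral_enorm _).trans ?_)
  exact lintegral_mono fun η => enorm_kernel_mul_le w j ξ η

theorem measurable_kernel (j : Fin 2) :
    Measurable (fun x : Plane => perp x j / ‖x‖ ^ 2) := by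
  have h : Continuous (fun x : Plane => perp x j) := by
    fin_cases j
    · simp [perp]; fun_prop
    · simp [perp]; fun_prop
  exact h.measurable.div (by fun_prop)

theorem aestronglyMeasurable_kernel_mul {w : Plane → ℂ} (hw : AEStronglyMeasurable w volume)
    (j : Fin 2) : AEStronglyMeasurable
      (fun p : Plane × Plane => ((perp (p.1 - p.2) j / ‖p.1 - p.2‖ ^ 2 : ℝ) : ℂ) * w p.2)
      (volume.prod volume) := by
  have h1 : Measurable (fun p : Plane × Plane => ((perp (p.1 - p.2) j / ‖p.1 - p.2‖ ^ 2 : ℝ) : ℂ)) :=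
    Complex.measurable_ofReal.comp
      ((measurable_kernel j).comp (measurable_fst.sub measurable_snd))
  exact h1.aestronglyMeasurable.mul hw.comp_snd

theorem aestronglyMeasurable_biotSavart {w : Plane → ℂ} (hw : AEStronglyMeasurable w volume)
    (j : Fin 2) : AEStronglyMeasurable (biotSavart w j) volume :=
  ((aestronglyMeasurable_kernel_mul hw j).integral_prod_right').const_mul _

theorem b_pos (ξ : Plane) : 0 < b ξ := Real.sqrt_pos.2 (by positivity)

theorem continuous_b_rpow (m : ℝ) : Continuous (fun ξ => b ξ ^ m) := by
  have : Continuous b := by unfold b; fun_prop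
  exact this.rpow_const fun ξ => Or.inl (b_pos ξ).ne'

theorem b_rpow_sq (m : ℝ) (ξ : Plane) : (b ξ ^ m) ^ 2 = (1 + ‖ξ‖ ^ 2) ^ m := by
  rw [b, Real.sqrt_eq_rpow, ← Real.rpow_natCast, ← Real.rpow_mul (by positivity),
    ← Real.rpow_mul (by positivity)]
  congr 1
  push_cast
  ring

theorem lintegral_weight_lt_top {m : ℝ} (hm : 1 < m) :
    ∫⁻ ξ : Plane, ENNReal.ofReal (b ξ ^ (-m)) ^ 2 < ⊤ := by
  have h := (integrable_rpow_neg_one_add_norm_sq (E := Plane) (μ := volume) (r := 2 * m)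
    (by simp; linarith)).hasFiniteIntegral
  refine lt_of_le_of_lt (lintegral_mono fun ξ => ?_) h
  rw [← ENNReal.ofReal_pow (by have := b_pos ξ; positivity), b_rpow_sq, ← ofReal_norm]
  refine ENNReal.ofReal_le_ofReal (le_trans (le_of_eq ?_) (le_abs_self _))
  congr 1
  ring

/-- Cauchy–Schwarz for the measure with density `1/|ξ - η|`, after writing `w = b^{-m} · b^m w`. -/
theorem potential_sq_le {m : ℝ} {w : Plane → ℂ} (hw : AEStronglyMeasurable w volume) (ξ : Plane) :
    potential w ξ ^ 2 ≤ (∫⁻ η, rker (ξ - η) * ENNReal.ofReal (b η ^ (-m)) ^ 2) *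
      ∫⁻ η, rker (ξ - η) * ‖((b η ^ m : ℝ) : ℂ) * w η‖ₑ ^ 2 := by
  have mk : Measurable (fun η => rker (ξ - η)) := measurable_rker.comp (measurable_const.sub measurable_id)
  set f : Plane → ℝ≥0∞ := fun η => rker (ξ - η) ^ (1 / 2 : ℝ) * ENNReal.ofReal (b η ^ (-m))
  set g : Plane → ℝ≥0∞ := fun η => rker (ξ - η) ^ (1 / 2 : ℝ) * ‖((b η ^ m : ℝ) : ℂ) * w η‖ₑ
  have hf : AEMeasurable f volume :=
    ((mk.pow_const _).mul (continuous_b_rpow (-m)).measurable.ennreal_ofReal).aemeasurable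
  have hg : AEMeasurable g volume := by
    refine (mk.pow_const _).aemeasurable.mul ?_
    have : AEStronglyMeasurable (fun η => ((b η ^ m : ℝ) : ℂ) * w η) volume :=
      (Complex.continuous_ofReal.comp (continuous_b_rpow m)).aestronglyMeasurable.mul hw
    exact this.enorm
  have h := ENNReal.lintegral_mul_le_Lp_mul_Lq volume Real.HolderConjugate.two_two hf hg
  have e : ∀ η, (f * g) η = rker (ξ - η) * ‖w η‖ₑ := by
    intro η
    have hb := b_pos η
    simp only [f, g, Pi.mul_apply]
    rw [enorm_mul, mul_mul_mul_comm, ← ENNReal.rpow_add_of_nonneg _ _ (by norm_num) (by norm_num),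
      ← mul_assoc (ENNReal.ofReal _), ← ofReal_norm (((b η ^ m : ℝ) : ℂ)), Complex.norm_real,
      Real.norm_of_nonneg (by positivity), ← ENNReal.ofReal_mul (by positivity),
      ← Real.rpow_add hb]
    norm_num
  have ef : ∀ η, f η ^ (2 : ℝ) = rker (ξ - η) * ENNReal.ofReal (b η ^ (-m)) ^ 2 := by
    intro η
    simp only [f]
    rw [ENNReal.mul_rpow_of_nonneg _ _ (by norm_num), ← ENNReal.rpow_mul]
    norm_num
  have eg : ∀ η, g η ^ (2 : ℝ) = rker (ξ - η) * ‖((b η ^ m : ℝ) : ℂ) * w η‖ₑ ^ 2 := by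
    intro η
    simp only [g]
    rw [ENNReal.mul_rpow_of_nonneg _ _ (by norm_num), ← ENNReal.rpow_mul]
    norm_num
  simp only [e, ef, eg] at h
  have h2 := pow_le_pow_left' h 2
  have hsq : ∀ a : ℝ≥0∞, (a ^ (1 / 2 : ℝ)) ^ 2 = a := fun a => by
    rw [← ENNReal.rpow_natCast, ← ENNReal.rpow_mul]; norm_num
  rw [mul_pow, hsq, hsq] at h2
  exact h2

/-- The first factor in `potential_sq_le` is bounded uniformly in `ξ`, because `b^{-2m}` is bounded
and, for `m > 1`, integrable. Tonelli moves the kernel onto `W`, where the same splitting gives a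
uniform bound. Square integrability of the velocity against a Gaussian is all that is needed later.
-/
theorem lintegral_potential_sq_lt_top {m : ℝ} (hm : 1 < m) {w : Plane → ℂ} (hw : w ∈ L2 m)
    {W : Plane → ℝ≥0∞} (hW : Measurable W) (hW1 : ∀ x, W x ≤ 1) (hWi : ∫⁻ x, W x < ⊤) :
    ∫⁻ ξ, potential w ξ ^ 2 * W ξ < ⊤ := by
  set β : Plane → ℝ≥0∞ := fun η => ENNReal.ofReal (b η ^ (-m)) ^ 2
  set h : Plane → ℝ≥0∞ := fun η => ‖((b η ^ m : ℝ) : ℂ) * w η‖ₑ ^ 2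
  have mβ : Measurable β := (continuous_b_rpow (-m)).measurable.ennreal_ofReal.pow_const 2
  have hβ1 : ∀ η, β η ≤ 1 := by
    intro η
    refine pow_le_one₀ zero_le ?_
    rw [ENNReal.ofReal_le_one]
    refine Real.rpow_le_one_of_one_le_of_nonpos ?_ (by linarith)
    rw [b]
    exact Real.one_le_sqrt.2 (by nlinarith [sq_nonneg ‖η‖])
  set K1 := rkerMass * 1 + ∫⁻ η, β η
  set K2 := rkerMass * 1 + ∫⁻ η, W η
  have hK1 : K1 < ⊤ := ENNReal.add_lt_top.2
    ⟨by simpa using rkerMass_lt_top, lintegral_weight_lt_top hm⟩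
  have hK2 : K2 < ⊤ := ENNReal.add_lt_top.2 ⟨by simpa using rkerMass_lt_top, hWi⟩
  have hh : ∫⁻ η, h η < ⊤ := by
    have h1 := hw.2.eLpNorm_lt_top
    rw [eLpNorm_lt_top_iff_lintegral_rpow_enorm_lt_top (by norm_num) (by norm_num)] at h1
    simpa [h] using h1
  have mh : AEMeasurable h volume := hw.2.1.enorm.pow_const 2
  have mk : Measurable (fun p : Plane × Plane => rker (p.1 - p.2)) :=
    measurable_rker.comp (measurable_fst.sub measurable_snd)
  calc ∫⁻ ξ, potential w ξ ^ 2 * W ξ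
      ≤ ∫⁻ ξ, K1 * ∫⁻ η, rker (ξ - η) * h η * W ξ := by
        refine lintegral_mono fun ξ => ?_
        have h1 := potential_sq_le (m := m) hw.1.1 ξ
        have h2 := lintegral_rker_mul_le hβ1 ξ
        have m1 : AEMeasurable (fun η => rker (ξ - η) * h η) volume :=
          (measurable_rker.comp (measurable_const.sub measurable_id)).aemeasurable.mul mh
        rw [lintegral_mul_const'' _ m1, ← mul_assoc]
        gcongr
        exact h1.trans (by gcongr)
    _ = K1 * ∫⁻ ξ, ∫⁻ η, rker (ξ - η) * h η * W ξ := lintegral_const_mul' _ _ hK1.ne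
    _ = K1 * ∫⁻ η, ∫⁻ ξ, rker (ξ - η) * h η * W ξ := by
        rw [lintegral_lintegral_swap]
        exact (mk.aemeasurable.mul mh.comp_snd).mul (hW.comp measurable_fst).aemeasurable
    _ ≤ K1 * ∫⁻ η, K2 * h η := by
        gcongr with η
        have h2 := lintegral_rker_mul_le hW1 η
        have m1 : Measurable (fun ξ => rker (η - ξ) * W ξ) :=
          (measurable_rker.comp (measurable_const.sub measurable_id)).mul hW
        calc ∫⁻ ξ, rker (ξ - η) * h η * W ξ = ∫⁻ ξ, (rker (η - ξ) * W ξ) * h η := by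
              refine lintegral_congr fun ξ => ?_
              rw [← rker_neg (ξ - η), neg_sub]
              ring
          _ = (∫⁻ ξ, rker (η - ξ) * W ξ) * h η := lintegral_mul_const _ m1
          _ ≤ K2 * h η := by gcongr
    _ = K1 * (K2 * ∫⁻ η, h η) := by rw [lintegral_const_mul' _ _ hK2.ne]
    _ < ⊤ := ENNReal.mul_lt_top hK1 (ENNReal.mul_lt_top hK2 hh)

theorem integrable_norm_biotSavart_sq {m : ℝ} (hm : 1 < m) {w : Plane → ℂ} (hw : w ∈ L2 m)
    (j : Fin 2) {c : ℝ} (hc : 0 < c) :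
    Integrable (fun ξ => ‖biotSavart w j ξ‖ ^ 2 * Real.exp (-c * ‖ξ‖ ^ 2)) := by
  have cE : Continuous (fun ξ : Plane => Real.exp (-c * ‖ξ‖ ^ 2)) := by fun_prop
  refine ⟨((aestronglyMeasurable_biotSavart hw.1.1 j).norm.pow 2).mul cE.aestronglyMeasurable, ?_⟩
  have h := lintegral_potential_sq_lt_top hm hw (W := fun ξ => ENNReal.ofReal
    (Real.exp (-c * ‖ξ‖ ^ 2))) cE.measurable.ennreal_ofReal (fun x => by
      rw [ENNReal.ofReal_le_one, Real.exp_le_one_iff]; nlinarith [sq_nonneg ‖x‖]) ?_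
  · refine lt_of_le_of_lt (lintegral_mono fun ξ => ?_) h
    rw [enorm_mul, enorm_pow, enorm_norm]
    gcongr
    · exact enorm_biotSavart_le w j ξ
    · rw [← ofReal_norm, Real.norm_of_nonneg (Real.exp_pos _).le]
  · have h1 := (integrable_exp_neg_mul_norm_sq hc).hasFiniteIntegral
    refine lt_of_le_of_lt (le_of_eq (lintegral_congr fun ξ => ?_)) h1
    rw [← ofReal_norm, Real.norm_of_nonneg (Real.exp_pos _).le]

/-! ### The term `v · ∇G` -/

/-- The function `v · ∇G`. -/
def velGradG (w : Plane → ℂ) (ξ : Plane) : ℂ :=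
  ∑ j : Fin 2, biotSavart w j ξ * ((pd j G ξ : ℝ) : ℂ)

theorem pd_G (j : Fin 2) (ξ : Plane) : pd j G ξ = -(ξ j / 2) * G ξ := by
  have h : HasDerivAt (fun t : ℝ => 1 / (4 * Real.pi) * Real.exp (-t / 4))
      (1 / (4 * Real.pi) * (-(1 / 4) * Real.exp (-‖ξ‖ ^ 2 / 4))) (‖ξ‖ ^ 2) := by
    have := (hasDerivAt_exp_neg_mul (1 / 4) (‖ξ‖ ^ 2)).const_mul (1 / (4 * Real.pi))
    convert! this using 1
    · ext t; congr 2; ring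
    · congr 3; ring
  have h2 := pd_radial h j
  change pd j (fun y : Plane => 1 / (4 * Real.pi) * Real.exp (-‖y‖ ^ 2 / 4)) ξ = _
  rw [h2, G]
  ring

theorem continuous_G : Continuous G := by unfold G; fun_prop

theorem continuous_pd_G (j : Fin 2) : Continuous (pd j G) := by
  rw [funext (pd_G j)]
  have := continuous_G
  fun_prop

theorem aestronglyMeasurable_velGradG {w : Plane → ℂ} (hw : AEStronglyMeasurable w volume) :
    AEStronglyMeasurable (velGradG w) volume :=
  Finset.aestronglyMeasurable_fun_sum _ fun j _ => (aestronglyMeasurable_biotSavart hw j).mul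
    (Complex.continuous_ofReal.comp (continuous_pd_G j)).aestronglyMeasurable

/-- The square of `∇G` decays like `e^{-|ξ|²/2}` up to a quadratic factor, which costs a rate
`1/16`; the balance is `1/16 - 1/2 + 3/8 = -1/16`. The rate `3/8` exceeds the weight `1/4` by a
margin that later absorbs the polynomial factor `(1 + |ξ|²)^m`. -/
theorem norm_velGradG_sq_le (w : Plane → ℂ) (ξ : Plane) :
    ‖velGradG w ξ‖ ^ 2 * Real.exp (3 / 8 * ‖ξ‖ ^ 2) ≤
      32 * (‖biotSavart w 0 ξ‖ ^ 2 * Real.exp (-(1 / 16) * ‖ξ‖ ^ 2)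
        + ‖biotSavart w 1 ξ‖ ^ 2 * Real.exp (-(1 / 16) * ‖ξ‖ ^ 2)) := by
  have hj : ∀ j, pd j G ξ ^ 2 * Real.exp (3 / 8 * ‖ξ‖ ^ 2) ≤
      16 * Real.exp (-(1 / 16) * ‖ξ‖ ^ 2) := by
    intro j
    have h1 : ξ j ^ 2 ≤ ‖ξ‖ ^ 2 := by
      rw [norm_sq_eq]
      fin_cases j
      · simp; positivity
      · simp; positivity
    have h2 : G ξ ^ 2 ≤ Real.exp (-(1 / 2) * ‖ξ‖ ^ 2) := by
      have h3 : (1 / (4 * Real.pi)) ^ 2 ≤ 1 := by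
        refine pow_le_one₀ (by positivity) ?_
        rw [div_le_one (by positivity)]
        linarith [Real.pi_gt_three]
      rw [G, mul_pow, ← Real.exp_nat_mul]
      calc (1 / (4 * Real.pi)) ^ 2 * Real.exp (((2 : ℕ) : ℝ) * (-‖ξ‖ ^ 2 / 4))
          ≤ 1 * Real.exp (((2 : ℕ) : ℝ) * (-‖ξ‖ ^ 2 / 4)) := by gcongr
        _ = _ := by rw [one_mul]; congr 1; push_cast; ring
    have h4 : ‖ξ‖ ^ 2 / 16 ≤ Real.exp (1 / 16 * ‖ξ‖ ^ 2) := by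
      have := Real.add_one_le_exp (1 / 16 * ‖ξ‖ ^ 2)
      linarith
    rw [pd_G]
    calc (-(ξ j / 2) * G ξ) ^ 2 * Real.exp (3 / 8 * ‖ξ‖ ^ 2)
        = ξ j ^ 2 / 4 * G ξ ^ 2 * Real.exp (3 / 8 * ‖ξ‖ ^ 2) := by ring
      _ ≤ (16 * Real.exp (1 / 16 * ‖ξ‖ ^ 2)) * Real.exp (-(1 / 2) * ‖ξ‖ ^ 2)
          * Real.exp (3 / 8 * ‖ξ‖ ^ 2) := by
          have h5 : ξ j ^ 2 / 4 ≤ 16 * Real.exp (1 / 16 * ‖ξ‖ ^ 2) := by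
            nlinarith [sq_nonneg (ξ j)]
          gcongr
      _ = 16 * Real.exp (-(1 / 16) * ‖ξ‖ ^ 2) := by
          rw [mul_assoc, mul_assoc, ← Real.exp_add, ← Real.exp_add]
          congr 2; ring
  have h1 : ‖velGradG w ξ‖ ^ 2 ≤ 2 * (‖biotSavart w 0 ξ‖ ^ 2 * pd 0 G ξ ^ 2
      + ‖biotSavart w 1 ξ‖ ^ 2 * pd 1 G ξ ^ 2) := by
    rw [velGradG, Fin.sum_univ_two]
    have h2 := norm_add_le (biotSavart w 0 ξ * ((pd 0 G ξ : ℝ) : ℂ))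
      (biotSavart w 1 ξ * ((pd 1 G ξ : ℝ) : ℂ))
    rw [norm_mul, norm_mul, Complex.norm_real, Complex.norm_real, Real.norm_eq_abs,
      Real.norm_eq_abs] at h2
    have h3 := pow_le_pow_left₀ (norm_nonneg _) h2 2
    refine h3.trans ?_
    rw [← sq_abs (pd 0 G ξ), ← sq_abs (pd 1 G ξ)]
    nlinarith [sq_nonneg (‖biotSavart w 0 ξ‖ * |pd 0 G ξ| - ‖biotSavart w 1 ξ‖ * |pd 1 G ξ|)]
  calc ‖velGradG w ξ‖ ^ 2 * Real.exp (3 / 8 * ‖ξ‖ ^ 2)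
      ≤ 2 * (‖biotSavart w 0 ξ‖ ^ 2 * pd 0 G ξ ^ 2 + ‖biotSavart w 1 ξ‖ ^ 2 * pd 1 G ξ ^ 2)
        * Real.exp (3 / 8 * ‖ξ‖ ^ 2) := by gcongr
    _ = 2 * (‖biotSavart w 0 ξ‖ ^ 2 * (pd 0 G ξ ^ 2 * Real.exp (3 / 8 * ‖ξ‖ ^ 2))
        + ‖biotSavart w 1 ξ‖ ^ 2 * (pd 1 G ξ ^ 2 * Real.exp (3 / 8 * ‖ξ‖ ^ 2))) := by ring
    _ ≤ 2 * (‖biotSavart w 0 ξ‖ ^ 2 * (16 * Real.exp (-(1 / 16) * ‖ξ‖ ^ 2))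
        + ‖biotSavart w 1 ξ‖ ^ 2 * (16 * Real.exp (-(1 / 16) * ‖ξ‖ ^ 2))) := by
        have h0 := mul_le_mul_of_nonneg_left (hj 0) (sq_nonneg ‖biotSavart w 0 ξ‖)
        have h1 := mul_le_mul_of_nonneg_left (hj 1) (sq_nonneg ‖biotSavart w 1 ξ‖)
        linarith
    _ = _ := by ring

theorem integrable_velGradG_sq {m : ℝ} (hm : 1 < m) {w : Plane → ℂ} (hw : w ∈ L2 m) :
    Integrable (fun ξ => ‖velGradG w ξ‖ ^ 2 * Real.exp (3 / 8 * ‖ξ‖ ^ 2)) := by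
  have h16 : (0 : ℝ) < 1 / 16 := by norm_num
  have h := ((integrable_norm_biotSavart_sq hm hw 0 h16).add
    (integrable_norm_biotSavart_sq hm hw 1 h16)).const_mul 32
  have cE : Continuous (fun ξ : Plane => Real.exp (3 / 8 * ‖ξ‖ ^ 2)) := by fun_prop
  refine h.mono' (((aestronglyMeasurable_velGradG hw.1.1).norm.pow 2).mul cE.aestronglyMeasurable)
    (ae_of_all _ fun ξ => ?_)
  rw [Real.norm_of_nonneg (by positivity)]
  exact norm_velGradG_sq_le w ξ

theorem memLp_velGradG {m : ℝ} (hm : 1 < m) {w : Plane → ℂ} (hw : w ∈ L2 m) :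
    MemLp (velGradG w) 2 := by
  have hM := aestronglyMeasurable_velGradG hw.1.1
  rw [memLp_two_iff_integrable_sq_norm hM]
  refine (integrable_velGradG_sq hm hw).mono' (hM.norm.pow 2) (ae_of_all _ fun ξ => ?_)
  rw [Real.norm_of_nonneg (by positivity)]
  exact le_mul_of_one_le_right (by positivity) (Real.one_le_exp (by positivity))

end OseenVortex
end

open MeasureTheory
open scoped ContDiff
noncomputable section
namespace OseenVortex
open Filter Topology Set
open scoped ENNReal Convolution ComplexConjugate

/-! ### The velocity field of the vortex -/

/-- The smooth extension of `(1 - e^{-s/4}) / (2 π s)`. -/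
def swirl (s : ℝ) : ℝ := 1 / (2 * Real.pi) * dslope (fun s => 1 - Real.exp (-(1 / 4) * s)) 0 s

/-- At the origin the divided slope of an analytic function is analytic; elsewhere it is a smooth
quotient. -/
theorem contDiff_swirl : ContDiff ℝ ∞ swirl := by
  have hf : ContDiff ℝ ∞ (fun s : ℝ => 1 - Real.exp (-(1 / 4) * s)) := by fun_prop
  have ha : AnalyticAt ℝ (fun s : ℝ => 1 - Real.exp (-(1 / 4) * s)) 0 := by fun_prop
  refine contDiff_const.mul (contDiff_iff_contDiffAt.2 fun s => ?_)
  rcases eq_or_ne s 0 with rfl | hs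
  · obtain ⟨p, hp⟩ := ha
    exact (AnalyticAt.contDiffAt ⟨_, hp.has_fpower_series_dslope_fslope⟩)
  · refine ContDiffAt.congr_of_eventuallyEq ?_ (dslope_eventuallyEq_slope_of_ne _ hs)
    simp only [slope_fun_def_field]
    exact (hf.contDiffAt.sub contDiffAt_const).div (contDiffAt_id.sub contDiffAt_const)
      (by simpa using hs)

theorem vG_apply (ξ : Plane) (j : Fin 2) : vG ξ j = swirl (‖ξ‖ ^ 2) * perp ξ j := by
  rcases eq_or_ne ξ 0 with rfl | h
  · simp [vG, perp]
    fin_cases j <;> simp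
  · have h2 : ‖ξ‖ ^ 2 ≠ 0 := by simpa using h
    rw [vG, swirl, dslope_of_ne _ h2, slope_def_field]
    simp
    left
    congr 2
    ring_nf

theorem vG_zero (ξ : Plane) : vG ξ 0 = -(swirl (‖ξ‖ ^ 2) * ξ 1) := by
  rw [vG_apply]; simp [perp]

theorem vG_one (ξ : Plane) : vG ξ 1 = swirl (‖ξ‖ ^ 2) * ξ 0 := by
  rw [vG_apply]; simp [perp]

theorem contDiff_coord (j : Fin 2) : ContDiff ℝ ∞ (fun ξ : Plane => ξ j) :=
  (EuclideanSpace.proj j : Plane →L[ℝ] ℝ).contDiff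

theorem contDiff_vG (j : Fin 2) : ContDiff ℝ ∞ (fun ξ => vG ξ j) := by
  have h : ContDiff ℝ ∞ (fun ξ : Plane => swirl (‖ξ‖ ^ 2)) :=
    contDiff_swirl.comp (contDiff_norm_sq ℝ)
  fin_cases j
  · simp only [Fin.zero_eta, vG_zero]
    exact (h.mul (contDiff_coord 1)).neg
  · simp only [Fin.mk_one, vG_one]
    exact h.mul (contDiff_coord 0)

/-- The gradient of the radial factor is parallel to `ξ`, hence orthogonal to `ξ^⊥`, and `ξ^⊥` is
itself divergence free. -/
theorem div_vG (ξ : Plane) : ∑ j, pd j (fun ξ => vG ξ j) ξ = 0 := by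
  have hs : HasDerivAt swirl (deriv swirl (‖ξ‖ ^ 2)) (‖ξ‖ ^ 2) :=
    (contDiff_swirl.differentiable (by simp) _).hasDerivAt
  have d1 := (hasFDerivAt_radial hs).differentiableAt
  have d2 : ∀ j, DifferentiableAt ℝ (fun ξ : Plane => ξ j) ξ := fun j =>
    (contDiff_coord j).differentiable (by simp) ξ
  have e0 : (fun ξ => vG ξ 0) = fun ξ => (-1) * (swirl (‖ξ‖ ^ 2) * ξ 1) := by
    ext ξ; rw [vG_zero]; ring
  have d3 : DifferentiableAt ℝ (fun ξ : Plane => swirl (‖ξ‖ ^ 2) * ξ 1) ξ := d1.mul (d2 1)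
  rw [Fin.sum_univ_two, e0, pd_mul 0 (differentiableAt_const _) d3, pd_mul 0 d1 (d2 1), funext vG_one,
    pd_mul 1 d1 (d2 0), pd_radial hs, pd_radial hs, pd_coord, pd_coord]
  simp [pd]
  ring

theorem sum_vG_mul (ξ : Plane) : ∑ j, vG ξ j * ξ j = 0 := by
  rw [Fin.sum_univ_two, vG_zero, vG_one]; ring

theorem abs_vG_le (ξ : Plane) (j : Fin 2) : |vG ξ j| ≤ ‖ξ‖ := by
  have h1 : |1 / (2 * Real.pi) * ((1 - Real.exp (-‖ξ‖ ^ 2 / 4)) / ‖ξ‖ ^ 2)| ≤ 1 := by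
    have hp : |1 / (2 * Real.pi)| ≤ 1 := by
      rw [abs_of_pos (by positivity), div_le_one (by positivity)]
      linarith [Real.pi_gt_three]
    have hq : |(1 - Real.exp (-‖ξ‖ ^ 2 / 4)) / ‖ξ‖ ^ 2| ≤ 1 := by
      have h2 := Real.add_one_le_exp (-‖ξ‖ ^ 2 / 4)
      have h3 : Real.exp (-‖ξ‖ ^ 2 / 4) ≤ 1 := by
        rw [Real.exp_le_one_iff]; nlinarith [sq_nonneg ‖ξ‖]
      rw [abs_of_nonneg (div_nonneg (by linarith) (sq_nonneg _))]
      refine div_le_one_of_le₀ ?_ (sq_nonneg _)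
      nlinarith [sq_nonneg ‖ξ‖]
    rw [abs_mul]
    exact mul_le_one₀ hp (abs_nonneg _) hq
  have h2 : vG ξ j = 1 / (2 * Real.pi) * ((1 - Real.exp (-‖ξ‖ ^ 2 / 4)) / ‖ξ‖ ^ 2) * perp ξ j := by
    simp [vG]
  rw [h2, abs_mul]
  calc _ ≤ 1 * ‖ξ‖ := mul_le_mul h1 (abs_perp_le ξ j) (abs_nonneg _) zero_le_one
    _ = _ := one_mul _

/-- The total drift `ξ / 2 - α v^G`. -/
def drift (α : ℝ) (j : Fin 2) (ξ : Plane) : ℝ := ξ j / 2 - α * vG ξ j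

theorem contDiff_drift (α : ℝ) (j : Fin 2) : ContDiff ℝ ∞ (drift α j) :=
  ((contDiff_coord j).div_const 2).sub (contDiff_const.mul (contDiff_vG j))

theorem div_drift (α : ℝ) (ξ : Plane) : ∑ j, pd j (drift α j) ξ = 1 := by
  have e : ∀ j, pd j (drift α j) ξ = 1 / 2 + -α * pd j (fun ξ => vG ξ j) ξ := by
    intro j
    have d1 : DifferentiableAt ℝ (fun ξ : Plane => ξ j) ξ := (contDiff_coord j).differentiable (by simp) ξ
    have d2 : DifferentiableAt ℝ (fun ξ : Plane => vG ξ j) ξ := (contDiff_vG j).differentiable (by simp) ξ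
    have d3 : DifferentiableAt ℝ (fun ξ : Plane => (1 / 2 : ℝ) * ξ j) ξ := d1.const_mul _
    have d4 : DifferentiableAt ℝ (fun ξ : Plane => -α * vG ξ j) ξ := d2.const_mul _
    have : drift α j = fun ξ => (1 / 2 : ℝ) * ξ j + -α * vG ξ j := by
      ext ξ; rw [drift]; ring
    rw [this, pd_add j d3 d4, pd_mul j (differentiableAt_const _) d1,
      pd_mul j (differentiableAt_const _) d2, pd_coord]
    simp [pd]
  simp only [e, Finset.sum_add_distrib, ← Finset.mul_sum, div_vG]
  simp

theorem sum_drift_mul (α : ℝ) (ξ : Plane) : ∑ j, drift α j ξ * ξ j = ‖ξ‖ ^ 2 / 2 := by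
  have := sum_vG_mul ξ
  rw [norm_sq_eq]
  simp only [drift, Fin.sum_univ_two] at *
  linear_combination -α * this

/-- The drift grows at most linearly, and `|ξ| ≤ b^m` since `m > 1`. -/
theorem memLp_drift_mul {m α : ℝ} (hm : 1 < m) {w : Plane → ℂ} (hw : w ∈ L2 m) (j : Fin 2) :
    MemLp (fun x => ((drift α j x : ℝ) : ℂ) * w x) 2 := by
  refine MemLp.of_le_mul (c := 1 + |α|) hw.2 ?_ (ae_of_all _ fun ξ => ?_)
  · exact (Complex.continuous_ofReal.comp (contDiff_drift α j).continuous).aestronglyMeasurable.mul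
      hw.1.1
  · have h1 : |ξ j| ≤ ‖ξ‖ := by simpa using PiLp.norm_apply_le ξ j
    have h2 := abs_vG_le ξ j
    have h3 : |drift α j ξ| ≤ (1 + |α|) * ‖ξ‖ := by
      rw [drift]
      refine (abs_sub _ _).trans ?_
      rw [abs_mul, abs_div, abs_two]
      nlinarith [abs_nonneg α, abs_nonneg (ξ j), norm_nonneg ξ]
    have h4 : ‖ξ‖ ≤ b ξ ^ m := by
      have hb : ‖ξ‖ ≤ b ξ := Real.le_sqrt_of_sq_le (by linarith)
      have hb1 : 1 ≤ b ξ := Real.one_le_sqrt.2 (by nlinarith [sq_nonneg ‖ξ‖])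
      calc ‖ξ‖ ≤ b ξ ^ (1 : ℝ) := by simpa using hb
        _ ≤ b ξ ^ m := Real.rpow_le_rpow_of_exponent_le hb1 hm.le
    rw [norm_mul, norm_mul, Complex.norm_real, Complex.norm_real, Real.norm_eq_abs,
      Real.norm_of_nonneg (by have := b_pos ξ; positivity), ← mul_assoc]
    gcongr
    exact h3.trans (by gcongr)

/-! ### The weak formulation of the eigenvalue equation -/

theorem integrable_mul_of_hasCompactSupport {w ψ : Plane → ℂ} (hw : LocallyIntegrable w)
    (hψ : Continuous ψ) (hc : HasCompactSupport ψ) : Integrable (fun x => w x * ψ x) := by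
  have := hw.integrable_smul_left_of_hasCompactSupport hψ hc
  simpa [mul_comm] using this

/-- Puts the equation in divergence form. The product rule on the test function turns `ξ·∇w/2 + w`
into `div(ξ w/2)`, since half the divergence of `ξ` is one in the plane, and turns `v^G·∇w` into
`div(v^G w)`, since `div v^G = 0`. -/
theorem weak_form {m α : ℝ} (hm : 1 < m) {w : Plane → ℂ} (hw : w ∈ L2 m) {z : ℂ}
    (h : DistEq (opL w - (α : ℂ) • opLam w) (ofFun (z • w))) {φ : Plane → ℂ} (hφ : IsTest φ) :
    (∫ x, w x * ∑ j, pd j (pd j φ) x) - ∑ j, ∫ x, ((drift α j x : ℝ) : ℂ) * w x * pd j φ x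
      = ∫ x, (z * w x + (α : ℂ) * velGradG w x) * φ x := by
  have key := h φ hφ
  have lw : LocallyIntegrable w := hw.1.locallyIntegrable (by norm_num)
  have lg : LocallyIntegrable (velGradG w) := (memLp_velGradG hm hw).locallyIntegrable (by norm_num)
  have cφ := hφ.1.continuous
  have cpφ : ∀ j, ContDiff ℝ ∞ (pd j φ) := fun j => contDiff_pd hφ.1 (by simp) j
  have cppφ : ∀ j, Continuous (pd j (pd j φ)) := fun j =>
    (contDiff_pd (k := ∞) (cpφ j) (by simp) j).continuous
  have I1 : ∀ j, Integrable (fun x => w x * pd j (pd j φ) x) := fun j =>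
    integrable_mul_of_hasCompactSupport lw (cppφ j) ((hφ.2.pd j).pd j)
  have I0 : Integrable (fun x => w x * φ x) := integrable_mul_of_hasCompactSupport lw cφ hφ.2
  have Ig : Integrable (fun x => velGradG w x * φ x) :=
    integrable_mul_of_hasCompactSupport lg cφ hφ.2
  have mulT : ∀ (a : Plane → ℝ) (ψ : Plane → ℂ), ContDiff ℝ ∞ a → Continuous ψ →
      HasCompactSupport ψ → Integrable (fun x => w x * (((a x : ℝ) : ℂ) * ψ x)) := by
    intro a ψ ha hψ hc
    exact integrable_mul_of_hasCompactSupport lw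
      ((Complex.continuous_ofReal.comp ha.continuous).mul hψ) hc.mul_left
  have prodrule : ∀ (a : Plane → ℝ), ContDiff ℝ ∞ a → ∀ j x,
      pd j (fun ξ => ((a ξ : ℝ) : ℂ) * φ ξ) x
        = ((a x : ℝ) : ℂ) * pd j φ x + ((pd j a x : ℝ) : ℂ) * φ x := by
    intro a ha j x
    have hC : ContDiff ℝ ∞ (fun x => ((a x : ℝ) : ℂ)) := Complex.ofRealCLM.contDiff.comp ha
    rw [pd_mul j (hC.differentiable (by simp) x) (hφ.1.differentiable (by simp) x),
      pd_ofReal j (ha.differentiable (by simp) x)]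
  have hint : ∀ (a : Plane → ℝ), ContDiff ℝ ∞ a → ∀ j,
      ∫ x, w x * pd j (fun ξ => ((a ξ : ℝ) : ℂ) * φ ξ) x
        = (∫ x, w x * (((a x : ℝ) : ℂ) * pd j φ x)) + ∫ x, w x * (((pd j a x : ℝ) : ℂ) * φ x) := by
    intro a ha j
    rw [← integral_add (mulT a _ ha (cpφ j).continuous (hφ.2.pd j))
      (mulT _ _ (contDiff_pd ha (by simp) j) cφ hφ.2)]
    simp only [prodrule a ha, mul_add]
  have hdv : (∫ x, w x * (((pd 0 (fun ξ => vG ξ 0) x : ℝ) : ℂ) * φ x))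
      + ∫ x, w x * (((pd 1 (fun ξ => vG ξ 1) x : ℝ) : ℂ) * φ x) = 0 := by
    rw [← integral_add (mulT _ _ (contDiff_pd (contDiff_vG 0) (by simp) 0) cφ hφ.2)
      (mulT _ _ (contDiff_pd (contDiff_vG 1) (by simp) 1) cφ hφ.2)]
    have : ∀ x, w x * (((pd 0 (fun ξ => vG ξ 0) x : ℝ) : ℂ) * φ x)
        + w x * (((pd 1 (fun ξ => vG ξ 1) x : ℝ) : ℂ) * φ x) = 0 := by
      intro x
      have h0 := div_vG x
      rw [Fin.sum_univ_two] at h0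
      have h1 : ((pd 0 (fun ξ => vG ξ 0) x : ℝ) : ℂ) + ((pd 1 (fun ξ => vG ξ 1) x : ℝ) : ℂ) = 0 := by
        exact_mod_cast h0
      linear_combination w x * φ x * h1
    simp [this]
  have hcx : ∀ j, ∫ x, w x * (((pd j (fun ξ : Plane => ξ j) x : ℝ) : ℂ) * φ x)
      = ∫ x, w x * φ x := by
    intro j
    simp [pd_coord]
  have hdr : ∀ j, ∫ x, ((drift α j x : ℝ) : ℂ) * w x * pd j φ x
      = (1 / 2 : ℂ) * (∫ x, w x * (((x j : ℝ) : ℂ) * pd j φ x))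
        - (α : ℂ) * ∫ x, w x * (((vG x j : ℝ) : ℂ) * pd j φ x) := by
    intro j
    rw [← integral_const_mul, ← integral_const_mul, ← integral_sub
      ((mulT _ _ (contDiff_coord j) (cpφ j).continuous (hφ.2.pd j)).const_mul _)
      ((mulT _ _ (contDiff_vG j) (cpφ j).continuous (hφ.2.pd j)).const_mul _)]
    congr 1; ext x
    simp only [drift]
    push_cast
    ring
  have hrhs : ∫ x, (z * w x + (α : ℂ) * velGradG w x) * φ x
      = z * (∫ x, w x * φ x) + (α : ℂ) * ∫ x, velGradG w x * φ x := by
    rw [← integral_const_mul, ← integral_const_mul, ← integral_add (I0.const_mul _) (Ig.const_mul _)]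
    congr 1; ext x; ring
  have hlap : (∫ x, w x * ∑ j, pd j (pd j φ) x)
      = (∫ x, w x * pd 0 (pd 0 φ) x) + ∫ x, w x * pd 1 (pd 1 φ) x := by
    rw [← integral_add (I1 0) (I1 1)]
    simp only [Fin.sum_univ_two, mul_add]
  have hz : ∫ x, z * w x * φ x = z * ∫ x, w x * φ x := by
    rw [← integral_const_mul]
    simp [mul_assoc]
  simp only [opL, opLam, principalPart, Pi.add_apply, Pi.sub_apply, Pi.smul_apply,
    Fin.sum_univ_two, dd, mulFun, ofFun, smul_eq_mul, neg_neg] at key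
  rw [hint _ (contDiff_coord 0), hint _ (contDiff_coord 1), hint _ (contDiff_vG 0),
    hint _ (contDiff_vG 1), hcx, hcx] at key
  have hg : ∫ x, (biotSavart w 0 x * ((pd 0 G x : ℝ) : ℂ) + biotSavart w 1 x * ((pd 1 G x : ℝ) : ℂ))
      * φ x = ∫ x, velGradG w x * φ x := by
    simp only [velGradG, Fin.sum_univ_two]
  rw [hg] at key
  rw [hlap, Fin.sum_univ_two, hdr, hdr, hrhs]
  rw [hz] at key
  linear_combination key - (α : ℂ) * hdv

end OseenVortex
end

open MeasureTheory
open scoped ContDiff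
noncomputable section
namespace OseenVortex
open Filter Topology Set
open scoped ENNReal Convolution ComplexConjugate

/-! ### The energy inequality with radial weights -/

/-- For a radial cutoff only the radial component of the drift matters. Since `v^G·ξ = 0`, that
component does not involve `α`, which survives only in front of `v·∇G`. -/
theorem exists_approx_energy_radial {m α : ℝ} (hm : 1 < m) {w : Plane → ℂ} (hw : w ∈ L2 m) {z : ℂ}
    (h : DistEq (opL w - (α : ℂ) • opLam w) (ofFun (z • w))) {S S' : ℝ → ℝ}
    (hS : ∀ t, 0 ≤ t → HasDerivAt S (S' t) t)
    (hs : ContDiff ℝ 1 (fun x : Plane => S (‖x‖ ^ 2)))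
    (hc : HasCompactSupport (fun x : Plane => S (‖x‖ ^ 2))) :
    ∃ f : ℕ → Plane → ℂ, (∀ n, ContDiff ℝ ∞ (f n)) ∧ (∀ n, MemLp (f n) 2) ∧
      Tendsto (fun n => eLpNorm (fun x => f n x - w x) 2 volume) atTop (𝓝 0) ∧
      ∀ ε > 0, ∀ᶠ n in atTop,
        ∫ x, ∑ j, ‖pd j (fun y => ((S (‖y‖ ^ 2) : ℝ) : ℂ) * f n y) x‖ ^ 2 ≤
        (∫ x, ((4 * ‖x‖ ^ 2 * S' (‖x‖ ^ 2) ^ 2 - ‖x‖ ^ 2 * S (‖x‖ ^ 2) * S' (‖x‖ ^ 2)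
          + S (‖x‖ ^ 2) ^ 2 / 2 - z.re * S (‖x‖ ^ 2) ^ 2) * ‖w x‖ ^ 2
          - α * (S (‖x‖ ^ 2) ^ 2 * (conj (w x) * velGradG w x).re))) + ε := by
  have hh : MemLp (fun x => z * w x + (α : ℂ) * velGradG w x) 2 :=
    (hw.1.const_mul z).add ((memLp_velGradG hm hw).const_mul (α : ℂ))
  obtain ⟨f, h1, h2, h3, h4⟩ := exists_approx_energy hw.1 (memLp_drift_mul (α := α) hm hw) hh
    (fun φ hφ => weak_form hm hw h hφ) hs hc
    (fun j => (contDiff_drift α j).of_le (by exact_mod_cast le_top)) (div_drift α)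
  refine ⟨f, h1, h2, h3, fun ε hε => ?_⟩
  filter_upwards [h4 ε hε] with n hn
  refine hn.trans (le_of_eq ?_)
  congr 2
  ext x
  have hp : ∀ j, pd j (fun x : Plane => S (‖x‖ ^ 2)) x = 2 * x j * S' (‖x‖ ^ 2) := fun j =>
    pd_radial (hS _ (sq_nonneg _)) j
  have hd := sum_drift_mul α x
  have e1 : ∑ j, pd j (fun x : Plane => S (‖x‖ ^ 2)) x ^ 2 = 4 * ‖x‖ ^ 2 * S' (‖x‖ ^ 2) ^ 2 := by
    simp only [hp, Fin.sum_univ_two]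
    rw [norm_sq_eq]; ring
  have e2 : ∑ j, drift α j x * pd j (fun x : Plane => S (‖x‖ ^ 2)) x
      = ‖x‖ ^ 2 * S' (‖x‖ ^ 2) := by
    have : ∑ j, drift α j x * pd j (fun x : Plane => S (‖x‖ ^ 2)) x
        = 2 * S' (‖x‖ ^ 2) * ∑ j, drift α j x * x j := by
      simp only [hp, Fin.sum_univ_two]; ring
    rw [this, hd]; ring
  have e3 : (conj (w x) * (z * w x + (α : ℂ) * velGradG w x)).re
      = z.re * ‖w x‖ ^ 2 + α * (conj (w x) * velGradG w x).re := by
    rw [Complex.sq_norm, Complex.normSq_apply]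
    simp
    ring
  rw [e1, e2, e3]
  ring

theorem integrable_energy_radial {S S' : ℝ → ℝ} (hS : ∀ t, 0 ≤ t → HasDerivAt S (S' t) t)
    (hs : ContDiff ℝ 1 (fun x : Plane => S (‖x‖ ^ 2)))
    (hc : HasCompactSupport (fun x : Plane => S (‖x‖ ^ 2))) {w g : Plane → ℂ} (hw : MemLp w 2)
    (hg : MemLp g 2) (r α : ℝ) :
    Integrable (fun x => (4 * ‖x‖ ^ 2 * S' (‖x‖ ^ 2) ^ 2 - ‖x‖ ^ 2 * S (‖x‖ ^ 2) * S' (‖x‖ ^ 2)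
          + S (‖x‖ ^ 2) ^ 2 / 2 - r * S (‖x‖ ^ 2) ^ 2) * ‖w x‖ ^ 2
          - α * (S (‖x‖ ^ 2) ^ 2 * (conj (w x) * g x).re)) := by
  set s : Plane → ℝ := fun x => S (‖x‖ ^ 2) with hsd
  have bdd : ∀ c : Plane → ℝ, Continuous c → (∀ x, x ∉ tsupport s → c x = 0) →
      ∃ C, ∀ x, |c x| ≤ C := fun c hcc hz =>
    hcc.bounded_above_of_compact_support (HasCompactSupport.intro hc hz)
  have zs : ∀ x, x ∉ tsupport s → s x = 0 := fun x hx => image_eq_zero_of_notMem_tsupport hx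
  have zps : ∀ j x, x ∉ tsupport s → pd j s x = 0 := fun j x hx =>
    image_eq_zero_of_notMem_tsupport fun h => hx (tsupport_fderiv_apply_subset ℝ _ h)
  have cps := fun j => continuous_pd hs j
  have cs := hs.continuous
  have hp : ∀ j x, pd j s x = 2 * x j * S' (‖x‖ ^ 2) := fun j x =>
    pd_radial (hS _ (sq_nonneg _)) j
  set c : Plane → ℝ := fun x => (∑ j, pd j s x ^ 2) - s x / 2 * (∑ j, x j * pd j s x)
    + s x ^ 2 / 2 - r * s x ^ 2 with hcd
  have cc : Continuous c := by rw [hcd]; fun_prop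
  obtain ⟨C1, hC1⟩ := bdd c cc fun x hx => by simp [hcd, zs x hx, zps _ x hx]
  obtain ⟨C2, hC2⟩ := bdd (fun x => s x ^ 2) (by fun_prop) fun x hx => by simp [zs x hx]
  refine ((integrable_weighted cc.aestronglyMeasurable hC1 hw hw).sub
    ((integrable_weighted (cs.pow 2).aestronglyMeasurable hC2 hw hg).const_mul α)).congr
    (ae_of_all _ fun x => ?_)
  have : c x = 4 * ‖x‖ ^ 2 * S' (‖x‖ ^ 2) ^ 2 - ‖x‖ ^ 2 * S (‖x‖ ^ 2) * S' (‖x‖ ^ 2)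
      + S (‖x‖ ^ 2) ^ 2 / 2 - r * S (‖x‖ ^ 2) ^ 2 := by
    have hn := norm_sq_eq x
    simp only [hcd, hp, Fin.sum_univ_two]
    simp only [hsd]
    linear_combination (4 * S' (‖x‖ ^ 2) ^ 2 - S (‖x‖ ^ 2) * S' (‖x‖ ^ 2)) * (-hn)
  simp only [Pi.sub_apply]
  rw [← this, Complex.sq_norm, Complex.normSq_apply]
  simp [hsd]

/-! ### Radial cutoffs in the variable `t = |x|²`. -/

/-- The radial cutoff, as a function of `t = |x|²`. -/
def chi (R t : ℝ) : ℝ := Real.smoothTransition (2 - t / R)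

/-- The derivative of the radial cutoff. -/
def chiD (R t : ℝ) : ℝ := -(1 / R) * deriv Real.smoothTransition (2 - t / R)

theorem hasDerivAt_chi (R t : ℝ) : HasDerivAt (chi R) (chiD R t) t := by
  have h1 : HasDerivAt (fun t : ℝ => 2 - t / R) (-(1 / R)) t := by
    simpa using ((hasDerivAt_id t).div_const R).const_sub 2
  have h2 : HasDerivAt Real.smoothTransition (deriv Real.smoothTransition (2 - t / R)) (2 - t / R) :=
    ((Real.smoothTransition.contDiff (n := 1)).differentiable (by simp) _).hasDerivAt
  have := h2.comp t h1
  rw [mul_comm] at this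
  exact this

theorem contDiff_chi (R : ℝ) : ContDiff ℝ ∞ (chi R) :=
  Real.smoothTransition.contDiff.comp (contDiff_const.sub (contDiff_id.div_const R))

theorem chi_nonneg (R t : ℝ) : 0 ≤ chi R t := Real.smoothTransition.nonneg _

theorem chi_le_one (R t : ℝ) : chi R t ≤ 1 := Real.smoothTransition.le_one _

theorem chi_eq_one {R t : ℝ} (hR : 0 < R) (h : t ≤ R) : chi R t = 1 := by
  apply Real.smoothTransition.one_of_one_le
  have := (div_le_one hR).2 h
  linarith

theorem chi_eq_zero {R t : ℝ} (hR : 0 < R) (h : 2 * R ≤ t) : chi R t = 0 := by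
  apply Real.smoothTransition.zero_of_nonpos
  have := (le_div_iff₀ hR).2 h
  linarith

theorem chiD_eq_zero_of_lt {R t : ℝ} (hR : 0 < R) (h : t < R) : chiD R t = 0 := by
  have h1 : chi R =ᶠ[𝓝 t] fun _ => 1 := by
    filter_upwards [gt_mem_nhds h] with s hs
    exact chi_eq_one hR hs.le
  exact (hasDerivAt_chi R t).unique ((hasDerivAt_const t (1 : ℝ)).congr_of_eventuallyEq h1)

theorem chiD_eq_zero_of_gt {R t : ℝ} (hR : 0 < R) (h : 2 * R < t) : chiD R t = 0 := by
  have h1 : chi R =ᶠ[𝓝 t] fun _ => 0 := by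
    filter_upwards [lt_mem_nhds h] with s hs
    exact chi_eq_zero hR hs.le
  exact (hasDerivAt_chi R t).unique ((hasDerivAt_const t (0 : ℝ)).congr_of_eventuallyEq h1)

/-- The derivative has size `1/R` and vanishes beyond `t = 2R`, so `t |χ'|` stays bounded. The
second bound multiplies this by `|χ'| ≤ L`, valid for `R ≥ 1`. -/
theorem exists_chiD_bound : ∃ M, 0 ≤ M ∧ ∀ R t : ℝ, 1 ≤ R → 0 ≤ t →
    t * |chiD R t| ≤ M ∧ t * chiD R t ^ 2 ≤ M := by
  have hc : Continuous (deriv Real.smoothTransition) :=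
    (Real.smoothTransition.contDiff (n := 1)).continuous_deriv (by simp)
  obtain ⟨L, hL⟩ := (isCompact_Icc (a := (0 : ℝ)) (b := 2)).exists_bound_of_continuousOn
    hc.continuousOn
  have hL0 : 0 ≤ L := (norm_nonneg _).trans (hL 0 (by simp))
  refine ⟨2 * L + 2 * L ^ 2, by positivity, fun R t hR ht => ?_⟩
  have hR0 : 0 < R := by linarith
  by_cases h2 : 2 * R < t
  · rw [chiD_eq_zero_of_gt hR0 h2]
    simp
    positivity
  · push Not at h2
    have h3 : t / R ≤ 2 := by rw [div_le_iff₀ hR0]; exact h2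
    have h4 : 0 ≤ t / R := by positivity
    have h5 := hL (2 - t / R) ⟨by linarith, by linarith⟩
    rw [Real.norm_eq_abs] at h5
    have h6 : |chiD R t| = 1 / R * |deriv Real.smoothTransition (2 - t / R)| := by
      rw [chiD, abs_mul, abs_neg, abs_of_pos (by positivity)]
    have h7 : t * |chiD R t| ≤ 2 * L := by
      rw [h6, ← mul_assoc, mul_one_div]
      exact mul_le_mul h3 h5 (abs_nonneg _) (by norm_num)
    have h8 : |chiD R t| ≤ L := by
      rw [h6]
      have : 1 / R ≤ 1 := by rw [div_le_one hR0]; exact hR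
      calc _ ≤ 1 * L := mul_le_mul this h5 (abs_nonneg _) zero_le_one
        _ = L := one_mul L
    refine ⟨by nlinarith, ?_⟩
    rw [← sq_abs, sq, ← mul_assoc]
    have := mul_le_mul h7 h8 (abs_nonneg _) (by positivity)
    nlinarith

theorem hasCompactSupport_chi_mul {R : ℝ} (hR : 0 < R) (P : ℝ → ℝ) :
    HasCompactSupport (fun x : Plane => chi R (‖x‖ ^ 2) * P (‖x‖ ^ 2)) := by
  refine HasCompactSupport.intro (isCompact_closedBall (0 : Plane) (Real.sqrt (2 * R)))
    fun x hx => ?_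
  have h1 : Real.sqrt (2 * R) < ‖x‖ := by simpa using hx
  have h2 : 2 * R ≤ ‖x‖ ^ 2 := by
    have := Real.lt_sq_of_sqrt_lt h1
    exact this.le
  rw [chi_eq_zero hR h2, zero_mul]

end OseenVortex
end

open MeasureTheory
open scoped ContDiff
noncomputable section
namespace OseenVortex
open Filter Topology Set
open scoped ENNReal Convolution ComplexConjugate

/-! ### Gaussian decay of eigenfunctions -/

/-- The regularized weight `((1 + t)^m / (ε + e^{-t/4}))^{1/2}`. -/
def wt (m ε t : ℝ) : ℝ :=
  Real.exp (1 / 2 * (m * Real.log (1 + t) - Real.log (ε + Real.exp (-(1 / 4) * t))))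

/-- Twice the logarithmic derivative of `wt`. -/
def wtLog (m ε t : ℝ) : ℝ :=
  m / (1 + t) + Real.exp (-(1 / 4) * t) / (ε + Real.exp (-(1 / 4) * t)) / 4

theorem hasDerivAt_wt (m : ℝ) {ε t : ℝ} (hε : 0 < ε) (ht : 0 ≤ t) :
    HasDerivAt (wt m ε) (wt m ε t * (1 / 2 * wtLog m ε t)) t := by
  have h1 : HasDerivAt (fun t : ℝ => Real.log (1 + t)) (1 / (1 + t)) t :=
    ((hasDerivAt_id t).const_add 1).log (by simp; linarith)
  have h2 : HasDerivAt (fun t : ℝ => ε + Real.exp (-(1 / 4) * t))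
      (-(1 / 4) * Real.exp (-(1 / 4) * t)) t :=
    (hasDerivAt_exp_neg_mul (1 / 4) t).const_add ε
  have h3 := h2.log (by positivity)
  convert! (((h1.const_mul m).sub h3).const_mul (1 / 2)).exp using 1
  rw [wt, wtLog]
  congr 2
  field_simp
  ring

theorem wt_sq (m : ℝ) {ε t : ℝ} (hε : 0 < ε) (ht : 0 ≤ t) :
    wt m ε t ^ 2 = (1 + t) ^ m / (ε + Real.exp (-(1 / 4) * t)) := by
  rw [wt, ← Real.exp_nat_mul, Real.rpow_def_of_pos (by linarith)]
  push_cast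
  rw [← mul_assoc, show (2 : ℝ) * (1 / 2) = 1 by norm_num, one_mul, Real.exp_sub,
    Real.exp_log (by positivity), mul_comm m]

theorem wt_sq_le_div {m ε t : ℝ} (hε : 0 < ε) (ht : 0 ≤ t) :
    wt m ε t ^ 2 ≤ (1 + t) ^ m / ε := by
  rw [wt_sq m hε ht]
  gcongr
  linarith [Real.exp_pos (-(1 / 4) * t)]

theorem wt_sq_le {m ε t : ℝ} (hε : 0 < ε) (ht : 0 ≤ t) :
    wt m ε t ^ 2 ≤ (1 + t) ^ m * Real.exp (t / 4) := by
  rw [wt_sq m hε ht, show t / 4 = -(-(1 / 4) * t) by ring, Real.exp_neg, ← div_eq_mul_inv]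
  gcongr
  linarith

theorem le_wt_sq {m ε t : ℝ} (hm : 0 ≤ m) (hε : 0 < ε) (ht : 0 ≤ t)
    (h : ε ≤ Real.exp (-(1 / 4) * t)) : Real.exp (t / 4) / 2 ≤ wt m ε t ^ 2 := by
  rw [wt_sq m hε ht, show t / 4 = -(-(1 / 4) * t) by ring, Real.exp_neg]
  have h1 : 1 ≤ (1 + t) ^ m := Real.one_le_rpow (by linarith) hm
  have h2 := Real.exp_pos (-(1 / 4) * t)
  rw [le_div_iff₀ (by positivity)]
  refine le_trans ?_ h1
  calc _ ≤ (Real.exp (-(1 / 4) * t))⁻¹ / 2 * (Real.exp (-(1 / 4) * t) + Real.exp (-(1 / 4) * t)) := by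
        gcongr
    _ = 1 := by field_simp; norm_num

theorem contDiff_wt_norm_sq (m : ℝ) {ε : ℝ} (hε : 0 < ε) :
    ContDiff ℝ 1 (fun x : Plane => wt m ε (‖x‖ ^ 2)) := by
  have h0 : ContDiff ℝ 1 (fun x : Plane => ‖x‖ ^ 2) := contDiff_norm_sq ℝ
  have h1 : ContDiff ℝ 1 (fun x : Plane => Real.log (1 + ‖x‖ ^ 2)) :=
    (contDiff_const.add h0).log fun x => by positivity
  have h2 : ContDiff ℝ 1 (fun x : Plane => Real.log (ε + Real.exp (-(1 / 4) * ‖x‖ ^ 2))) :=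
    (contDiff_const.add (contDiff_const.mul h0).exp).log fun x => by positivity
  exact (contDiff_const.mul ((contDiff_const.mul h1).sub h2)).exp

theorem wtLog_nonneg {m ε t : ℝ} (hm : 0 ≤ m) (hε : 0 < ε) (ht : 0 ≤ t) : 0 ≤ wtLog m ε t := by
  unfold wtLog; positivity

theorem exp_div_add_le_one {ε : ℝ} (hε : 0 < ε) (y : ℝ) :
    Real.exp y / (ε + Real.exp y) ≤ 1 := by
  rw [div_le_one (by positivity)]; linarith

theorem wtLog_le {m ε t : ℝ} (hm : 0 ≤ m) (hε : 0 < ε) (ht : 0 ≤ t) :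
    wtLog m ε t ≤ m + 1 / 4 := by
  have h1 := exp_div_add_le_one hε (-(1 / 4) * t)
  have h2 : m / (1 + t) ≤ m := div_le_self hm (by linarith)
  unfold wtLog
  linarith

/-- This is the zeroth-order coefficient for the weight `wt`, whose logarithmic derivative is half
of `μ + θ/4` with `μ = m/(1+t)` and `θ ∈ [0,1]`. Since `t μ = m - μ`, the part without `θ` equals
`-2κ + μ(m + 1/2) - μ²`, and the second threshold on `t` makes `μ(m + 1/2) ≤ κ`. The terms with `θ`
are nonpositive as soon as `μ ≤ 1/8`, which is the first threshold. -/
theorem wtLog_quadratic_le {m κ r ε t : ℝ} (hm : 1 < m) (hκ : 0 < κ) (hr : r - (1 - m) / 2 = 2 * κ)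
    (hε : 0 < ε) (ht : 0 ≤ t) (h1 : 8 * m ≤ t) (h2 : m * (1 / 2 + m) / κ ≤ t) :
    t * wtLog m ε t ^ 2 - t * wtLog m ε t / 2 + 1 / 2 - r ≤ -κ := by
  have hθ1 := exp_div_add_le_one hε (-(1 / 4) * t)
  have hθ0 : 0 ≤ Real.exp (-(1 / 4) * t) / (ε + Real.exp (-(1 / 4) * t)) := by positivity
  unfold wtLog
  generalize Real.exp (-(1 / 4) * t) / (ε + Real.exp (-(1 / 4) * t)) = θ at *
  set μ := m / (1 + t) with hμ
  have hμt : μ + t * μ = m := by rw [hμ]; field_simp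
  have hμ0 : 0 ≤ μ := by positivity
  have hμ8 : μ ≤ 1 / 8 := by rw [hμ, div_le_iff₀ (by linarith)]; linarith
  have hμκ : μ * (1 / 2 + m) ≤ κ := by
    rw [div_le_iff₀ hκ] at h2
    rw [hμ, div_mul_eq_mul_div, div_le_iff₀ (by linarith)]
    nlinarith
  have h3 : 0 ≤ t * (θ / 4 * (1 / 2 - 2 * μ - θ / 4)) := by
    have : 0 ≤ 1 / 2 - 2 * μ - θ / 4 := by linarith
    positivity
  have h4 : t * (μ + θ / 4) ^ 2 - t * (μ + θ / 4) / 2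
      = t * μ * (μ - 1 / 2) - t * (θ / 4 * (1 / 2 - 2 * μ - θ / 4)) := by ring
  have h5 : t * μ = m - μ := by linarith
  rw [h4, h5]
  nlinarith

theorem exists_rpow_le_exp {m : ℝ} (hm : 0 < m) :
    ∃ C, 0 ≤ C ∧ ∀ t, 0 ≤ t → (1 + t) ^ m ≤ C * Real.exp (t / 8) := by
  refine ⟨(8 * m) ^ m * Real.exp (1 / 8), by positivity, fun t ht => ?_⟩
  have h1 : (1 + t) / (8 * m) ≤ Real.exp ((1 + t) / (8 * m)) := by
    linarith [Real.add_one_le_exp ((1 + t) / (8 * m))]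
  have h2 := Real.rpow_le_rpow (by positivity) h1 hm.le
  rw [Real.div_rpow (by positivity) (by positivity), div_le_iff₀ (by positivity),
    ← Real.exp_mul] at h2
  rw [mul_assoc, ← Real.exp_add]
  refine h2.trans (le_of_eq ?_)
  rw [mul_comm]
  congr 2
  field_simp

/-- The constants `D` and `K` are independent of `ε` and `R`. The bad factor `1/ε` appears only in
the region `t ≥ R`, where the cutoff may vary. Hence `R → ∞` can be taken first, for fixed `ε`, and
the resulting bound is uniform in `ε`. -/
theorem exists_cutoff_weight_le {m κ r : ℝ} (hm : 1 < m) (hκ : 0 < κ)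
    (hr : r - (1 - m) / 2 = 2 * κ) :
    ∃ D K : ℝ, 0 ≤ K ∧ ∀ ε R t : ℝ, 0 < ε → 1 ≤ R → 0 ≤ t →
      ∀ S S' : ℝ, S = chi R t * wt m ε t →
        S' = chiD R t * wt m ε t + chi R t * (wt m ε t * (1 / 2 * wtLog m ε t)) →
      4 * t * S' ^ 2 - t * S * S' + S ^ 2 / 2 - r * S ^ 2
        ≤ -κ * S ^ 2 + D + K / ε * (if R ≤ t then (1 + t) ^ m else 0) := by
  obtain ⟨M, hM0, hM⟩ := exists_chiD_bound
  have hm0 : 0 ≤ m := by linarith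
  set t0 := max (8 * m) (m * (1 / 2 + m) / κ) with ht0
  have ht00 : 0 ≤ t0 := le_max_of_le_left (by linarith)
  set C0 := t0 * (m + 1 / 4) ^ 2 + 1 / 2 + |r| with hC0
  have hC00 : 0 ≤ C0 := by positivity
  refine ⟨(C0 + κ) * ((1 + t0) ^ m * Real.exp (t0 / 4)), 5 * M + 4 * (M * (m + 1 / 4)),
    by positivity, fun ε R t hε hR ht S S' hS hS' => ?_⟩
  have hR0 : 0 < R := by linarith
  obtain ⟨b1, b2⟩ := hM R t hR ht
  have c0 := chi_nonneg R t
  have c1 := chi_le_one R t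
  have p0 := wtLog_nonneg (t := t) hm0 hε ht
  have p1 := wtLog_le (t := t) hm0 hε ht
  set P := wt m ε t
  set c := chi R t
  set d := chiD R t with hd
  set ψ := wtLog m ε t with hψ
  -- The first summand is the coefficient of the uncut weight; the second collects everything
  -- containing the derivative `d` of the cutoff.
  have e : 4 * t * S' ^ 2 - t * S * S' + S ^ 2 / 2 - r * S ^ 2
      = (c ^ 2 * P ^ 2) * (t * ψ ^ 2 - t * ψ / 2 + 1 / 2 - r)
        + P ^ 2 * (4 * (t * d ^ 2) + 4 * (c * ((t * d) * ψ)) - c * (t * d)) := by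
    rw [hS, hS']; ring
  have hSS : S ^ 2 = c ^ 2 * P ^ 2 := by rw [hS]; ring
  have hP0 : 0 ≤ P ^ 2 := sq_nonneg _
  have hc2 : c ^ 2 ≤ 1 := by nlinarith
  -- terms with a derivative of the cutoff
  have t1 : P ^ 2 * (4 * (t * d ^ 2) + 4 * (c * ((t * d) * ψ)) - c * (t * d))
      ≤ (5 * M + 4 * (M * (m + 1 / 4))) / ε * (if R ≤ t then (1 + t) ^ m else 0) := by
    split_ifs with h
    · have td : |t * d| ≤ M := by rw [abs_mul, abs_of_nonneg ht]; exact b1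
      have q1 : |c * ((t * d) * ψ)| ≤ M * (m + 1 / 4) := by
        rw [abs_mul, abs_mul, abs_of_nonneg c0, abs_of_nonneg p0]
        calc c * (|t * d| * ψ) ≤ 1 * (M * (m + 1 / 4)) := by gcongr
          _ = _ := one_mul _
      have q2 : |c * (t * d)| ≤ M := by
        rw [abs_mul, abs_of_nonneg c0]
        calc c * |t * d| ≤ 1 * M := by gcongr
          _ = _ := one_mul _
      have q3 : 4 * (t * d ^ 2) + 4 * (c * ((t * d) * ψ)) - c * (t * d)
          ≤ 5 * M + 4 * (M * (m + 1 / 4)) := by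
        linarith [le_abs_self (c * ((t * d) * ψ)), neg_abs_le (c * (t * d))]
      calc _ ≤ P ^ 2 * (5 * M + 4 * (M * (m + 1 / 4))) := by gcongr
        _ ≤ (1 + t) ^ m / ε * (5 * M + 4 * (M * (m + 1 / 4))) := by
            gcongr; exact wt_sq_le_div hε ht
        _ = _ := by ring
    · have : d = 0 := chiD_eq_zero_of_lt hR0 (not_le.1 h)
      rw [this]; simp
  have t2 : (c ^ 2 * P ^ 2) * (t * ψ ^ 2 - t * ψ / 2 + 1 / 2 - r)
      ≤ -κ * (c ^ 2 * P ^ 2) + (C0 + κ) * ((1 + t0) ^ m * Real.exp (t0 / 4)) := by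
    have hcP : 0 ≤ c ^ 2 * P ^ 2 := by positivity
    by_cases h : t0 ≤ t
    · have := wtLog_quadratic_le hm hκ hr hε ht ((le_max_left _ _).trans h)
        ((le_max_right _ _).trans h)
      have h3 := mul_le_mul_of_nonneg_left this hcP
      have : 0 ≤ (C0 + κ) * ((1 + t0) ^ m * Real.exp (t0 / 4)) := by positivity
      linarith
    · push Not at h
      have q1 : t * ψ ^ 2 - t * ψ / 2 + 1 / 2 - r ≤ C0 := by
        have : t * ψ ^ 2 ≤ t0 * (m + 1 / 4) ^ 2 := by gcongr
        have : 0 ≤ t * ψ := by positivity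
        rw [hC0]
        linarith [neg_abs_le r]
      have q2 : c ^ 2 * P ^ 2 ≤ (1 + t0) ^ m * Real.exp (t0 / 4) :=
        calc c ^ 2 * P ^ 2 ≤ 1 * P ^ 2 := by gcongr
          _ ≤ (1 + t) ^ m * Real.exp (t / 4) := by rw [one_mul]; exact wt_sq_le hε ht
          _ ≤ _ := by gcongr
      have q3 := mul_le_mul_of_nonneg_left q1 hcP
      have q4 := mul_le_mul_of_nonneg_left q2 (by positivity : 0 ≤ C0 + κ)
      linarith
  rw [e, hSS]
  linarith

theorem integrable_rpow_mul_norm_sq {m : ℝ} {w : Plane → ℂ} (hw : w ∈ L2 m) :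
    Integrable (fun x : Plane => (1 + ‖x‖ ^ 2) ^ m * ‖w x‖ ^ 2) := by
  refine ((memLp_two_iff_integrable_sq_norm hw.2.1).1 hw.2).congr (ae_of_all _ fun x => ?_)
  simp only [norm_mul, Complex.norm_real, mul_pow, Real.norm_eq_abs, sq_abs, b_rpow_sq]

/-- The integrals over the balls `|x|² ≤ n` are bounded independently of `n` by the energy
inequality with weight `wt`, letting the cutoff radius tend to infinity while `ε` is tied to `n`.
Monotone exhaustion then gives integrability. -/
theorem integrable_exp_mul_norm_sq_of_lt {m α : ℝ} (hm : 1 < m) {w : Plane → ℂ} (hw : w ∈ L2 m)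
    {z : ℂ} (h : DistEq (opL w - (α : ℂ) • opLam w) (ofFun (z • w))) (hz : (1 - m) / 2 < z.re) :
    Integrable (fun x : Plane => Real.exp (‖x‖ ^ 2 / 4) * ‖w x‖ ^ 2) := by
  have hm0 : 0 ≤ m := by linarith
  -- Half of the spectral margin: one `κ` absorbs the error terms of the weight, and the other
  -- remains as coercivity.
  set κ := (z.re - (1 - m) / 2) / 2 with hκd
  have hκ : 0 < κ := by rw [hκd]; linarith
  have hr : z.re - (1 - m) / 2 = 2 * κ := by rw [hκd]; ring
  obtain ⟨D, K, hK0, hDK⟩ := exists_cutoff_weight_le hm hκ hr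
  obtain ⟨C, hC0, hC⟩ := exists_rpow_le_exp (m := m) (by linarith)
  have Iw : Integrable (fun x => ‖w x‖ ^ 2) := (memLp_two_iff_integrable_sq_norm hw.1.1).1 hw.1
  have Im := integrable_rpow_mul_norm_sq hw
  have Ig := integrable_velGradG_sq hm hw
  have hgm := memLp_velGradG hm hw
  set A := D * (∫ x, ‖w x‖ ^ 2)
    + α ^ 2 / (2 * κ) * C * ∫ x, ‖velGradG w x‖ ^ 2 * Real.exp (3 / 8 * ‖x‖ ^ 2) with hA
  set B : ℕ → Set Plane := fun n => {x | ‖x‖ ^ 2 ≤ n} with hB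
  have mB : ∀ n, MeasurableSet (B n) := fun n =>
    (isClosed_le (by fun_prop) continuous_const).measurableSet
  have hcov : AECover volume atTop B := by
    refine ⟨ae_of_all _ fun x => ?_, mB⟩
    obtain ⟨N, hN⟩ := exists_nat_ge (‖x‖ ^ 2)
    filter_upwards [eventually_ge_atTop N] with n hn
    exact hN.trans (by exact_mod_cast hn)
  have IB : ∀ n, IntegrableOn (fun x : Plane => Real.exp (‖x‖ ^ 2 / 4) * ‖w x‖ ^ 2) (B n) := by
    intro n
    refine ((Iw.const_mul (Real.exp (n / 4))).integrableOn (s := B n)).mono' ?_ ?_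
    · exact ((by fun_prop : Continuous fun x : Plane => Real.exp (‖x‖ ^ 2 / 4)).aestronglyMeasurable.mul
        Iw.aestronglyMeasurable).restrict
    · filter_upwards [ae_restrict_mem (mB n)] with x hx
      rw [Real.norm_of_nonneg (by positivity)]
      have : ‖x‖ ^ 2 ≤ n := hx
      gcongr
  refine hcov.integrable_of_integral_bounded_of_nonneg_ae (4 / κ * A) IB
    (ae_of_all _ fun x => by positivity) (Eventually.of_forall fun n => ?_)
  -- The largest `ε` for which `ε ≤ e^{-t/4}` on the whole ball `t ≤ n`, so that the squared weight
  -- is at least `e^{t/4}/2` there.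
  set ε := Real.exp (-(1 / 4) * n) with hεd
  have hε : 0 < ε := Real.exp_pos _
  set T : ℕ → Plane → ℝ := fun N x =>
    (if (N : ℝ) ≤ ‖x‖ ^ 2 then (1 + ‖x‖ ^ 2) ^ m else 0) * ‖w x‖ ^ 2 with hT
  have Tm : ∀ N, AEStronglyMeasurable (T N) volume := fun N => by
    have : Measurable (fun x : Plane => if (N : ℝ) ≤ ‖x‖ ^ 2 then (1 + ‖x‖ ^ 2) ^ m else 0) :=
      Measurable.ite (measurableSet_le measurable_const (by fun_prop)) (by fun_prop) measurable_const
    exact this.aestronglyMeasurable.mul Iw.aestronglyMeasurable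
  have Tb : ∀ N, ∀ᵐ x, ‖T N x‖ ≤ (1 + ‖x‖ ^ 2) ^ m * ‖w x‖ ^ 2 := fun N => ae_of_all _ fun x => by
    simp only [hT]
    split_ifs
    · rw [Real.norm_of_nonneg (by positivity)]
    · simp; positivity
  have IT : ∀ N, Integrable (T N) := fun N => Im.mono' (Tm N) (Tb N)
  -- Membership in `L²(m)` enters here: it makes the tails of `(1 + |x|²)^m |w|²` vanish, which
  -- compensates the fixed factor `K / ε`.
  have hTlim : Tendsto (fun N => ∫ x, T N x) atTop (𝓝 0) := by
    have := tendsto_integral_of_dominated_convergence (f := fun _ => (0 : ℝ)) _ Tm Im Tb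
      (ae_of_all _ fun x => by
        obtain ⟨N, hN⟩ := exists_nat_gt (‖x‖ ^ 2)
        refine tendsto_const_nhds.congr' ?_
        filter_upwards [eventually_ge_atTop N] with k hk
        have : ¬ ((k : ℝ) ≤ ‖x‖ ^ 2) := by
          push Not
          exact hN.trans_le (by exact_mod_cast hk)
        simp [hT, this])
    simpa using this
  have hlim : Tendsto (fun N => 4 / κ * (A + K / ε * ∫ x, T N x)) atTop (𝓝 (4 / κ * A)) := by
    have := ((hTlim.const_mul (K / ε)).const_add A).const_mul (4 / κ)
    simpa using this
  refine ge_of_tendsto hlim ?_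
  filter_upwards [eventually_ge_atTop (max n 1)] with N hN
  have hNn : (n : ℝ) ≤ N := by exact_mod_cast (le_max_left _ _).trans hN
  have hN1 : (1 : ℝ) ≤ N := by exact_mod_cast (le_max_right _ _).trans hN
  have hN0 : (0 : ℝ) < N := by linarith
  set S : ℝ → ℝ := fun t => chi N t * wt m ε t with hS
  set S' : ℝ → ℝ := fun t => chiD N t * wt m ε t
    + chi N t * (wt m ε t * (1 / 2 * wtLog m ε t)) with hS'
  have dS : ∀ t, 0 ≤ t → HasDerivAt S (S' t) t := fun t ht =>
    (hasDerivAt_chi N t).mul (hasDerivAt_wt m hε ht)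
  have cs : ContDiff ℝ 1 (fun x : Plane => S (‖x‖ ^ 2)) :=
    (((contDiff_chi N).of_le (by exact_mod_cast le_top)).comp (contDiff_norm_sq ℝ)).mul
      (contDiff_wt_norm_sq m hε)
  have hcs : HasCompactSupport (fun x : Plane => S (‖x‖ ^ 2)) := hasCompactSupport_chi_mul hN0 _
  obtain ⟨f, -, -, -, hf⟩ := exists_approx_energy_radial hm hw h dS cs hcs
  set J := ∫ x, ((4 * ‖x‖ ^ 2 * S' (‖x‖ ^ 2) ^ 2 - ‖x‖ ^ 2 * S (‖x‖ ^ 2) * S' (‖x‖ ^ 2)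
          + S (‖x‖ ^ 2) ^ 2 / 2 - z.re * S (‖x‖ ^ 2) ^ 2) * ‖w x‖ ^ 2
          - α * (S (‖x‖ ^ 2) ^ 2 * (conj (w x) * velGradG w x).re)) with hJ
  -- Only the nonnegativity of the Dirichlet integrals is used at this stage.
  have J0 : 0 ≤ J := by
    refine le_of_forall_pos_le_add fun δ hδ => ?_
    obtain ⟨k, hk⟩ := (hf δ hδ).exists
    exact le_trans (integral_nonneg fun x => by positivity) hk
  -- pointwise bound of the integrand
  have hpt : ∀ x : Plane, (4 * ‖x‖ ^ 2 * S' (‖x‖ ^ 2) ^ 2 - ‖x‖ ^ 2 * S (‖x‖ ^ 2) * S' (‖x‖ ^ 2)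
          + S (‖x‖ ^ 2) ^ 2 / 2 - z.re * S (‖x‖ ^ 2) ^ 2) * ‖w x‖ ^ 2
          - α * (S (‖x‖ ^ 2) ^ 2 * (conj (w x) * velGradG w x).re)
      ≤ (D * ‖w x‖ ^ 2 + α ^ 2 / (2 * κ) * C * (‖velGradG w x‖ ^ 2 * Real.exp (3 / 8 * ‖x‖ ^ 2))
        + K / ε * T N x) - κ / 4 * (B n).indicator (fun x => Real.exp (‖x‖ ^ 2 / 4) * ‖w x‖ ^ 2) x := by
    intro x
    have ht : 0 ≤ ‖x‖ ^ 2 := by positivity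
    have k1 := hDK ε N (‖x‖ ^ 2) hε hN1 ht (S (‖x‖ ^ 2)) (S' (‖x‖ ^ 2)) rfl rfl
    have k2 := mul_le_mul_of_nonneg_right k1 (sq_nonneg ‖w x‖)
    have k3 : |(conj (w x) * velGradG w x).re| ≤ ‖w x‖ * ‖velGradG w x‖ := by
      refine (Complex.abs_re_le_norm _).trans (le_of_eq ?_)
      rw [norm_mul, Complex.norm_conj]
    -- Young's inequality spends half of the coercivity `κ` on `w`. The other half, combined with
    -- the lower bound `e^{t/4}/2` for the squared weight on the ball, leaves `κ/4`.
    have k4 : -(α * (conj (w x) * velGradG w x).re)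
        ≤ κ / 2 * ‖w x‖ ^ 2 + α ^ 2 / (2 * κ) * ‖velGradG w x‖ ^ 2 := by
      have e1 : κ / 2 * ‖w x‖ ^ 2 + α ^ 2 / (2 * κ) * ‖velGradG w x‖ ^ 2
          - |α| * (‖w x‖ * ‖velGradG w x‖)
          = (κ * ‖w x‖ - |α| * ‖velGradG w x‖) ^ 2 / (2 * κ) := by
        field_simp
        rw [sub_sq, mul_pow _ |α|, sq_abs]
        ring
      have e2 : 0 ≤ (κ * ‖w x‖ - |α| * ‖velGradG w x‖) ^ 2 / (2 * κ) := by positivity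
      have e3 : -(α * (conj (w x) * velGradG w x).re) ≤ |α| * (‖w x‖ * ‖velGradG w x‖) := by
        refine (neg_le_abs _).trans ?_
        rw [abs_mul]
        gcongr
      linarith
    have k5 := mul_le_mul_of_nonneg_left k4 (sq_nonneg (S (‖x‖ ^ 2)))
    have hS2 : S (‖x‖ ^ 2) ^ 2 ≤ wt m ε (‖x‖ ^ 2) ^ 2 := by
      have c0 := chi_nonneg N (‖x‖ ^ 2)
      have c1 := chi_le_one N (‖x‖ ^ 2)
      simp only [hS, mul_pow]
      exact mul_le_of_le_one_left (sq_nonneg _) (pow_le_one₀ c0 c1)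
    -- Here `3/8 = 1/4 + 1/8`, where the extra `1/8` dominates `(1 + t)^m`.
    have k6 : S (‖x‖ ^ 2) ^ 2 ≤ C * Real.exp (3 / 8 * ‖x‖ ^ 2) := by
      refine hS2.trans ((wt_sq_le hε ht).trans ?_)
      have e0 : Real.exp (3 / 8 * ‖x‖ ^ 2) = Real.exp (‖x‖ ^ 2 / 8) * Real.exp (‖x‖ ^ 2 / 4) := by
        rw [← Real.exp_add]; congr 1; ring
      rw [e0, ← mul_assoc]
      gcongr
      exact hC _ ht
    have k7 := mul_le_mul_of_nonneg_right k6
      (by positivity : 0 ≤ α ^ 2 / (2 * κ) * ‖velGradG w x‖ ^ 2)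
    have k8 : κ / 4 * (B n).indicator (fun x => Real.exp (‖x‖ ^ 2 / 4) * ‖w x‖ ^ 2) x
        ≤ κ / 2 * (S (‖x‖ ^ 2) ^ 2 * ‖w x‖ ^ 2) := by
      by_cases hx : x ∈ B n
      · have hxn : ‖x‖ ^ 2 ≤ n := hx
        rw [indicator_of_mem hx]
        have e1 : S (‖x‖ ^ 2) = wt m ε (‖x‖ ^ 2) := by
          simp only [hS]
          rw [chi_eq_one hN0 (hxn.trans hNn), one_mul]
        have e2 : Real.exp (‖x‖ ^ 2 / 4) / 2 ≤ wt m ε (‖x‖ ^ 2) ^ 2 :=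
          le_wt_sq hm0 hε ht (Real.exp_le_exp.2 (by linarith))
        rw [e1]
        have := mul_le_mul_of_nonneg_right e2 (by positivity : 0 ≤ κ / 2 * ‖w x‖ ^ 2)
        linarith
      · rw [indicator_of_notMem hx]
        simp; positivity
    have k9 : T N x = (if (N : ℝ) ≤ ‖x‖ ^ 2 then (1 + ‖x‖ ^ 2) ^ m else 0) * ‖w x‖ ^ 2 := rfl
    rw [k9]
    linarith
  have I1 : Integrable (fun x => D * ‖w x‖ ^ 2
      + α ^ 2 / (2 * κ) * C * (‖velGradG w x‖ ^ 2 * Real.exp (3 / 8 * ‖x‖ ^ 2))) := (Iw.const_mul D).add (Ig.const_mul (α ^ 2 / (2 * κ) * C))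
  have I2 : Integrable (fun x => D * ‖w x‖ ^ 2
      + α ^ 2 / (2 * κ) * C * (‖velGradG w x‖ ^ 2 * Real.exp (3 / 8 * ‖x‖ ^ 2))
      + K / ε * T N x) := I1.add ((IT N).const_mul (K / ε))
  have I3 := ((integrable_indicator_iff (mB n)).2 (IB n)).const_mul (κ / 4)
  have IJ : Integrable (fun x => (4 * ‖x‖ ^ 2 * S' (‖x‖ ^ 2) ^ 2 - ‖x‖ ^ 2 * S (‖x‖ ^ 2) * S' (‖x‖ ^ 2)
          + S (‖x‖ ^ 2) ^ 2 / 2 - z.re * S (‖x‖ ^ 2) ^ 2) * ‖w x‖ ^ 2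
          - α * (S (‖x‖ ^ 2) ^ 2 * (conj (w x) * velGradG w x).re)) :=
    integrable_energy_radial dS cs hcs hw.1 hgm _ _
  have hfin := integral_mono IJ (I2.sub I3) hpt
  have e1 : ∫ x, ((D * ‖w x‖ ^ 2 + α ^ 2 / (2 * κ) * C * (‖velGradG w x‖ ^ 2 * Real.exp (3 / 8 * ‖x‖ ^ 2))
        + K / ε * T N x) - κ / 4 * (B n).indicator (fun x => Real.exp (‖x‖ ^ 2 / 4) * ‖w x‖ ^ 2) x)
      = A + K / ε * (∫ x, T N x) - κ / 4 * ∫ x in B n, Real.exp (‖x‖ ^ 2 / 4) * ‖w x‖ ^ 2 := by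
    rw [integral_sub I2 I3, integral_add I1 ((IT N).const_mul _), integral_add (Iw.const_mul _)
      (Ig.const_mul _), integral_const_mul, integral_const_mul, integral_const_mul,
      integral_const_mul, integral_indicator (mB n)]
  have hfin' : J ≤ A + K / ε * (∫ x, T N x)
      - κ / 4 * ∫ x in B n, Real.exp (‖x‖ ^ 2 / 4) * ‖w x‖ ^ 2 := hfin.trans e1.le
  have : κ / 4 * (∫ x in B n, Real.exp (‖x‖ ^ 2 / 4) * ‖w x‖ ^ 2) ≤ A + K / ε * (∫ x, T N x) := by
    linarith
  rw [div_mul_eq_mul_div, le_div_iff₀ hκ]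
  linarith

end OseenVortex
end

open MeasureTheory
open scoped ContDiff
noncomputable section
namespace OseenVortex
open Filter Topology Set
open scoped ENNReal Convolution ComplexConjugate

/-! ### The spectral gap -/

/-- The oscillator gap is applied to the regular functions `s f_n` and passed to the limit, so no
derivative of `w` is needed. The `-1/2` of the oscillator potential cancels the `S²/2` of the energy
inequality, and `|x|²/16` takes its place. -/
theorem energy_gap_radial {m α : ℝ} (hm : 1 < m) {w : Plane → ℂ} (hw : w ∈ L2 m) {z : ℂ}
    (h : DistEq (opL w - (α : ℂ) • opLam w) (ofFun (z • w))) {S S' : ℝ → ℝ}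
    (hS : ∀ t, 0 ≤ t → HasDerivAt S (S' t) t)
    (hs : ContDiff ℝ 1 (fun x : Plane => S (‖x‖ ^ 2)))
    (hc : HasCompactSupport (fun x : Plane => S (‖x‖ ^ 2))) (k : ℕ) :
    (k : ℝ) / 2 * (∫ x, S (‖x‖ ^ 2) ^ 2 * ‖w x‖ ^ 2)
      - (k : ℝ) / 2 * ∑ i ∈ lowIdx k, hermiteT (fun x => ((S (‖x‖ ^ 2) : ℝ) : ℂ) * w x) i ≤
    ∫ x, ((4 * ‖x‖ ^ 2 * S' (‖x‖ ^ 2) ^ 2 - ‖x‖ ^ 2 * S (‖x‖ ^ 2) * S' (‖x‖ ^ 2)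
          + ‖x‖ ^ 2 / 16 * S (‖x‖ ^ 2) ^ 2 - z.re * S (‖x‖ ^ 2) ^ 2) * ‖w x‖ ^ 2
          - α * (S (‖x‖ ^ 2) ^ 2 * (conj (w x) * velGradG w x).re)) := by
  obtain ⟨f, h1, h2, h3, h4⟩ := exists_approx_energy_radial hm hw h hS hs hc
  have IJ := integrable_energy_radial hS hs hc hw.1 (memLp_velGradG hm hw) z.re α
  set J := ∫ x, ((4 * ‖x‖ ^ 2 * S' (‖x‖ ^ 2) ^ 2 - ‖x‖ ^ 2 * S (‖x‖ ^ 2) * S' (‖x‖ ^ 2)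
          + S (‖x‖ ^ 2) ^ 2 / 2 - z.re * S (‖x‖ ^ 2) ^ 2) * ‖w x‖ ^ 2
          - α * (S (‖x‖ ^ 2) ^ 2 * (conj (w x) * velGradG w x).re)) with hJ
  set s : Plane → ℝ := fun x => S (‖x‖ ^ 2) with hsd
  have cs := hs.continuous
  have zs : ∀ x, x ∉ tsupport s → s x = 0 := fun x hx => image_eq_zero_of_notMem_tsupport hx
  have bdd : ∀ c : Plane → ℝ, Continuous c → (∀ x, x ∉ tsupport s → c x = 0) →
      ∃ C, ∀ x, |c x| ≤ C := fun c hcc hz =>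
    hcc.bounded_above_of_compact_support (HasCompactSupport.intro hc hz)
  obtain ⟨C0, hC0⟩ := bdd s cs zs
  have c1c : Continuous (fun x => s x ^ 2) := by fun_prop
  obtain ⟨C1, hC1⟩ := bdd (fun x => s x ^ 2) c1c fun x hx => by simp [zs x hx]
  have c2c : Continuous (fun x : Plane => (‖x‖ ^ 2 / 16 - 1 / 2) * s x ^ 2) := by fun_prop
  obtain ⟨C2, hC2⟩ := bdd (fun x => (‖x‖ ^ 2 / 16 - 1 / 2) * s x ^ 2) c2c
    fun x hx => by simp [zs x hx]
  set u : ℕ → Plane → ℂ := fun n x => ((s x : ℝ) : ℂ) * f n x with hu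
  have cu : ∀ n, ContDiff ℝ 1 (u n) := fun n =>
    (Complex.ofRealCLM.contDiff.comp hs).mul ((h1 n).of_le (by exact_mod_cast le_top))
  have su : ∀ n, HasCompactSupport (u n) := fun n =>
    HasCompactSupport.intro hc fun x hx => by simp [hu, zs x hx]
  have nu : ∀ (v : Plane → ℂ) x, ‖((s x : ℝ) : ℂ) * v x‖ ^ 2 = s x ^ 2 * (conj (v x) * v x).re := by
    intro v x
    rw [norm_mul, mul_pow, Complex.norm_real, Real.norm_eq_abs, sq_abs, conj_mul_self_re]
  -- limits
  have L1 : Tendsto (fun n => ∫ x, ‖u n x‖ ^ 2) atTop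
      (𝓝 (∫ x, s x ^ 2 * (conj (w x) * w x).re)) := by
    have := tendsto_integral_weighted c1c.aestronglyMeasurable hC1 h2 h2 hw.1 hw.1 h3 h3
    simpa only [hu, nu] using this
  have L2 : Tendsto (fun n => ∫ x, (‖x‖ ^ 2 / 16 - 1 / 2) * ‖u n x‖ ^ 2) atTop
      (𝓝 (∫ x, (‖x‖ ^ 2 / 16 - 1 / 2) * s x ^ 2 * (conj (w x) * w x).re)) := by
    have := tendsto_integral_weighted c2c.aestronglyMeasurable hC2 h2 h2 hw.1 hw.1 h3 h3
    simpa only [hu, nu, ← mul_assoc] using this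
  have L3 : ∀ i, Tendsto (fun n => hermiteT (u n) i) atTop
      (𝓝 (hermiteT (fun x => ((s x : ℝ) : ℂ) * w x) i)) := by
    intro i
    have hF := memLp_hermiteF i
    have hz : Tendsto (fun _ : ℕ => eLpNorm (fun x => ((hermiteF i x : ℝ) : ℂ)
        - ((hermiteF i x : ℝ) : ℂ)) 2 volume) atTop (𝓝 0) := by simp
    have := tendsto_integral_conj_mul (fun _ => hF)
      (fun n => memLp_bdd_mul cs.aestronglyMeasurable hC0 (h2 n)) hF
      (memLp_bdd_mul cs.aestronglyMeasurable hC0 hw.1) hz (tendsto_bdd_mul hC0 h3)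
    simp only [Complex.conj_ofReal] at this
    exact (this.norm.pow 2).div_const _
  have L4 := (L1.const_mul ((k : ℝ) / 2)).sub
    ((tendsto_finsetSum (lowIdx k) fun i _ => L3 i).const_mul ((k : ℝ) / 2))
  have hle : (k : ℝ) / 2 * (∫ x, s x ^ 2 * (conj (w x) * w x).re)
      - (k : ℝ) / 2 * ∑ i ∈ lowIdx k, hermiteT (fun x => ((s x : ℝ) : ℂ) * w x) i ≤
      J + ∫ x, (‖x‖ ^ 2 / 16 - 1 / 2) * s x ^ 2 * (conj (w x) * w x).re := by
    refine le_of_forall_pos_le_add fun δ hδ => ?_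
    refine le_of_tendsto_of_tendsto L4 ((L2.const_add J).add_const δ) ?_
    filter_upwards [h4 δ hδ] with n hn
    refine (harmonic_oscillator_gap (cu n) (su n) k).trans ?_
    have cpu := fun j => continuous_pd (cu n) j
    have zpu : ∀ j x, x ∉ tsupport (u n) → pd j (u n) x = 0 := fun j x hx =>
      image_eq_zero_of_notMem_tsupport fun h => hx (tsupport_fderiv_apply_subset ℝ _ h)
    have cun := (cu n).continuous
    rw [integral_add]
    · linarith
    · exact Continuous.integrable_of_hasCompactSupport (by fun_prop)
        (HasCompactSupport.intro (su n) fun x hx => by simp [zpu _ x hx])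
    · exact Continuous.integrable_of_hasCompactSupport (by fun_prop)
        (HasCompactSupport.intro (su n) fun x hx => by
          simp [image_eq_zero_of_notMem_tsupport hx])
  simp only [conj_mul_self_re] at hle
  refine hle.trans (le_of_eq ?_)
  have I2 := integrable_weighted c2c.aestronglyMeasurable hC2 hw.1 hw.1
  simp only [conj_mul_self_re] at I2
  rw [hJ, ← integral_add IJ I2]
  congr 1
  ext x
  simp only [hsd]
  ring

/-! ### Antisymmetry of the Biot-Savart kernel -/

/-- Provides the absolute convergence behind Fubini and the exchange of variables. Splitting off
`e^{|ξ|²/16}` and its inverse reduces the product to the Gaussian bound on `w` and to the potential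
against a Gaussian; `|ξ|² ≤ 8 e^{|ξ|²/8}` explains the `8`. -/
theorem lintegral_norm_mul_potential_lt_top {m : ℝ} (hm : 1 < m) {w : Plane → ℂ} (hw : w ∈ L2 m)
    (he : Integrable (fun x : Plane => Real.exp (‖x‖ ^ 2 / 4) * ‖w x‖ ^ 2)) :
    ∫⁻ ξ, ‖w ξ‖ₑ * ENNReal.ofReal ‖ξ‖ * potential w ξ < ⊤ := by
  have c16 : Continuous (fun ξ : Plane => Real.exp (‖ξ‖ ^ 2 / 16)) := by fun_prop
  have c8 : Continuous (fun ξ : Plane => Real.exp (-(‖ξ‖ ^ 2 / 8))) := by fun_prop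
  have hpt : ∀ ξ : Plane, ‖w ξ‖ₑ * ENNReal.ofReal ‖ξ‖ * potential w ξ ≤
      8 * ‖Real.exp (‖ξ‖ ^ 2 / 4) * ‖w ξ‖ ^ 2‖ₑ
        + potential w ξ ^ 2 * ENNReal.ofReal (Real.exp (-(‖ξ‖ ^ 2 / 8))) := by
    intro ξ
    set a := ‖w ξ‖ₑ * ENNReal.ofReal (‖ξ‖ * Real.exp (‖ξ‖ ^ 2 / 16)) with ha
    set c := potential w ξ * ENNReal.ofReal (Real.exp (-(‖ξ‖ ^ 2 / 16))) with hc
    have e1 : ‖w ξ‖ₑ * ENNReal.ofReal ‖ξ‖ * potential w ξ = a * c := by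
      have : ENNReal.ofReal ‖ξ‖ = ENNReal.ofReal (‖ξ‖ * Real.exp (‖ξ‖ ^ 2 / 16))
          * ENNReal.ofReal (Real.exp (-(‖ξ‖ ^ 2 / 16))) := by
        rw [← ENNReal.ofReal_mul (by positivity), mul_assoc, ← Real.exp_add]
        simp
      rw [this, ha, hc]
      ring
    have e2 : a * c ≤ a ^ 2 + c ^ 2 := by
      rcases le_total a c with hh | hh
      · calc a * c ≤ c * c := by gcongr
          _ = c ^ 2 := (sq c).symm
          _ ≤ _ := le_add_self
      · calc a * c ≤ a * a := by gcongr
          _ = a ^ 2 := (sq a).symm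
          _ ≤ _ := le_self_add
    have e3 : c ^ 2 = potential w ξ ^ 2 * ENNReal.ofReal (Real.exp (-(‖ξ‖ ^ 2 / 8))) := by
      rw [hc, mul_pow, ← ENNReal.ofReal_pow (by positivity), ← Real.exp_nat_mul]
      congr 3
      push_cast
      ring
    have e4 : a ^ 2 ≤ 8 * ‖Real.exp (‖ξ‖ ^ 2 / 4) * ‖w ξ‖ ^ 2‖ₑ := by
      rw [ha, ← ofReal_norm (w ξ), ← ENNReal.ofReal_mul (by positivity),
        ← ENNReal.ofReal_pow (by positivity), Real.enorm_of_nonneg (by positivity),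
        show (8 : ℝ≥0∞) = ENNReal.ofReal 8 by simp, ← ENNReal.ofReal_mul (by positivity)]
      refine ENNReal.ofReal_le_ofReal ?_
      have k1 : ‖ξ‖ ^ 2 / 8 ≤ Real.exp (‖ξ‖ ^ 2 / 8) := by
        linarith [Real.add_one_le_exp (‖ξ‖ ^ 2 / 8)]
      have k2 : Real.exp (‖ξ‖ ^ 2 / 16) ^ 2 = Real.exp (‖ξ‖ ^ 2 / 8) := by
        rw [← Real.exp_nat_mul]; congr 1; push_cast; ring
      have k3 : Real.exp (‖ξ‖ ^ 2 / 4) = Real.exp (‖ξ‖ ^ 2 / 8) * Real.exp (‖ξ‖ ^ 2 / 8) := by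
        rw [← Real.exp_add]; congr 1; ring
      calc (‖w ξ‖ * (‖ξ‖ * Real.exp (‖ξ‖ ^ 2 / 16))) ^ 2
          = 8 * (‖ξ‖ ^ 2 / 8 * Real.exp (‖ξ‖ ^ 2 / 16) ^ 2 * ‖w ξ‖ ^ 2) := by ring
        _ ≤ 8 * (Real.exp (‖ξ‖ ^ 2 / 8) * Real.exp (‖ξ‖ ^ 2 / 8) * ‖w ξ‖ ^ 2) := by
            rw [k2]; gcongr
        _ = _ := by rw [k3]
    rw [e1]
    exact e2.trans (add_le_add e4 e3.le)
  refine lt_of_le_of_lt (lintegral_mono hpt) ?_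
  have hW : ∫⁻ ξ : Plane, ENNReal.ofReal (Real.exp (-(‖ξ‖ ^ 2 / 8))) < ⊤ := by
    have := (integrable_exp_neg_mul_norm_sq (c := 1 / 8) (by norm_num)).hasFiniteIntegral
    refine lt_of_le_of_lt (lintegral_mono fun ξ => ?_) this
    rw [Real.enorm_of_nonneg (by positivity)]
    refine ENNReal.ofReal_le_ofReal (le_of_eq ?_)
    congr 1; ring
  rw [lintegral_add_left' (he.aestronglyMeasurable.enorm.const_mul _),
    lintegral_const_mul'' _ he.aestronglyMeasurable.enorm]
  exact ENNReal.add_lt_top.2 ⟨ENNReal.mul_lt_top (by simp) he.hasFiniteIntegral,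
    lintegral_potential_sq_lt_top hm hw c8.measurable.ennreal_ofReal
      (fun ξ => by rw [ENNReal.ofReal_le_one, Real.exp_le_one_iff]; linarith [sq_nonneg ‖ξ‖]) hW⟩

/-- The radial part of the Biot-Savart bilinear form. -/
def radialForm (w : Plane → ℂ) (j : Fin 2) (p : Plane × Plane) : ℂ :=
  ((p.1 j : ℝ) : ℂ) * conj (w p.1) *
    (((perp (p.1 - p.2) j / ‖p.1 - p.2‖ ^ 2 : ℝ) : ℂ) * w p.2)

theorem integrable_radialForm {m : ℝ} (hm : 1 < m) {w : Plane → ℂ} (hw : w ∈ L2 m)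
    (he : Integrable (fun x : Plane => Real.exp (‖x‖ ^ 2 / 4) * ‖w x‖ ^ 2)) (j : Fin 2) :
    Integrable (radialForm w j) (volume.prod volume) := by
  have hM : AEStronglyMeasurable (radialForm w j) (volume.prod volume) := by
    have c1 : Continuous (fun x : Plane => ((x j : ℝ) : ℂ)) := by fun_prop
    have h1 : AEStronglyMeasurable (fun x : Plane => ((x j : ℝ) : ℂ) * conj (w x)) volume :=
      c1.aestronglyMeasurable.mul (Complex.continuous_conj.comp_aestronglyMeasurable hw.1.1)
    exact h1.comp_fst.mul (aestronglyMeasurable_kernel_mul hw.1.1 j)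
  refine ⟨hM, ?_⟩
  rw [HasFiniteIntegral, lintegral_prod _ hM.enorm]
  refine lt_of_le_of_lt (lintegral_mono fun ξ => ?_) (lintegral_norm_mul_potential_lt_top hm hw he)
  rw [potential, ← lintegral_const_mul' _ _ (by finiteness)]
  refine lintegral_mono fun η => ?_
  rw [radialForm, enorm_mul]
  refine mul_le_mul' ?_ (enorm_kernel_mul_le w j ξ η)
  rw [enorm_mul, mul_comm]
  refine mul_le_mul' (le_of_eq ?_) ?_
  · rw [← ofReal_norm, ← ofReal_norm, Complex.norm_conj]
  · rw [← ofReal_norm, Complex.norm_real]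
    exact ENNReal.ofReal_le_ofReal (PiLp.norm_apply_le ξ j)

/-- Only the sum over both components is anti-Hermitian: `ξ·(ξ - η)^⊥ = -ξ·η^⊥` changes sign under
exchange of `ξ` and `η`, while `|ξ - η|²` does not. -/
theorem radialForm_swap (w : Plane → ℂ) (p : Plane × Plane) :
    radialForm w 0 p.swap + radialForm w 1 p.swap
      = -conj (radialForm w 0 p + radialForm w 1 p) := by
  obtain ⟨ξ, η⟩ := p
  have e : ‖η - ξ‖ = ‖ξ - η‖ := norm_sub_rev _ _
  simp only [radialForm, Prod.swap, e, map_add, map_mul, Complex.conj_ofReal, Complex.conj_conj,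
    perp]
  push_cast
  simp
  ring

/-- Since `∇G = -ξ G/2`, the weight cancels the Gaussian and leaves `-1/(16π²)` times the double
integral of `radialForm` summed over components. Exchanging the variables shows that this integral
equals minus its conjugate, hence is purely imaginary. -/
theorem integral_exp_mul_velGradG_eq_zero {m : ℝ} (hm : 1 < m) {w : Plane → ℂ} (hw : w ∈ L2 m)
    (he : Integrable (fun x : Plane => Real.exp (‖x‖ ^ 2 / 4) * ‖w x‖ ^ 2)) :
    ∫ x : Plane, Real.exp (‖x‖ ^ 2 / 4) * (conj (w x) * velGradG w x).re = 0 := by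
  have hi := integrable_radialForm hm hw he
  set F : Plane × Plane → ℂ := fun p => radialForm w 0 p + radialForm w 1 p with hF
  have hIF : Integrable F (volume.prod volume) := (hi 0).add (hi 1)
  have hre : (∫ p, F p ∂(volume.prod volume)).re = 0 := by
    have h1 : ∫ p, F p ∂(volume.prod volume) = ∫ p : Plane × Plane, F p.swap ∂(volume.prod volume) :=
      (integral_prod_swap F).symm
    have h2 : ∀ p : Plane × Plane, F p.swap = -conj (F p) := radialForm_swap w
    simp only [h2] at h1
    rw [integral_neg, integral_conj] at h1
    have := congrArg Complex.re h1
    simp at this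
    linarith
  have hin : ∀ j ξ, ∫ η, radialForm w j (ξ, η)
      = ((ξ j : ℝ) : ℂ) * conj (w ξ) * ((2 * Real.pi : ℂ) * biotSavart w j ξ) := by
    intro j ξ
    simp only [radialForm]
    rw [integral_const_mul, biotSavart]
    have : (Real.pi : ℂ) ≠ 0 := by exact_mod_cast Real.pi_pos.ne'
    congr 1
    field_simp
  have h3 : ∫ p, F p ∂(volume.prod volume) = ∫ ξ : Plane, ∑ j, ∫ η, radialForm w j (ξ, η) := by
    rw [hF, integral_add (hi 0) (hi 1), integral_prod _ (hi 0), integral_prod _ (hi 1),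
      ← integral_add (hi 0).integral_prod_left (hi 1).integral_prod_left]
    simp only [Fin.sum_univ_two]
  have hI3 : Integrable (fun ξ : Plane => ∑ j, ∫ η, radialForm w j (ξ, η)) := by
    simp only [Fin.sum_univ_two]
    exact (hi 0).integral_prod_left.add (hi 1).integral_prod_left
  rw [h3] at hre
  have h4 : (∫ ξ : Plane, ∑ j, ∫ η, radialForm w j (ξ, η)).re
      = ∫ ξ : Plane, (∑ j, ∫ η, radialForm w j (ξ, η)).re := (integral_re hI3).symm
  rw [h4] at hre
  have h5 : ∀ x : Plane, Real.exp (‖x‖ ^ 2 / 4) * (conj (w x) * velGradG w x).re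
      = -(1 / (16 * Real.pi ^ 2)) * (∑ j, ∫ η, radialForm w j (x, η)).re := by
    intro x
    have hE : Real.exp (‖x‖ ^ 2 / 4) * G x = 1 / (4 * Real.pi) := by
      rw [G, mul_left_comm, ← Real.exp_add]
      simp [neg_div]
    have hE' : ((Real.exp (‖x‖ ^ 2 / 4) : ℝ) : ℂ) * ((G x : ℝ) : ℂ) = 1 / (4 * Real.pi) := by
      exact_mod_cast hE
    have hp : (Real.pi : ℂ) ≠ 0 := by exact_mod_cast Real.pi_pos.ne'
    rw [← Complex.re_ofReal_mul, ← Complex.re_ofReal_mul]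
    congr 1
    simp only [hin, velGradG, pd_G, Fin.sum_univ_two]
    push_cast
    have : ((Real.exp (‖x‖ ^ 2 / 4) : ℝ) : ℂ) * (conj (w x) * (biotSavart w 0 x
        * (-(((x 0 : ℝ) : ℂ) / 2) * ((G x : ℝ) : ℂ)) + biotSavart w 1 x
        * (-(((x 1 : ℝ) : ℂ) / 2) * ((G x : ℝ) : ℂ))))
        = (((Real.exp (‖x‖ ^ 2 / 4) : ℝ) : ℂ) * ((G x : ℝ) : ℂ)) * (-(1 / 2) * (conj (w x)
          * (biotSavart w 0 x * ((x 0 : ℝ) : ℂ) + biotSavart w 1 x * ((x 1 : ℝ) : ℂ)))) := by ring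
    rw [hE'] at this
    push_cast at this
    rw [this]
    field_simp
    ring
  simp only [h5]
  rw [integral_const_mul, hre, mul_zero]

end OseenVortex
end

open MeasureTheory
open scoped ContDiff
noncomputable section
namespace OseenVortex
open Filter Topology Set
open scoped ENNReal Convolution ComplexConjugate

/-! ### Bounds on eigenvalues -/

theorem tendsto_chi_natCast (t : ℝ) : ∀ᶠ N : ℕ in atTop, chi N t = 1 ∧ chiD N t = 0 := by
  obtain ⟨n, hn⟩ := exists_nat_gt (max t 0)
  filter_upwards [eventually_ge_atTop n] with N hN
  have h1 : max t 0 < (N : ℝ) := hn.trans_le (by exact_mod_cast hN)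
  have h0 : (0 : ℝ) < N := (le_max_right _ _).trans_lt h1
  have ht : t < N := (le_max_left _ _).trans_lt h1
  exact ⟨chi_eq_one h0 ht.le, chiD_eq_zero_of_lt h0 ht⟩

/-- If the Gaussian-weighted eigenfunction is orthogonal to the low Hermite functions, then the
real part of the eigenvalue is at most `-k/2`. -/
theorem re_le_of_forall_lowIdx {m α : ℝ} (hm : 1 < m) {w : Plane → ℂ} (hw : w ∈ L2 m) {z : ℂ}
    (h : DistEq (opL w - (α : ℂ) • opLam w) (ofFun (z • w))) (hw0 : ¬ w =ᵐ[volume] 0)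
    (he : Integrable (fun x : Plane => Real.exp (‖x‖ ^ 2 / 4) * ‖w x‖ ^ 2)) (k : ℕ)
    (hk : ∀ i ∈ lowIdx k, ∫ x : Plane,
      (((hermiteQ i.1).eval (x 0) * (hermiteQ i.2).eval (x 1) : ℝ) : ℂ) * w x = 0) :
    z.re ≤ -(k / 2) := by
  set E : Plane → ℝ := fun x => Real.exp (‖x‖ ^ 2 / 4) with hE
  have cE8 : Continuous (fun x : Plane => Real.exp (‖x‖ ^ 2 / 8)) := by fun_prop
  have cE : Continuous E := by rw [hE]; fun_prop
  have sqE : ∀ x : Plane, Real.exp (‖x‖ ^ 2 / 8) ^ 2 = E x := fun x => by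
    rw [hE, ← Real.exp_nat_mul]; congr 1; push_cast; ring
  have hg := memLp_velGradG hm hw
  have Ig := integrable_velGradG_sq hm hw
  have mw := hw.1.1
  have mg := hg.1
  have mre : AEStronglyMeasurable (fun x => (conj (w x) * velGradG w x).re) volume :=
    Complex.continuous_re.comp_aestronglyMeasurable
      ((Complex.continuous_conj.comp_aestronglyMeasurable mw).mul mg)
  have bre : ∀ x, |(conj (w x) * velGradG w x).re| ≤ ‖w x‖ ^ 2 + ‖velGradG w x‖ ^ 2 := by
    intro x
    refine (Complex.abs_re_le_norm _).trans ?_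
    rw [norm_mul, Complex.norm_conj]
    nlinarith [sq_nonneg (‖w x‖ - ‖velGradG w x‖), sq_nonneg ‖w x‖, sq_nonneg ‖velGradG w x‖]
  set bd : Plane → ℝ := fun x => E x * ‖w x‖ ^ 2
    + ‖velGradG w x‖ ^ 2 * Real.exp (3 / 8 * ‖x‖ ^ 2) with hbd
  have Ibd : Integrable bd := he.add Ig
  have bEre : ∀ x, E x * |(conj (w x) * velGradG w x).re| ≤ bd x := by
    intro x
    have h1 : E x ≤ Real.exp (3 / 8 * ‖x‖ ^ 2) :=
      Real.exp_le_exp.2 (by nlinarith [sq_nonneg ‖x‖])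
    have h2 : 0 ≤ E x := (Real.exp_pos _).le
    calc _ ≤ E x * (‖w x‖ ^ 2 + ‖velGradG w x‖ ^ 2) := by gcongr; exact bre x
      _ = E x * ‖w x‖ ^ 2 + ‖velGradG w x‖ ^ 2 * E x := by ring
      _ ≤ bd x := by simp only [hbd]; gcongr
  have IEre : Integrable (fun x => E x * (conj (w x) * velGradG w x).re) :=
    Ibd.mono' (cE.aestronglyMeasurable.mul mre) (ae_of_all _ fun x => by
      rw [norm_mul, Real.norm_of_nonneg (Real.exp_pos _).le]; exact bEre x)
  -- the weights
  set S : ℕ → ℝ → ℝ := fun N t => chi N t * Real.exp (t / 8) with hS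
  set S' : ℕ → ℝ → ℝ := fun N t => chiD N t * Real.exp (t / 8)
    + chi N t * (Real.exp (t / 8) * (1 / 8)) with hS'
  have dS : ∀ N t, 0 ≤ t → HasDerivAt (S N) (S' N t) t := fun N t _ =>
    (hasDerivAt_chi N t).mul ((hasDerivAt_id t).div_const 8).exp
  have cS : ∀ N, ContDiff ℝ 1 (fun x : Plane => S N (‖x‖ ^ 2)) := fun N =>
    (((contDiff_chi N).of_le (by exact_mod_cast le_top)).comp (contDiff_norm_sq ℝ)).mul
      ((contDiff_norm_sq ℝ).div_const 8).exp
  have sq_S : ∀ N (x : Plane), S N (‖x‖ ^ 2) ^ 2 = chi N (‖x‖ ^ 2) ^ 2 * E x := fun N x => by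
    simp only [hS, mul_pow, sqE]
  have chi2 : ∀ (N : ℕ) t, chi N t ^ 2 ≤ 1 := fun N t =>
    pow_le_one₀ (chi_nonneg N t) (chi_le_one N t)
  -- limits
  have L1 : Tendsto (fun N => ∫ x : Plane, S N (‖x‖ ^ 2) ^ 2 * ‖w x‖ ^ 2) atTop
      (𝓝 (∫ x, E x * ‖w x‖ ^ 2)) := by
    refine tendsto_integral_of_dominated_convergence _ (fun N => ?_) he (fun N => ?_) ?_
    · exact ((cS N).continuous.pow 2).aestronglyMeasurable.mul (mw.norm.pow 2)
    · refine ae_of_all _ fun x => ?_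
      rw [Real.norm_of_nonneg (by positivity), sq_S]
      have := chi2 N (‖x‖ ^ 2)
      gcongr
      exact mul_le_of_le_one_left (Real.exp_pos _).le this
    · refine ae_of_all _ fun x => tendsto_const_nhds.congr' ?_
      filter_upwards [tendsto_chi_natCast (‖x‖ ^ 2)] with N hN
      rw [sq_S, hN.1]; ring
  have mEw : MemLp (fun x : Plane => ((Real.exp (‖x‖ ^ 2 / 8) : ℝ) : ℂ) * w x) 2 := by
    have hM : AEStronglyMeasurable (fun x : Plane => ((Real.exp (‖x‖ ^ 2 / 8) : ℝ) : ℂ) * w x)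
        volume := (Complex.continuous_ofReal.comp cE8).aestronglyMeasurable.mul mw
    rw [memLp_two_iff_integrable_sq_norm hM]
    refine he.congr (ae_of_all _ fun x => ?_)
    simp only [norm_mul, mul_pow, Complex.norm_real, Real.norm_eq_abs, sq_abs]
    rw [sqE]
  have L2 : ∀ i ∈ lowIdx k, Tendsto (fun N : ℕ =>
      hermiteT (fun x : Plane => ((S N (‖x‖ ^ 2) : ℝ) : ℂ) * w x) i) atTop (𝓝 0) := by
    intro i hi
    have hF := memLp_hermiteF i
    have IF : Integrable (fun x : Plane => ((hermiteF i x : ℝ) : ℂ)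
      * (((Real.exp (‖x‖ ^ 2 / 8) : ℝ) : ℂ) * w x)) := integrable_mul_of_memLp hF mEw
    have hlim : Tendsto (fun N : ℕ => ∫ x : Plane, ((hermiteF i x : ℝ) : ℂ)
        * (((S N (‖x‖ ^ 2) : ℝ) : ℂ) * w x)) atTop (𝓝 (∫ x : Plane, ((hermiteF i x : ℝ) : ℂ)
        * (((Real.exp (‖x‖ ^ 2 / 8) : ℝ) : ℂ) * w x))) := by
      refine tendsto_integral_of_dominated_convergence _ (fun N => ?_) IF.norm (fun N => ?_) ?_
      · exact hF.1.mul ((Complex.continuous_ofReal.comp (cS N).continuous).aestronglyMeasurable.mul mw)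
      · refine ae_of_all _ fun x => ?_
        simp only [norm_mul, Complex.norm_real, hS]
        gcongr
        rw [Real.norm_of_nonneg (chi_nonneg _ _)]
        exact mul_le_of_le_one_left (norm_nonneg _) (chi_le_one _ _)
      · refine ae_of_all _ fun x => tendsto_const_nhds.congr' ?_
        filter_upwards [tendsto_chi_natCast (‖x‖ ^ 2)] with N hN
        simp only [hS, hN.1, one_mul]
    -- The Gaussian in the Hermite function cancels `e^{|x|²/8}` exactly, leaving a polynomial
    -- moment of `w`.
    have h0 : ∫ x : Plane, ((hermiteF i x : ℝ) : ℂ)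
        * (((Real.exp (‖x‖ ^ 2 / 8) : ℝ) : ℂ) * w x) = 0 := by
      rw [← hk i hi]
      congr 1
      ext x
      rw [← mul_assoc, ← Complex.ofReal_mul]
      congr 2
      rw [hermiteF, polyGauss, mul_assoc, ← Real.exp_add,
        show -(1 / 8) * ‖x‖ ^ 2 + ‖x‖ ^ 2 / 8 = 0 by ring, Real.exp_zero, mul_one]
    rw [h0] at hlim
    have := (hlim.norm.pow 2).div_const (hermiteN i)
    simpa [hermiteT] using this
  obtain ⟨M, hM0, hM⟩ := exists_chiD_bound
  have L3 : Tendsto (fun N : ℕ => ∫ x : Plane,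
      ((4 * ‖x‖ ^ 2 * S' N (‖x‖ ^ 2) ^ 2 - ‖x‖ ^ 2 * S N (‖x‖ ^ 2) * S' N (‖x‖ ^ 2)
          + ‖x‖ ^ 2 / 16 * S N (‖x‖ ^ 2) ^ 2 - z.re * S N (‖x‖ ^ 2) ^ 2) * ‖w x‖ ^ 2
          - α * (S N (‖x‖ ^ 2) ^ 2 * (conj (w x) * velGradG w x).re))) atTop
      (𝓝 (∫ x, (-(z.re) * (E x * ‖w x‖ ^ 2) - α * (E x * (conj (w x) * velGradG w x).re)))) := by
    -- For the weight `e^{t/8}` the quadratic terms cancel exactly, `t (1/16 - 1/8 + 1/16) = 0`, and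
    -- so do the terms linear in the derivative of the cutoff. Only its square remains, and it
    -- disappears in the limit.
    have hform : ∀ (N : ℕ) (x : Plane),
        (4 * ‖x‖ ^ 2 * S' N (‖x‖ ^ 2) ^ 2 - ‖x‖ ^ 2 * S N (‖x‖ ^ 2) * S' N (‖x‖ ^ 2)
          + ‖x‖ ^ 2 / 16 * S N (‖x‖ ^ 2) ^ 2 - z.re * S N (‖x‖ ^ 2) ^ 2) * ‖w x‖ ^ 2
          - α * (S N (‖x‖ ^ 2) ^ 2 * (conj (w x) * velGradG w x).re)
        = (4 * (‖x‖ ^ 2 * chiD N (‖x‖ ^ 2) ^ 2) - z.re * chi N (‖x‖ ^ 2) ^ 2) * (E x * ‖w x‖ ^ 2)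
          - α * (chi N (‖x‖ ^ 2) ^ 2 * (E x * (conj (w x) * velGradG w x).re)) := by
      intro N x
      simp only [hS, hS', ← sqE]
      ring
    simp only [hform]
    have cchi : ∀ N : ℕ, Continuous (fun x : Plane => chi N (‖x‖ ^ 2)) := fun N =>
      (contDiff_chi N).continuous.comp (by fun_prop)
    have cchiD : ∀ N : ℕ, Continuous (fun x : Plane => chiD N (‖x‖ ^ 2)) := fun N => by
      have h1 : Continuous (deriv Real.smoothTransition) :=
        (Real.smoothTransition.contDiff (n := 1)).continuous_deriv (by simp)
      unfold chiD
      fun_prop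
    refine tendsto_integral_of_dominated_convergence
      (fun x => (4 * M + |z.re|) * (E x * ‖w x‖ ^ 2) + |α| * bd x) (fun N => ?_)
      ((he.const_mul _).add (Ibd.const_mul _)) (fun N => ?_) ?_
    · have c1 := cchi N
      have c2 := cchiD N
      refine ((by fun_prop : Continuous fun x : Plane => 4 * (‖x‖ ^ 2 * chiD N (‖x‖ ^ 2) ^ 2)
        - z.re * chi N (‖x‖ ^ 2) ^ 2).aestronglyMeasurable.mul he.aestronglyMeasurable).sub
        (((c1.pow 2).aestronglyMeasurable.mul IEre.aestronglyMeasurable).const_mul α)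
    · refine ae_of_all _ fun x => ?_
      have hW : 0 ≤ E x * ‖w x‖ ^ 2 := by positivity
      have b1 : |4 * (‖x‖ ^ 2 * chiD N (‖x‖ ^ 2) ^ 2) - z.re * chi N (‖x‖ ^ 2) ^ 2|
          ≤ 4 * M + |z.re| := by
        have q1 : ‖x‖ ^ 2 * chiD N (‖x‖ ^ 2) ^ 2 ≤ M := by
          -- For `N = 0` the convention `1/0 = 0` makes `chiD` vanish identically; the uniform bound
          -- needs `N ≥ 1`.
          rcases Nat.eq_zero_or_pos N with rfl | hN
          · simpa [chiD] using hM0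
          · exact (hM N (‖x‖ ^ 2) (by exact_mod_cast hN) (sq_nonneg _)).2
        have q2 : |z.re * chi N (‖x‖ ^ 2) ^ 2| ≤ |z.re| := by
          rw [abs_mul, abs_of_nonneg (sq_nonneg (chi _ _))]
          exact mul_le_of_le_one_right (abs_nonneg _) (chi2 _ _)
        refine (abs_sub _ _).trans (add_le_add ?_ q2)
        rw [abs_of_nonneg (by positivity)]
        linarith
      refine (norm_sub_le _ _).trans (add_le_add ?_ ?_)
      · rw [norm_mul, Real.norm_of_nonneg hW, Real.norm_eq_abs]
        gcongr
      · rw [norm_mul, norm_mul, norm_mul, Real.norm_eq_abs α, Real.norm_of_nonneg (sq_nonneg _),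
          Real.norm_of_nonneg (Real.exp_pos _).le, Real.norm_eq_abs]
        gcongr
        exact (mul_le_of_le_one_left (by positivity) (chi2 _ _)).trans (bEre x)
    · refine ae_of_all _ fun x => tendsto_const_nhds.congr' ?_
      filter_upwards [tendsto_chi_natCast (‖x‖ ^ 2)] with N hN
      rw [hN.1, hN.2]; ring
  have L4 : Tendsto (fun N => (k : ℝ) / 2 * (∫ x : Plane, S N (‖x‖ ^ 2) ^ 2 * ‖w x‖ ^ 2)
      - (k : ℝ) / 2 * ∑ i ∈ lowIdx k, hermiteT (fun x => ((S N (‖x‖ ^ 2) : ℝ) : ℂ) * w x) i) atTop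
      (𝓝 ((k : ℝ) / 2 * (∫ x, E x * ‖w x‖ ^ 2) - (k : ℝ) / 2 * ∑ i ∈ lowIdx k, 0)) :=
    (L1.const_mul _).sub ((tendsto_finsetSum (lowIdx k) L2).const_mul _)
  have hcS : ∀ N : ℕ, 1 ≤ N → HasCompactSupport (fun x : Plane => S N (‖x‖ ^ 2)) := fun N hN =>
    hasCompactSupport_chi_mul (by exact_mod_cast hN) (fun t => Real.exp (t / 8))
  have hgap := fun (N : ℕ) (hN : 1 ≤ N) => energy_gap_radial hm hw h (dS N) (cS N) (hcS N hN) k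
  have hfin := le_of_tendsto_of_tendsto L4 L3 ((eventually_ge_atTop 1).mono hgap)
  rw [Finset.sum_const_zero, mul_zero, sub_zero, integral_sub (he.const_mul _) (IEre.const_mul _),
    integral_const_mul, integral_const_mul, integral_exp_mul_velGradG_eq_zero hm hw he, mul_zero,
    sub_zero] at hfin
  have hpos : 0 < ∫ x, E x * ‖w x‖ ^ 2 := by
    refine lt_of_le_of_ne (integral_nonneg fun x => by positivity) fun h0 => hw0 ?_
    have := (integral_eq_zero_iff_of_nonneg (fun x => by positivity) he).1 h0.symm
    filter_upwards [this] with x hx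
    simpa [Real.exp_ne_zero, hE] using hx
  have : (k / 2 + z.re) * ∫ x, E x * ‖w x‖ ^ 2 ≤ 0 := by linarith
  have := nonpos_of_mul_nonpos_left this hpos
  linarith

/-- Above the threshold `(1-m)/2` the eigenfunction has Gaussian decay, and the gap applies with `k
= 1`: the only low Hermite polynomial is the constant, so zero mass suffices. -/
theorem re_le_of_isEigenvalueIn_L20 {m α : ℝ} (hm : 1 < m) {z : ℂ}
    (h : IsEigenvalueIn m α (L20 m) z) : z.re ≤ max (-(1 / 2)) ((1 - m) / 2) := by
  by_contra! hlt
  obtain ⟨w, ⟨hw, hmass⟩, hw0, -, -, heq⟩ := h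
  have he := integrable_exp_mul_norm_sq_of_lt hm hw heq ((le_max_right _ _).trans_lt hlt)
  have := re_le_of_forall_lowIdx hm hw heq hw0 he 1 fun i hi => by
    have : i = (0, 0) := by
      simp only [lowIdx, Finset.mem_filter] at hi
      ext <;> simp <;> omega
    subst this
    simpa [hermiteQ] using hmass
  have h2 := (le_max_left (-(1 / 2 : ℝ)) ((1 - m) / 2)).trans_lt hlt
  norm_num at this h2
  linarith

/-- The same argument with `k = 2`: the low Hermite polynomials are `1`, `x_0/2` and `x_1/2`, so
mass and first moments must vanish. -/
theorem re_le_of_isEigenvalueIn_L21 {m α : ℝ} (hm : 1 < m) {z : ℂ}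
    (h : IsEigenvalueIn m α (L21 m) z) : z.re ≤ max (-1) ((1 - m) / 2) := by
  by_contra! hlt
  obtain ⟨w, ⟨⟨hw, hmass⟩, hmom⟩, hw0, -, -, heq⟩ := h
  have he := integrable_exp_mul_norm_sq_of_lt hm hw heq ((le_max_right _ _).trans_lt hlt)
  have hmom' : ∀ j : Fin 2, ∫ x : Plane, ((1 / 2 * x j : ℝ) : ℂ) * w x = 0 := fun j => by
    have := hmom j
    push_cast
    simp only [mul_assoc]
    rw [integral_const_mul, this, mul_zero]
  have := re_le_of_forall_lowIdx hm hw heq hw0 he 2 fun i hi => by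
    have : i = (0, 0) ∨ i = (1, 0) ∨ i = (0, 1) := by
      simp only [lowIdx, Finset.mem_filter] at hi
      simp only [Prod.ext_iff]
      omega
    rcases this with rfl | rfl | rfl
    · simpa [hermiteQ] using hmass
    · simpa [hermiteQ] using hmom' 0
    · simpa [hermiteQ] using hmom' 1
  have h2 := (le_max_left (-1 : ℝ) ((1 - m) / 2)).trans_lt hlt
  norm_num at this
  linarith

end OseenVortex
end

theorem mainTheorem7 (m α : ℝ) (hm : 1 < m) :
    (∀ z : ℂ, OseenVortex.IsEigenvalueIn m α (OseenVortex.L20 m) z →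
      z.re ≤ max (-(1 / 2)) ((1 - m) / 2)) ∧
    (2 < m → ∀ z : ℂ, OseenVortex.IsEigenvalueIn m α (OseenVortex.L21 m) z →
      z.re ≤ max (-1) ((1 - m) / 2)) :=
  ⟨fun _ h => OseenVortex.re_le_of_isEigenvalueIn_L20 hm h,
    fun _ _ h => OseenVortex.re_le_of_isEigenvalueIn_L21 hm h⟩
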